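/- Let $n\ge 1$, let $k,l\ge 1$ be integers and let $A_{k,l}=(-\Delta)^l+|x|^{2k}+1$ on $\mathbb{R}^n$. Let $(u_j)_{j\in\mathbb{N}}$ be an orthonormal basis of $L^2(\mathbb{R}^n)$ consisting of eigenfunctions of $A_{k,l}$, $A_{k,l}u_j=\lambda_ju_j$. For a function $F:\mathbb{R}\to\mathbb{C}$ let $F(A_{k,l})f=\sum_j F(\lambda_j)\langle f,u_j\rangle_{L^2}\,u_j$ on the domain $\{f\in L^2(\mathbb{R}^n):\sum_j|F(\lambda_j)|^2|\langle f,u_j\rangle_{L^2}|^2<\infty\}$. Fix a window $0\ne g\in\mathcal{S}(\mathbb{R}^n)$ and put $V_gf(x,\xi)=\int f(y)\overline{g(y-x)}e^{-iy\cdot\xi}\,dy$ for $f\in\mathcal{S}'(\mathbb{R}^n)$ (distributional pairing). For a weight $w$, that is, a positive locally integrable function on $\mathbb{R}^{2n}$, and $1\le p,q\le\infty$ let $$\|f\|_{\mathcal{M}^{p,q}_w}=\Big(\int_{\mathbb{R}^n}\Big(\int_{\mathbb{R}^n}|V_gf(x,\xi)|^p\,w(x,\xi)^p\,dx\Big)^{q/p}d\xi\Big)^{1/q}$$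 (with essential suprema for infinite exponents), and let $\mathcal{M}^{p,q}_w$ be the space of all $f\in\mathcal{S}'(\mathbb{R}^n)$ for which this is finite. The weight $w$ is submultiplicative if $w(z_1+z_2)\le C\,w(z_1)w(z_2)$, and polynomially moderate if $w(z_1+z_2)\le C\,(1+|z_1|^2)^{s/2}\,w(z_2)$, for all $z_1,z_2\in\mathbb{R}^{2n}$ and some constants $C$, $s$. A bounded operator $T$ on a Banach space $\mathcal{B}$ is $r$-nuclear if $T=\sum_{j}\varphi_j\otimes\psi_j$ (that is, $Tf=\sum_j\psi_j(f)\varphi_j$ for all $f\in\mathcal{B}$) with $\varphi_j\in\mathcal{B}$, $\psi_j\in\mathcal{B}'$ and $\sum_j\|\psi_j\|^r\|\varphi_j\|^r<\infty$, and nuclear if it is $1$-nuclear. A nuclear operator $T$ has the trace $\operatorname{Tr}T=t$ if $\sum_j\psi_j(\varphi_j)=t$ for every such representation of $T$ with $r=1$. **Theorem.** Let $0<r\le1$, $1\le p,q<\infty$, $\frac1p+\frac1{p'}=\frac1q+\frac1{q'}=1$, and let $w$ be a submultiplicative polynomially moderate weight. Suppose that $$\sum_{j}|F(\lambda_j)|^r\,\|u_j\|^r_{\mathcal{M}^{p,q}_w}\,\|u_j\|^r_{\mathcal{M}^{p',q'}_{1/w}}<\infty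 .$$ Then $F(A_{k,l})$ is $r$-nuclear on $\mathcal{M}^{p,q}_w$: its domain intersected with $\mathcal{M}^{p,q}_w$ is dense in $\mathcal{M}^{p,q}_w$, and there $F(A_{k,l})$ agrees with a bounded operator on $\mathcal{M}^{p,q}_w$ that is $r$-nuclear. If the assumption holds with $r=1$, then the series $\sum_jF(\lambda_j)$ converges absolutely, and (the extension to $\mathcal{M}^{p,q}_w$ of) $F(A_{k,l})$ has the trace $$\operatorname{Tr}F(A_{k,l})=\sum_jF(\lambda_j).$$ -/

import Mathlib

open MeasureTheory SchwartzMap Laplacian Filter Topology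
open scoped ENNReal InnerProductSpace

/-! ### Nuclear operators and their trace -/

section Nuclear

variable {B : Type*} [SeminormedAddCommGroup B] [NormedSpace ℂ B]

/-- `T = ∑ⱼ φⱼ ⊗ ψⱼ` with `φⱼ ∈ B`, `ψⱼ ∈ B'` (the topological dual) and
`∑ⱼ ‖ψⱼ‖ʳ ‖φⱼ‖ʳ < ∞`. -/
structure IsNuclearRepresentation (r : ℝ) (T : B →L[ℂ] B) (φ : ℕ → B) (ψ : ℕ → (B →L[ℂ] ℂ)) :
    Prop where
  summable : Summable fun j => ‖ψ j‖ ^ r * ‖φ j‖ ^ r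
  hasSum : ∀ f : B, HasSum (fun j => ψ j f • φ j) (T f)

/-- `T` is `r`-nuclear (nuclear, if `r = 1`). -/
def IsRNuclear (r : ℝ) (T : B →L[ℂ] B) : Prop :=
  ∃ (φ : ℕ → B) (ψ : ℕ → (B →L[ℂ] ℂ)), IsNuclearRepresentation r T φ ψ

/-- `T` is nuclear and `t` is its (well-defined) nuclear trace: `∑ⱼ ψⱼ(φⱼ) = t` for every
representation `T = ∑ⱼ φⱼ ⊗ ψⱼ` with `∑ⱼ ‖ψⱼ‖ ‖φⱼ‖ < ∞`. -/
def HasNuclearTrace (T : B →L[ℂ] B) (t : ℂ) : Prop :=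
  IsRNuclear 1 T ∧
    ∀ (φ : ℕ → B) (ψ : ℕ → (B →L[ℂ] ℂ)), IsNuclearRepresentation 1 T φ ψ →
      HasSum (fun j => ψ j (φ j)) t

end Nuclear

/-! ### Weights on `ℝⁿ × ℝⁿ` -/

section Weights

variable {n : ℕ}

/-- A weight on the phase space: a positive, locally integrable function. -/
structure IsWeight (w : EuclideanSpace ℝ (Fin n) × EuclideanSpace ℝ (Fin n) → ℝ) : Prop where
  pos : ∀ z, 0 < w z
  locallyIntegrable : LocallyIntegrable w volume

/-- Submultiplicativity (up to a multiplicative constant). -/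
def IsSubmultiplicativeWeight (w : EuclideanSpace ℝ (Fin n) × EuclideanSpace ℝ (Fin n) → ℝ) :
    Prop :=
  ∃ C : ℝ, ∀ z₁ z₂, w (z₁ + z₂) ≤ C * (w z₁ * w z₂)

/-- The polynomial weight `v_s(x, ξ) = (1 + |x|² + |ξ|²)^(s/2)`, with Euclidean norms. -/
noncomputable def polyWeight (s : ℝ)
    (z : EuclideanSpace ℝ (Fin n) × EuclideanSpace ℝ (Fin n)) : ℝ :=
  (1 + ‖z.1‖ ^ 2 + ‖z.2‖ ^ 2) ^ (s / 2)

/-- `w` is `v_s`-moderate for some `s`. -/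
def IsPolynomiallyModerate (w : EuclideanSpace ℝ (Fin n) × EuclideanSpace ℝ (Fin n) → ℝ) : Prop :=
  ∃ s C : ℝ, ∀ z₁ z₂, w (z₁ + z₂) ≤ C * (polyWeight s z₁ * w z₂)

end Weights

/-! ### Mixed Lebesgue norms -/

section Mixed

variable {n : ℕ}

/-- The mixed norm `‖F‖_{L^{p,q}} = (∫ (∫ |F(x,ξ)|^p dx)^{q/p} dξ)^{1/q}`, with the usual
essential suprema when an exponent is `∞`. -/
noncomputable def mixedENorm (p q : ℝ≥0∞)
    (F : EuclideanSpace ℝ (Fin n) × EuclideanSpace ℝ (Fin n) → ℂ) : ℝ≥0∞ :=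
  eLpNorm (fun ξ => eLpNorm (fun x => F (x, ξ)) p volume) q volume

theorem mixedENorm_add_le {p q : ℝ≥0∞} (hp : 1 ≤ p) (hp' : p ≠ ∞) (hq : 1 ≤ q)
    {F G : EuclideanSpace ℝ (Fin n) × EuclideanSpace ℝ (Fin n) → ℂ}
    (hF : AEStronglyMeasurable F volume) (hG : AEStronglyMeasurable G volume) :
    mixedENorm p q (fun z => F z + G z) ≤ mixedENorm p q F + mixedENorm p q G := by
  have key : ∀ {H : EuclideanSpace ℝ (Fin n) × EuclideanSpace ℝ (Fin n) → ℂ},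
      AEStronglyMeasurable H volume →
      AEStronglyMeasurable (fun ξ => eLpNorm (fun x => H (x, ξ)) p volume) volume := by
    intro H hH
    have h0 : p ≠ 0 := (zero_lt_one.trans_le hp).ne'
    simp only [eLpNorm_eq_lintegral_rpow_enorm_toReal h0 hp']
    have h1 : AEMeasurable (fun z => ‖H z‖ₑ ^ p.toReal)
        ((volume : Measure (EuclideanSpace ℝ (Fin n))).prod volume) := by
      exact (hH.enorm.pow_const _)
    exact (h1.lintegral_prod_left'.pow_const _).aestronglyMeasurable
  have hFs : ∀ᵐ ξ ∂(volume : Measure (EuclideanSpace ℝ (Fin n))),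
      AEStronglyMeasurable (fun x => F (x, ξ)) volume :=
    AEStronglyMeasurable.prodMk_right (f := F) hF
  have hGs : ∀ᵐ ξ ∂(volume : Measure (EuclideanSpace ℝ (Fin n))),
      AEStronglyMeasurable (fun x => G (x, ξ)) volume :=
    AEStronglyMeasurable.prodMk_right (f := G) hG
  refine le_trans (eLpNorm_mono_enorm_ae (g := (fun ξ => eLpNorm (fun x => F (x, ξ)) p volume) +
    (fun ξ => eLpNorm (fun x => G (x, ξ)) p volume)) ?_) (eLpNorm_add_le (key hF) (key hG) hq)
  filter_upwards [hFs, hGs] with ξ h1 h2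
  exact eLpNorm_add_le h1 h2 hp

theorem mixedENorm_const_mul_le (p q : ℝ≥0∞) (c : ℂ)
    (F : EuclideanSpace ℝ (Fin n) × EuclideanSpace ℝ (Fin n) → ℂ) :
    mixedENorm p q (fun z => c * F z) ≤ ‖c‖ₑ * mixedENorm p q F := by
  refine eLpNorm_le_nnreal_smul_eLpNorm_of_ae_le_mul' (c := ‖c‖₊) (Eventually.of_forall fun ξ => ?_) q
  exact eLpNorm_const_smul_le (c := c) (f := fun x => F (x, ξ))

end Mixed

/-! ### The short-time Fourier transform and modulation spaces -/

section Modulation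

variable {n : ℕ}

theorem hasTemperateGrowth_cexp_inner (ξ : EuclideanSpace ℝ (Fin n)) :
    (fun y : EuclideanSpace ℝ (Fin n) =>
      Complex.exp (-(Complex.I * ((⟪y, ξ⟫_ℝ : ℝ) : ℂ)))).HasTemperateGrowth := by
  have h : (fun t : ℝ => Complex.exp (-(Complex.I * (t : ℂ)))).HasTemperateGrowth := by
    have hd : ∀ m : ℕ, iteratedDeriv m (fun t : ℝ => Complex.exp (-(Complex.I * (t : ℂ))))
        = fun t : ℝ => (-Complex.I) ^ m * Complex.exp (-(Complex.I * (t : ℂ))) := by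
      intro m
      induction m with
      | zero => simp
      | succ m ih =>
        rw [iteratedDeriv_succ, ih]
        funext t
        have h1 : HasDerivAt (fun t : ℝ => -(Complex.I * (t : ℂ))) (-(Complex.I * 1)) t :=
          ((Complex.ofRealCLM.hasDerivAt (x := t)).const_mul Complex.I).neg
        have h2 := (h1.cexp.const_mul ((-Complex.I) ^ m)).deriv
        rw [h2]
        ring
    refine ⟨(contDiff_const.mul Complex.ofRealCLM.contDiff).neg.cexp, fun m => ⟨0, 1, fun t => ?_⟩⟩
    rw [norm_iteratedFDeriv_eq_norm_iteratedDeriv, hd]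
    have : -(Complex.I * (t : ℂ)) = ((-t : ℝ) : ℂ) * Complex.I := by push_cast; ring
    simp [this, Complex.norm_exp_ofReal_mul_I, -Complex.ofReal_neg]
  exact h.comp (Function.hasTemperateGrowth_inner_left ξ)

/-- The test function `y ↦ conj (g (y - x)) * exp (-i y·ξ)` for `z = (x, ξ)`. -/
noncomputable def conjTimeFrequencyShift (g : 𝓢(EuclideanSpace ℝ (Fin n), ℂ))
    (z : EuclideanSpace ℝ (Fin n) × EuclideanSpace ℝ (Fin n)) :
    𝓢(EuclideanSpace ℝ (Fin n), ℂ) :=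
  smulLeftCLM ℂ (fun y => Complex.exp (-(Complex.I * ((⟪y, z.2⟫_ℝ : ℝ) : ℂ))))
    (compSubConstCLM ℂ z.1
      (postcompCLM (𝕜 := ℝ) (Complex.conjCLE : ℂ →L[ℝ] ℂ) g))

theorem conjTimeFrequencyShift_apply (g : 𝓢(EuclideanSpace ℝ (Fin n), ℂ))
    (z : EuclideanSpace ℝ (Fin n) × EuclideanSpace ℝ (Fin n)) (y : EuclideanSpace ℝ (Fin n)) :
    conjTimeFrequencyShift g z y =
      Complex.exp (-(Complex.I * ((⟪y, z.2⟫_ℝ : ℝ) : ℂ))) *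
        (starRingEnd ℂ) (g (y - z.1)) := by
  rw [conjTimeFrequencyShift, smulLeftCLM_apply_apply (hasTemperateGrowth_cexp_inner z.2)]
  rfl

/-- The short-time Fourier transform `V_g f (x, ξ) = ∫ f(y) conj (g (y - x)) exp (-i y·ξ) dy` of a
tempered distribution `f` with respect to the window `g`, the integral being the distributional
pairing. -/
noncomputable def stft (g : 𝓢(EuclideanSpace ℝ (Fin n), ℂ)) (f : 𝓢'(EuclideanSpace ℝ (Fin n), ℂ))
    (z : EuclideanSpace ℝ (Fin n) × EuclideanSpace ℝ (Fin n)) : ℂ :=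
  f (conjTimeFrequencyShift g z)

/-- The modulation norm `‖f‖_{M_w^{p,q}} = ‖w · V_g f‖_{L^{p,q}} ∈ [0, ∞]` of a tempered
distribution. -/
noncomputable def modulationENorm (g : 𝓢(EuclideanSpace ℝ (Fin n), ℂ))
    (w : EuclideanSpace ℝ (Fin n) × EuclideanSpace ℝ (Fin n) → ℝ) (p q : ℝ≥0∞)
    (f : 𝓢'(EuclideanSpace ℝ (Fin n), ℂ)) : ℝ≥0∞ :=
  mixedENorm p q (fun z => (w z : ℂ) * stft g f z)

/-- The tempered distributions `f` with `w · V_g f ∈ L^{p,q}`, as a subspace of `𝓢'`. Since `V_g f`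
is continuous, the measurability requirement only concerns the weight and holds whenever `w` is
measurable. -/
noncomputable def modulationSubmodule (g : 𝓢(EuclideanSpace ℝ (Fin n), ℂ))
    (w : EuclideanSpace ℝ (Fin n) × EuclideanSpace ℝ (Fin n) → ℝ) (p q : ℝ≥0∞)
    [hp : Fact (1 ≤ p)] [hp' : Fact (p ≠ ∞)] [hq : Fact (1 ≤ q)] :
    Submodule ℂ (𝓢'(EuclideanSpace ℝ (Fin n), ℂ)) where
  carrier := {f | AEStronglyMeasurable (fun z => (w z : ℂ) * stft g f z) volume ∧
    modulationENorm g w p q f < ∞}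
  zero_mem' := by
    have h : ∀ z, stft g 0 z = 0 := fun z => rfl
    constructor
    · simpa [h] using aestronglyMeasurable_const
    · simp [modulationENorm, mixedENorm, h]
  add_mem' := by
    rintro f₁ f₂ ⟨h₁, k₁⟩ ⟨h₂, k₂⟩
    have h : (fun z => (w z : ℂ) * stft g (f₁ + f₂) z)
        = fun z => (w z : ℂ) * stft g f₁ z + (w z : ℂ) * stft g f₂ z := by
      funext z
      exact mul_add _ _ _
    refine ⟨by rw [h]; exact h₁.add h₂, ?_⟩
    rw [modulationENorm, h]
    exact (mixedENorm_add_le hp.out hp'.out hq.out h₁ h₂).trans_lt (ENNReal.add_lt_top.2 ⟨k₁, k₂⟩)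
  smul_mem' := by
    rintro c f ⟨h₁, k₁⟩
    have h : (fun z => (w z : ℂ) * stft g (c • f) z)
        = fun z => c * ((w z : ℂ) * stft g f z) := by
      funext z
      exact mul_left_comm _ _ _
    refine ⟨by rw [h]; exact h₁.const_mul c, ?_⟩
    rw [modulationENorm, h]
    exact (mixedENorm_const_mul_le p q c _).trans_lt (ENNReal.mul_lt_top enorm_lt_top k₁)

/-- The modulation space `M_w^{p,q}(ℝⁿ)`, `1 ≤ p, q < ∞`, with window `g`. It is a type synonym of
`modulationSubmodule`, carrying the modulation norm instead of the topology of `𝓢'`. -/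
def ModulationSpace (g : 𝓢(EuclideanSpace ℝ (Fin n), ℂ))
    (w : EuclideanSpace ℝ (Fin n) × EuclideanSpace ℝ (Fin n) → ℝ) (p q : ℝ≥0∞)
    [Fact (1 ≤ p)] [Fact (p ≠ ∞)] [Fact (1 ≤ q)] [Fact (q ≠ ∞)] : Type :=
  ↥(modulationSubmodule g w p q)

namespace ModulationSpace

variable {g : 𝓢(EuclideanSpace ℝ (Fin n), ℂ)}
  {w : EuclideanSpace ℝ (Fin n) × EuclideanSpace ℝ (Fin n) → ℝ} {p q : ℝ≥0∞}
  [hp : Fact (1 ≤ p)] [hp' : Fact (p ≠ ∞)] [hq : Fact (1 ≤ q)] [hq' : Fact (q ≠ ∞)]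

noncomputable instance instAddCommGroup : AddCommGroup (ModulationSpace g w p q) :=
  inferInstanceAs (AddCommGroup ↥(modulationSubmodule g w p q))

noncomputable instance instModule : Module ℂ (ModulationSpace g w p q) :=
  inferInstanceAs (Module ℂ ↥(modulationSubmodule g w p q))

/-- The inclusion `M_w^{p,q} ⊆ 𝓢'`. -/
noncomputable def toDistribution : ModulationSpace g w p q →ₗ[ℂ] 𝓢'(EuclideanSpace ℝ (Fin n), ℂ) :=
  (modulationSubmodule g w p q).subtype

theorem modulationENorm_lt_top (f : ModulationSpace g w p q) :
    modulationENorm g w p q (toDistribution f) < ∞ := f.2.2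

theorem modulationENorm_smul_le (c : ℂ) (f : ModulationSpace g w p q) :
    modulationENorm g w p q (toDistribution (c • f))
      ≤ ‖c‖ₑ * modulationENorm g w p q (toDistribution f) := by
  have h : (fun z => (w z : ℂ) * stft g (toDistribution (c • f)) z)
      = fun z => c * ((w z : ℂ) * stft g (toDistribution f) z) := by
    funext z
    exact mul_left_comm _ _ _
  rw [modulationENorm, h]
  exact mixedENorm_const_mul_le p q c _

theorem modulationENorm_add_le (f₁ f₂ : ModulationSpace g w p q) :
    modulationENorm g w p q (toDistribution (f₁ + f₂))
      ≤ modulationENorm g w p q (toDistribution f₁)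
        + modulationENorm g w p q (toDistribution f₂) := by
  have h : (fun z => (w z : ℂ) * stft g (toDistribution (f₁ + f₂)) z)
      = fun z => (w z : ℂ) * stft g (toDistribution f₁) z
        + (w z : ℂ) * stft g (toDistribution f₂) z := by
    funext z
    exact mul_add _ _ _
  rw [modulationENorm, h]
  exact mixedENorm_add_le hp.out hp'.out hq.out f₁.2.1 f₂.2.1

/-- The modulation norm on the modulation space. -/
noncomputable def addGroupSeminorm : AddGroupSeminorm (ModulationSpace g w p q) where
  toFun f := (modulationENorm g w p q (toDistribution f)).toReal
  map_zero' := by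
    have h := modulationENorm_smul_le (0 : ℂ) (0 : ModulationSpace g w p q)
    rw [zero_smul, enorm_zero, zero_mul] at h
    rw [nonpos_iff_eq_zero.1 h, ENNReal.toReal_zero]
  add_le' f₁ f₂ := by
    rw [← ENNReal.toReal_add (modulationENorm_lt_top f₁).ne (modulationENorm_lt_top f₂).ne]
    exact ENNReal.toReal_mono
      (ENNReal.add_lt_top.2 ⟨modulationENorm_lt_top f₁, modulationENorm_lt_top f₂⟩).ne
      (modulationENorm_add_le f₁ f₂)
  neg' f := by
    have h₁ : modulationENorm g w p q (toDistribution (-f))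
        ≤ modulationENorm g w p q (toDistribution f) := by
      simpa using modulationENorm_smul_le (-1 : ℂ) f
    have h₂ : modulationENorm g w p q (toDistribution f)
        ≤ modulationENorm g w p q (toDistribution (-f)) := by
      simpa using modulationENorm_smul_le (-1 : ℂ) (-f)
    rw [le_antisymm h₁ h₂]

/-- The modulation norm. (For a nonzero window and a positive weight it is definite.) -/
noncomputable instance instSeminormedAddCommGroup :
    SeminormedAddCommGroup (ModulationSpace g w p q) :=
  { addGroupSeminorm.toSeminormedAddGroup, instAddCommGroup with }

theorem norm_def (f : ModulationSpace g w p q) :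
    ‖f‖ = (modulationENorm g w p q (toDistribution f)).toReal := rfl

noncomputable instance instNormedSpace : NormedSpace ℂ (ModulationSpace g w p q) where
  norm_smul_le c f := by
    have h := ENNReal.toReal_mono
      (ENNReal.mul_lt_top enorm_lt_top (modulationENorm_lt_top f)).ne (modulationENorm_smul_le c f)
    rw [ENNReal.toReal_mul, toReal_enorm] at h
    exact h

end ModulationSpace

end Modulation

/-! ### The anharmonic oscillator and its functional calculus -/

section Anharmonic

variable {n : ℕ}

/-- The anharmonic oscillator `A_{k,l} = (-Δ)^l + |x|^{2k} + 1`, acting on tempered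
distributions. -/
noncomputable def anharmonicOscillator (k l : ℕ) (f : 𝓢'(EuclideanSpace ℝ (Fin n), ℂ)) :
    𝓢'(EuclideanSpace ℝ (Fin n), ℂ) :=
  (fun v : 𝓢'(EuclideanSpace ℝ (Fin n), ℂ) => -(Δ v))^[l] f
    + TemperedDistribution.smulLeftCLM ℂ
        (fun x : EuclideanSpace ℝ (Fin n) => ((‖x‖ ^ (2 * k) : ℝ) : ℂ)) f
    + f

/-- `(uⱼ)` is an orthonormal basis of `L²(ℝⁿ)` consisting of eigenfunctions of `A_{k,l}`, with
`A_{k,l} uⱼ = λⱼ uⱼ`. (The self-adjoint realization of `A_{k,l}` in `L²` has the domain of all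
`f ∈ L²` for which the distribution `A_{k,l} f` is in `L²`, so its eigenfunctions are the `f ∈ L²`
that satisfy the eigenvalue equation in `𝓢'`.) -/
def IsAnharmonicEigenbasis (k l : ℕ)
    (u : HilbertBasis ℕ ℂ (Lp ℂ 2 (volume : Measure (EuclideanSpace ℝ (Fin n)))))
    (lam : ℕ → ℝ) : Prop :=
  ∀ j, anharmonicOscillator k l (Lp.toTemperedDistribution (u j))
    = (lam j : ℂ) • Lp.toTemperedDistribution (u j)

/-- The maximal domain `{f | ∑ⱼ |mⱼ|² |⟨uⱼ, f⟩|² < ∞}` of the operator `f ↦ ∑ⱼ mⱼ ⟨uⱼ, f⟩ uⱼ`. -/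
noncomputable def spectralDomain {H : Type*} [NormedAddCommGroup H] [InnerProductSpace ℂ H]
    (u : HilbertBasis ℕ ℂ H) (m : ℕ → ℂ) : Submodule ℂ H where
  carrier := {f | Memℓp (fun j => m j * u.repr f j) 2}
  zero_mem' := by
    have h : (fun j => m j * u.repr 0 j) = 0 := by funext j; simp
    change Memℓp (fun j => m j * u.repr 0 j) 2
    rw [h]
    exact zero_memℓp
  add_mem' := by
    intro f₁ f₂ h₁ h₂
    have h : (fun j => m j * u.repr (f₁ + f₂) j)
        = (fun j => m j * u.repr f₁ j) + fun j => m j * u.repr f₂ j := by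
      funext j; simp [mul_add]
    change Memℓp (fun j => m j * u.repr (f₁ + f₂) j) 2
    rw [h]
    exact Memℓp.add h₁ h₂
  smul_mem' := by
    intro c f h₁
    have h : (fun j => m j * u.repr (c • f) j) = c • fun j => m j * u.repr f j := by
      funext j; simp [mul_left_comm]
    change Memℓp (fun j => m j * u.repr (c • f) j) 2
    rw [h]
    exact Memℓp.const_smul h₁ c

/-- The sequence of coefficients `mⱼ ⟨uⱼ, f⟩`, as an element of `ℓ²`. -/
noncomputable def spectralCoeff {H : Type*} [NormedAddCommGroup H] [InnerProductSpace ℂ H]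
    (u : HilbertBasis ℕ ℂ H) (m : ℕ → ℂ) : spectralDomain u m →ₗ[ℂ] lp (fun _ : ℕ => ℂ) 2 where
  toFun f := ⟨fun j => m j * u.repr f.1 j, f.2⟩
  map_add' f₁ f₂ := by
    ext j
    change m j * u.repr (f₁.1 + f₂.1) j = m j * u.repr f₁.1 j + m j * u.repr f₂.1 j
    simp [mul_add]
  map_smul' c f := by
    ext j
    change m j * u.repr (c • f.1) j = c * (m j * u.repr f.1 j)
    simp [mul_left_comm]

/-- The operator `f ↦ ∑ⱼ mⱼ ⟨uⱼ, f⟩ uⱼ` in a Hilbert space with orthonormal basis `(uⱼ)`, on its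
maximal domain. If `A uⱼ = λⱼ uⱼ` for all `j` and `mⱼ = F(λⱼ)`, then this is the operator `F(A)` of
the functional calculus. -/
noncomputable def spectralMultiplier {H : Type*} [NormedAddCommGroup H] [InnerProductSpace ℂ H]
    (u : HilbertBasis ℕ ℂ H) (m : ℕ → ℂ) : H →ₗ.[ℂ] H where
  domain := spectralDomain u m
  toFun := u.repr.symm.toLinearEquiv.toLinearMap ∘ₗ spectralCoeff u m

/-- The bounded operator `T` on `M_w^{p,q}` is the operator `S`, given in `L²`: the elements of the
domain of `S` that lie in `M_w^{p,q}` are dense in `M_w^{p,q}`, and there `T` agrees with `S`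
(all functions being identified with tempered distributions). -/
structure IsRealization {g : 𝓢(EuclideanSpace ℝ (Fin n), ℂ)}
    {w : EuclideanSpace ℝ (Fin n) × EuclideanSpace ℝ (Fin n) → ℝ} {p q : ℝ≥0∞}
    [Fact (1 ≤ p)] [Fact (p ≠ ∞)] [Fact (1 ≤ q)] [Fact (q ≠ ∞)]
    (S : Lp ℂ 2 (volume : Measure (EuclideanSpace ℝ (Fin n))) →ₗ.[ℂ]
      Lp ℂ 2 (volume : Measure (EuclideanSpace ℝ (Fin n))))
    (T : ModulationSpace g w p q →L[ℂ] ModulationSpace g w p q) : Prop where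
  dense : Dense {a : ModulationSpace g w p q | ∃ f : S.domain,
    ModulationSpace.toDistribution a = Lp.toTemperedDistribution f.1}
  agrees : ∀ (a : ModulationSpace g w p q) (f : S.domain),
    ModulationSpace.toDistribution a = Lp.toTemperedDistribution f.1 →
      ModulationSpace.toDistribution (T a) = Lp.toTemperedDistribution (S f)

end Anharmonic

/-!
Write `g_z` for the time-frequency shift of the window `g` by `z` and `κ = (2π)ⁿ ‖g‖²`. Everything
rests on the inversion formula `κ f = ∫ V_g f(z) g_z dz`.

Paired with `h ∈ M_{1/w}^{p',q'}`, it shows by Hölder's inequality that `⟨h, ·⟩` extends to a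
functional on `M_w^{p,q}` of norm at most `κ⁻¹ ‖h‖`. So `F(A)` is the sum of the rank-one operators
`F(λⱼ) ⟨uⱼ, ·⟩ uⱼ`, of norm at most `κ⁻¹ |F(λⱼ)| ‖uⱼ‖ ‖uⱼ‖`. Since `‖uⱼ‖ ‖uⱼ‖ ≥ κ > 0`, both norms
of `uⱼ` are finite as soon as `F(λⱼ) ≠ 0`.

For finite exponents, `κ ψ(a) = ∫ V_g a(z) ψ(g_z) dz` for every functional `ψ` on `M_w^{p,q}`.
Hence a functional that vanishes on `L² ∩ M_w^{p,q}`, which contains every `g_z`, is zero, so this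
space is dense. And `κ ∑ⱼ ψⱼ(φⱼ) = ∫ ∑ⱼ V_g φⱼ(z) ψⱼ(g_z) dz = ∫ V_g(T g_z)(z) dz` for every nuclear
representation of `T`, so the trace depends on `T` alone. It is `∑ⱼ F(λⱼ)` because `⟨uⱼ, uⱼ⟩ = 1`.
-/

/-! ### Mixed Lebesgue norms -/

section LebesgueNorm

variable {X Y T : Type*} [MeasurableSpace X] [MeasurableSpace Y] [MeasurableSpace T]
  {μ : Measure X} {ν : Measure T}

theorem eLpNorm_ennreal_eq_lintegral_rpow {p : ℝ≥0∞} (hp₀ : p ≠ 0) (hp : p ≠ ∞) (f : X → ℝ≥0∞) :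
    eLpNorm f p μ = (∫⁻ x, f x ^ p.toReal ∂μ) ^ (1 / p.toReal) := by
  simp only [eLpNorm_eq_lintegral_rpow_enorm_toReal hp₀ hp, enorm_eq_self]

theorem eLpNorm_ennreal_mono_ae {p : ℝ≥0∞} {f g : X → ℝ≥0∞} (h : f ≤ᵐ[μ] g) :
    eLpNorm f p μ ≤ eLpNorm g p μ :=
  eLpNorm_mono_enorm_ae (h.mono fun x hx => by simpa only [enorm_eq_self] using hx)

theorem eLpNorm_ennreal_const_mul (p : ℝ≥0∞) {c : ℝ≥0∞} (hc : c ≠ ∞) (f : X → ℝ≥0∞) :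
    eLpNorm (fun x => c * f x) p μ = c * eLpNorm f p μ := by
  rcases eq_or_ne p 0 with rfl | hp₀
  · simp
  rcases eq_or_ne p ∞ with rfl | hp
  · simpa only [eLpNorm_exponent_top, eLpNormEssSup_eq_essSup_enorm, enorm_eq_self]
      using ENNReal.essSup_const_mul
  have hp' : 0 < p.toReal := ENNReal.toReal_pos hp₀ hp
  simp only [eLpNorm_ennreal_eq_lintegral_rpow hp₀ hp, ENNReal.mul_rpow_of_nonneg _ _ hp'.le]
  rw [lintegral_const_mul' _ _ (ENNReal.rpow_ne_top_of_nonneg hp'.le hc),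
    ENNReal.mul_rpow_of_nonneg _ _ (by positivity), one_div, ENNReal.rpow_rpow_inv hp'.ne']

theorem measurable_eLpNorm_prodMk_right [SFinite μ] (p : ℝ≥0∞) {G : X × Y → ℝ≥0∞}
    (hG : Measurable G) : Measurable fun y => eLpNorm (fun x => G (x, y)) p μ := by
  rcases eq_or_ne p 0 with rfl | hp₀
  · simp
  rcases eq_or_ne p ∞ with rfl | hp
  · have essSup_gt (c : ℝ≥0∞) : {y | eLpNorm (fun x => G (x, y)) ∞ μ ≤ c}
        = {y | μ ((fun x => (x, y)) ⁻¹' (G ⁻¹' Set.Ioi c)) = 0} := by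
      ext y
      have : μ ((fun x => (x, y)) ⁻¹' (G ⁻¹' Set.Ioi c)) = 0 ↔ ∀ᵐ x ∂μ, G (x, y) ≤ c := by
        simp only [ae_iff, not_le]
        rfl
      simp only [Set.mem_ofPred_eq, this, eLpNorm_exponent_top, eLpNormEssSup_eq_essSup_enorm,
        enorm_eq_self]
      exact ⟨fun h => (ENNReal.ae_le_essSup _).mono fun x hx => hx.trans h,
        essSup_le_of_ae_le c⟩
    refine measurable_of_Iic fun c => ?_
    change MeasurableSet {y | eLpNorm (fun x => G (x, y)) ∞ μ ≤ c}
    rw [essSup_gt]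
    exact measurableSet_eq_fun (measurable_measure_prodMk_right (hG measurableSet_Ioi))
      measurable_const
  · simp only [eLpNorm_ennreal_eq_lintegral_rpow hp₀ hp]
    exact ((hG.pow_const _).lintegral_prod_left').pow_const _

theorem lintegral_le_of_forall_le_of_lintegral_lt_top [SigmaFinite μ] {f : X → ℝ≥0∞} {c : ℝ≥0∞}
    (h : ∀ g : X → ℝ≥0∞, Measurable g → g ≤ f → ∫⁻ x, g x ∂μ < ∞ → ∫⁻ x, g x ∂μ ≤ c) :
    ∫⁻ x, f x ∂μ ≤ c := by
  rw [lintegral_eq_nnreal]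
  refine iSup₂_le fun φ hφ => ?_
  rw [← SimpleFunc.lintegral_eq_lintegral]
  by_contra! hlt
  obtain ⟨ψ, hψφ, hψ, hcψ⟩ := SimpleFunc.exists_lt_lintegral_simpleFunc_of_lt_lintegral hlt
  exact hcψ.not_ge (h _ ψ.measurable.coe_nnreal_ennreal
    (fun x => (ENNReal.coe_le_coe.2 (hψφ x)).trans (hφ x)) hψ)

theorem lintegral_le_rpow_mul_lintegral_of_le_rpow [SFinite μ] [SFinite ν] {p q : ℝ}
    (hpq : p.HolderConjugate q) {G : X × T → ℝ≥0∞} (hG : Measurable G) {h : X → ℝ≥0∞}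
    (hh : Measurable h) (hle : ∀ x, h x ≤ (∫⁻ t, G (x, t) ∂ν) ^ p) :
    ∫⁻ x, h x ∂μ ≤ (∫⁻ x, h x ∂μ) ^ (1 / q) * ∫⁻ t, (∫⁻ x, G (x, t) ^ p ∂μ) ^ (1 / p) ∂ν := by
  have hpq' : 1 / q + 1 / p = 1 := by simpa [add_comm] using hpq.inv_add_inv_eq_one
  -- Hölder's inequality on `h = h^(1/q) * h^(1/p)`, where the second factor is at most `∫ G(·, t)`
  calc ∫⁻ x, h x ∂μ ≤ ∫⁻ x, ∫⁻ t, h x ^ (1 / q) * G (x, t) ∂ν ∂μ := by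
        refine lintegral_mono fun x => ?_
        rw [lintegral_const_mul (f := fun t => G (x, t)) _ (hG.comp measurable_prodMk_left)]
        calc h x = h x ^ (1 / q) * h x ^ (1 / p) := by
              rw [← ENNReal.rpow_add_of_nonneg _ _ hpq.symm.one_div_nonneg hpq.one_div_nonneg,
                hpq', ENNReal.rpow_one]
          _ ≤ h x ^ (1 / q) * ∫⁻ t, G (x, t) ∂ν := by
              gcongr
              rw [one_div, ENNReal.rpow_inv_le_iff hpq.pos]
              exact hle x
    _ = ∫⁻ t, ∫⁻ x, h x ^ (1 / q) * G (x, t) ∂μ ∂ν :=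
        lintegral_lintegral_swap (((hh.comp measurable_fst).pow_const _).mul hG).aemeasurable
    _ ≤ ∫⁻ t, (∫⁻ x, h x ∂μ) ^ (1 / q) * (∫⁻ x, G (x, t) ^ p ∂μ) ^ (1 / p) ∂ν := by
        refine lintegral_mono fun t => ?_
        refine (ENNReal.lintegral_mul_le_Lp_mul_Lq μ hpq.symm (hh.pow_const _).aemeasurable
          (hG.comp measurable_prodMk_right).aemeasurable).trans_eq ?_
        simp only [one_div, ENNReal.rpow_inv_rpow hpq.symm.ne_zero]
        rfl
    _ = (∫⁻ x, h x ∂μ) ^ (1 / q) * ∫⁻ t, (∫⁻ x, G (x, t) ^ p ∂μ) ^ (1 / p) ∂ν :=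
        lintegral_const_mul _ ((hG.pow_const _).lintegral_prod_left'.pow_const _)

theorem lintegral_lintegral_rpow_le [SigmaFinite μ] [SFinite ν] {p : ℝ} (hp : 1 ≤ p)
    {G : X × T → ℝ≥0∞} (hG : Measurable G) :
    (∫⁻ x, (∫⁻ t, G (x, t) ∂ν) ^ p ∂μ) ^ (1 / p)
      ≤ ∫⁻ t, (∫⁻ x, G (x, t) ^ p ∂μ) ^ (1 / p) ∂ν := by
  rcases hp.eq_or_lt with rfl | hp₁
  · simpa using (lintegral_lintegral_swap (f := fun x t => G (x, t)) hG.aemeasurable).le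
  have hp₀ : 0 < p := zero_lt_one.trans hp₁
  have hpq := Real.HolderConjugate.conjExponent hp₁
  set q := p.conjExponent
  have hpq' : 1 / q + 1 / p = 1 := by simpa [add_comm] using hpq.inv_add_inv_eq_one
  rw [one_div, ENNReal.rpow_inv_le_iff hp₀]
  refine lintegral_le_of_forall_le_of_lintegral_lt_top fun h hh hle hfin => ?_
  rw [← ENNReal.rpow_inv_le_iff hp₀, ← one_div]
  rcases eq_or_ne (∫⁻ x, h x ∂μ) 0 with h₀ | h₀
  · simp [h₀, hp₀]
  have h₁ : (∫⁻ x, h x ∂μ) ^ (1 / q) ≠ 0 := by simp [h₀, hfin.ne]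
  have h₂ : (∫⁻ x, h x ∂μ) ^ (1 / q) ≠ ∞ :=
    ENNReal.rpow_ne_top_of_nonneg hpq.symm.one_div_nonneg hfin.ne
  rw [← ENNReal.mul_le_mul_iff_right h₁ h₂, ← ENNReal.rpow_add _ _ h₀ hfin.ne, hpq',
    ENNReal.rpow_one]
  exact lintegral_le_rpow_mul_lintegral_of_le_rpow hpq hG hh hle

theorem eLpNorm_lintegral_le [SigmaFinite μ] [SFinite ν] {p : ℝ≥0∞} (hp : 1 ≤ p) (hp' : p ≠ ∞)
    {G : X × T → ℝ≥0∞} (hG : Measurable G) :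
    eLpNorm (fun x => ∫⁻ t, G (x, t) ∂ν) p μ ≤ ∫⁻ t, eLpNorm (fun x => G (x, t)) p μ ∂ν := by
  simp only [eLpNorm_ennreal_eq_lintegral_rpow (zero_lt_one.trans_le hp).ne' hp']
  exact lintegral_lintegral_rpow_le (ENNReal.toReal_mono hp' hp) hG

theorem lintegral_mul_le_eLpNorm_one_mul_eLpNorm_top {f : X → ℝ≥0∞} (hf : AEMeasurable f μ)
    (g : X → ℝ≥0∞) : ∫⁻ x, f x * g x ∂μ ≤ eLpNorm f 1 μ * eLpNorm g ∞ μ := by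
  simp only [eLpNorm_one_eq_lintegral_enorm, eLpNorm_exponent_top, eLpNormEssSup_eq_essSup_enorm,
    enorm_eq_self]
  rw [← lintegral_mul_const'' _ hf]
  exact lintegral_mono_ae ((ENNReal.ae_le_essSup g).mono fun x hx => by gcongr)

theorem lintegral_mul_le_eLpNorm_mul_eLpNorm (p q : ℝ≥0∞) [hpq : p.HolderConjugate q]
    {f g : X → ℝ≥0∞} (hf : AEMeasurable f μ) (hg : AEMeasurable g μ) :
    ∫⁻ x, f x * g x ∂μ ≤ eLpNorm f p μ * eLpNorm g q μ := by
  rcases eq_or_ne p ∞ with rfl | hp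
  · obtain rfl : q = 1 := (ENNReal.HolderConjugate.eq_top_iff_eq_one ∞ q).1 rfl
    simpa only [mul_comm] using lintegral_mul_le_eLpNorm_one_mul_eLpNorm_top hg f
  rcases eq_or_ne q ∞ with rfl | hq
  · obtain rfl : p = 1 := (ENNReal.HolderConjugate.eq_top_iff_eq_one ∞ p).1 rfl
    exact lintegral_mul_le_eLpNorm_one_mul_eLpNorm_top hf g
  rw [eLpNorm_ennreal_eq_lintegral_rpow (ENNReal.HolderConjugate.ne_zero p q) hp,
    eLpNorm_ennreal_eq_lintegral_rpow (ENNReal.HolderConjugate.ne_zero q p) hq]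
  exact ENNReal.lintegral_mul_le_Lp_mul_Lq μ
    (ENNReal.HolderConjugate.toReal_of_ne_top hp hq) hf hg

theorem ae_lt_top_of_eLpNorm_ne_top {p : ℝ≥0∞} (hp₀ : p ≠ 0) {f : X → ℝ≥0∞}
    (hf : AEMeasurable f μ) (h : eLpNorm f p μ ≠ ∞) : ∀ᵐ x ∂μ, f x < ∞ := by
  rcases eq_or_ne p ∞ with rfl | hp
  · simp only [eLpNorm_exponent_top, eLpNormEssSup_eq_essSup_enorm, enorm_eq_self] at h
    exact (ENNReal.ae_le_essSup f).mono fun x hx => hx.trans_lt h.lt_top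
  have hp' : 0 < p.toReal := ENNReal.toReal_pos hp₀ hp
  have hint : ∫⁻ x, f x ^ p.toReal ∂μ ≠ ∞ := by
    simpa [eLpNorm_ennreal_eq_lintegral_rpow hp₀ hp, hp'] using h
  exact (ae_lt_top' (hf.pow_const _) hint).mono
    fun x => (ENNReal.rpow_lt_top_iff_of_pos hp').1

theorem tendsto_eLpNorm_zero_of_dominated {p : ℝ≥0∞} (hp : p ≠ ∞) {G : ℕ → X → ℝ≥0∞}
    {B : X → ℝ≥0∞} (hG : ∀ j, AEMeasurable (G j) μ) (hB : eLpNorm B p μ ≠ ∞)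
    (hle : ∀ j, G j ≤ᵐ[μ] B) (hlim : ∀ᵐ x ∂μ, Tendsto (fun j => G j x) atTop (𝓝 0)) :
    Tendsto (fun j => eLpNorm (G j) p μ) atTop (𝓝 0) := by
  rcases eq_or_ne p 0 with rfl | hp₀
  · simp
  have hp' : 0 < p.toReal := ENNReal.toReal_pos hp₀ hp
  have tendsto_rpow_zero {ι : Type _} {l : Filter ι} {f : ι → ℝ≥0∞} {s : ℝ} (hs : 0 < s)
      (hf : Tendsto f l (𝓝 0)) : Tendsto (fun i => f i ^ s) l (𝓝 0) := by
    simpa [hs, Function.comp_def] using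
      (ENNReal.continuous_rpow_const (y := s)).continuousAt.tendsto.comp hf
  simp only [eLpNorm_ennreal_eq_lintegral_rpow hp₀ hp] at hB ⊢
  refine tendsto_rpow_zero (one_div_pos.2 hp') ?_
  rw [← lintegral_zero (μ := μ)]
  refine tendsto_lintegral_of_dominated_convergence' (fun x => B x ^ p.toReal)
    (fun j => (hG j).pow_const _)
    (fun j => (hle j).mono fun x hx => ENNReal.rpow_le_rpow hx hp'.le)
    (by simpa [hp'] using hB) (hlim.mono fun x => tendsto_rpow_zero hp')

end LebesgueNorm

section MixedNorm

variable {X Y T : Type*} [MeasureSpace X] [MeasureSpace Y] [MeasurableSpace T] {ν : Measure T}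
  {p q : ℝ≥0∞} {F G : X × Y → ℝ≥0∞}

/-- The mixed norm `(∫ (∫ G(x,ξ)^p dx)^{q/p} dξ)^{1/q}` of a function with values in `[0, ∞]`.
Keeping the value `∞` allows the norm of a formal series or integral to be estimated before its
convergence is known. -/
noncomputable def mixedLNorm (p q : ℝ≥0∞) (G : X × Y → ℝ≥0∞) : ℝ≥0∞ :=
  eLpNorm (fun ξ => eLpNorm (fun x => G (x, ξ)) p volume) q volume

theorem mixedENorm_eq_mixedLNorm {n : ℕ} (p q : ℝ≥0∞)
    (F : EuclideanSpace ℝ (Fin n) × EuclideanSpace ℝ (Fin n) → ℂ) :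
    mixedENorm p q F = mixedLNorm p q (fun z => ‖F z‖ₑ) := by
  simp only [mixedENorm, mixedLNorm, eLpNorm_enorm]

theorem mixedLNorm_mono (h : F ≤ G) : mixedLNorm p q F ≤ mixedLNorm p q G :=
  eLpNorm_ennreal_mono_ae (.of_forall fun ξ =>
    eLpNorm_ennreal_mono_ae (.of_forall fun x => h (x, ξ)))

theorem mixedLNorm_const_mul (p q : ℝ≥0∞) {c : ℝ≥0∞} (hc : c ≠ ∞) (G : X × Y → ℝ≥0∞) :
    mixedLNorm p q (fun z => c * G z) = c * mixedLNorm p q G := by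
  simp only [mixedLNorm, eLpNorm_ennreal_const_mul _ hc]

section SFinite

variable [SFinite (volume : Measure X)] [SFinite (volume : Measure Y)]

theorem ae_ae_of_ae_prod_swap {P : X × Y → Prop} (h : ∀ᵐ z, P z) :
    ∀ᵐ ξ : Y, ∀ᵐ x : X, P (x, ξ) :=
  Measure.ae_ae_of_ae_prod (p := fun z : Y × X => P z.swap)
    (Measure.measurePreserving_swap.quasiMeasurePreserving.ae h)

theorem ae_prod_mem_of_ae_ae_mem {s : Set (X × Y)} (hs : MeasurableSet s)
    (h : ∀ᵐ ξ : Y, ∀ᵐ x : X, (x, ξ) ∈ s) : ∀ᵐ z, z ∈ s :=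
  (Measure.measurePreserving_swap (μ := (volume : Measure X))
    (ν := (volume : Measure Y))).quasiMeasurePreserving.ae
    ((Measure.ae_prod_mem_iff_ae_ae_mem (measurable_swap hs)).2 h)

theorem mixedLNorm_mono_ae (h : F ≤ᵐ[volume] G) : mixedLNorm p q F ≤ mixedLNorm p q G :=
  eLpNorm_ennreal_mono_ae ((ae_ae_of_ae_prod_swap h).mono fun _ => eLpNorm_ennreal_mono_ae)

theorem mixedLNorm_congr_ae (h : F =ᵐ[volume] G) : mixedLNorm p q F = mixedLNorm p q G :=
  le_antisymm (mixedLNorm_mono_ae h.le) (mixedLNorm_mono_ae h.symm.le)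

theorem lintegral_mul_le_mixedLNorm_mul_mixedLNorm (p p' q q' : ℝ≥0∞) [p.HolderConjugate p']
    [q.HolderConjugate q'] (hF : AEMeasurable F volume) (hG : AEMeasurable G volume) :
    ∫⁻ z, F z * G z ≤ mixedLNorm p q F * mixedLNorm p' q' G := by
  rw [mixedLNorm_congr_ae hF.ae_eq_mk, mixedLNorm_congr_ae hG.ae_eq_mk,
    lintegral_congr_ae (f := fun z => F z * G z) (hF.ae_eq_mk.mul hG.ae_eq_mk)]
  have hF' := hF.measurable_mk
  have hG' := hG.measurable_mk
  calc ∫⁻ z, hF.mk F z * hG.mk G z = ∫⁻ ξ, ∫⁻ x, hF.mk F (x, ξ) * hG.mk G (x, ξ) :=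
        lintegral_prod_symm' _ (hF'.mul hG')
    _ ≤ ∫⁻ ξ, eLpNorm (fun x => hF.mk F (x, ξ)) p volume
          * eLpNorm (fun x => hG.mk G (x, ξ)) p' volume :=
        lintegral_mono fun ξ => lintegral_mul_le_eLpNorm_mul_eLpNorm p p'
          (hF'.comp measurable_prodMk_right).aemeasurable
          (hG'.comp measurable_prodMk_right).aemeasurable
    _ ≤ mixedLNorm p q (hF.mk F) * mixedLNorm p' q' (hG.mk G) :=
        lintegral_mul_le_eLpNorm_mul_eLpNorm q q'
          (measurable_eLpNorm_prodMk_right p hF').aemeasurable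
          (measurable_eLpNorm_prodMk_right p' hG').aemeasurable

theorem ae_lt_top_of_mixedLNorm_ne_top (hp : p ≠ 0) (hq : q ≠ 0) (hG : AEMeasurable G volume)
    (h : mixedLNorm p q G ≠ ∞) : ∀ᵐ z, G z < ∞ := by
  rw [mixedLNorm_congr_ae hG.ae_eq_mk] at h
  have hG' := hG.measurable_mk
  have hmk : ∀ᵐ z, hG.mk G z < ∞ := by
    refine ae_prod_mem_of_ae_ae_mem (hG' measurableSet_Iio) ?_
    filter_upwards [ae_lt_top_of_eLpNorm_ne_top hq
      (measurable_eLpNorm_prodMk_right p hG').aemeasurable h] with ξ hξ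
    exact ae_lt_top_of_eLpNorm_ne_top hp (hG'.comp measurable_prodMk_right).aemeasurable hξ.ne
  filter_upwards [hmk, hG.ae_eq_mk] with z hz hz'
  rwa [hz']

theorem tendsto_mixedLNorm_zero_of_dominated (hp : p ≠ ∞) (hq₀ : q ≠ 0) (hq : q ≠ ∞)
    {G : ℕ → X × Y → ℝ≥0∞} {B : X × Y → ℝ≥0∞} (hG : ∀ j, AEMeasurable (G j) volume)
    (hBm : AEMeasurable B volume) (hB : mixedLNorm p q B ≠ ∞) (hle : ∀ j, G j ≤ᵐ[volume] B)
    (hlim : ∀ᵐ z, Tendsto (fun j => G j z) atTop (𝓝 0)) :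
    Tendsto (fun j => mixedLNorm p q (G j)) atTop (𝓝 0) := by
  rw [mixedLNorm_congr_ae hBm.ae_eq_mk] at hB
  simp_rw [fun j => mixedLNorm_congr_ae (p := p) (q := q) (hG j).ae_eq_mk]
  have hle' (j : ℕ) : (hG j).mk _ ≤ᵐ[volume] hBm.mk B :=
    (hG j).ae_eq_mk.symm.le.trans ((hle j).trans hBm.ae_eq_mk.le)
  have hlim' : ∀ᵐ z, Tendsto (fun j => (hG j).mk _ z) atTop (𝓝 0) := by
    filter_upwards [hlim, ae_all_iff.2 fun j => (hG j).ae_eq_mk] with z h₁ h₂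
    exact h₁.congr h₂
  have hfin : ∀ᵐ ξ, eLpNorm (fun x => hBm.mk B (x, ξ)) p volume < ∞ :=
    ae_lt_top_of_eLpNorm_ne_top hq₀
      (measurable_eLpNorm_prodMk_right p hBm.measurable_mk).aemeasurable hB
  refine tendsto_eLpNorm_zero_of_dominated hq
    (fun j => (measurable_eLpNorm_prodMk_right p (hG j).measurable_mk).aemeasurable) hB
    (fun j => (ae_ae_of_ae_prod_swap (hle' j)).mono fun _ => eLpNorm_ennreal_mono_ae) ?_
  filter_upwards [hfin, ae_ae_of_ae_prod_swap (ae_all_iff.2 hle'),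
    ae_ae_of_ae_prod_swap hlim'] with ξ hξ hleξ hlimξ
  exact tendsto_eLpNorm_zero_of_dominated hp
    (fun j => ((hG j).measurable_mk.comp measurable_prodMk_right).aemeasurable) hξ.ne
    (fun j => hleξ.mono fun x hx => hx j) hlimξ

end SFinite

section SigmaFinite

variable [SigmaFinite (volume : Measure X)] [SigmaFinite (volume : Measure Y)]

theorem mixedLNorm_lintegral_le [SFinite ν] (hp : 1 ≤ p) (hp' : p ≠ ∞) (hq : 1 ≤ q) (hq' : q ≠ ∞)
    {G : (X × Y) × T → ℝ≥0∞} (hG : Measurable G) :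
    mixedLNorm p q (fun z => ∫⁻ t, G (z, t) ∂ν) ≤ ∫⁻ t, mixedLNorm p q (fun z => G (z, t)) ∂ν := by
  have inner (ξ : Y) : eLpNorm (fun x => ∫⁻ t, G ((x, ξ), t) ∂ν) p volume
      ≤ ∫⁻ t, eLpNorm (fun x => G ((x, ξ), t)) p volume ∂ν :=
    eLpNorm_lintegral_le hp hp' (G := fun z : X × T => G ((z.1, ξ), z.2)) (hG.comp (by fun_prop))
  have hmeas : Measurable fun z : Y × T => eLpNorm (fun x => G ((x, z.1), z.2)) p volume :=
    measurable_eLpNorm_prodMk_right p (G := fun z : X × Y × T => G ((z.1, z.2.1), z.2.2))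
      (hG.comp (by fun_prop))
  calc mixedLNorm p q (fun z => ∫⁻ t, G (z, t) ∂ν)
    _ ≤ eLpNorm (fun ξ => ∫⁻ t, eLpNorm (fun x => G ((x, ξ), t)) p volume ∂ν) q volume :=
        eLpNorm_ennreal_mono_ae (ae_of_all _ inner)
    _ ≤ ∫⁻ t, mixedLNorm p q (fun z => G (z, t)) ∂ν :=
        eLpNorm_lintegral_le hq hq' (G := fun z => eLpNorm (fun x => G ((x, z.1), z.2)) p volume)
          hmeas

theorem mixedLNorm_tsum_le (hp : 1 ≤ p) (hp' : p ≠ ∞) (hq : 1 ≤ q) (hq' : q ≠ ∞)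
    {G : ℕ → X × Y → ℝ≥0∞} (hG : ∀ j, AEMeasurable (G j) volume) :
    mixedLNorm p q (fun z => ∑' j, G j z) ≤ ∑' j, mixedLNorm p q (G j) := by
  have htsum : (fun z => ∑' j, G j z) =ᵐ[volume] fun z => ∑' j, (hG j).mk _ z :=
    (ae_all_iff.2 fun j => (hG j).ae_eq_mk).mono fun z hz => tsum_congr hz
  rw [mixedLNorm_congr_ae htsum]
  simp_rw [fun j => mixedLNorm_congr_ae (p := p) (q := q) (hG j).ae_eq_mk]
  simpa only [lintegral_count] using mixedLNorm_lintegral_le hp hp' hq hq'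
    (ν := (Measure.count : Measure ℕ)) (G := fun z => (hG z.2).mk _ z.1)
    (measurable_from_prod_countable_left fun j => (hG j).measurable_mk)

end SigmaFinite

end MixedNorm

section Young

variable {E : Type*} [NormedAddCommGroup E] [MeasureSpace E] [BorelSpace E]
  [(volume : Measure E).IsAddHaarMeasure]

theorem eLpNorm_ennreal_sub_right (p : ℝ≥0∞) (f : E → ℝ≥0∞) (a : E) :
    eLpNorm (fun x => f (x - a)) p volume = eLpNorm f p volume := by
  calc eLpNorm (f ∘ MeasurableEquiv.subRight a) p volume
    _ = eLpNorm f p (Measure.map (MeasurableEquiv.subRight a) volume) :=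
        (MeasurableEquiv.subRight a).measurableEmbedding.eLpNorm_map_measure.symm
    _ = eLpNorm f p volume := by
        exact congrArg _ (measurePreserving_sub_right volume a).map_eq

theorem mixedLNorm_sub_right (p q : ℝ≥0∞) (G : E × E → ℝ≥0∞) (a : E × E) :
    mixedLNorm p q (fun z => G (z - a)) = mixedLNorm p q G := by
  have inner (ξ : E) : eLpNorm (fun x => G ((x, ξ) - a)) p volume
      = eLpNorm (fun x => G (x, ξ - a.2)) p volume :=
    eLpNorm_ennreal_sub_right p (fun x => G (x, ξ - a.2)) a.1
  simp only [mixedLNorm, inner]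
  exact eLpNorm_ennreal_sub_right q (fun ξ => eLpNorm (fun x => G (x, ξ)) p volume) a.2

theorem mixedLNorm_convolution_le [NormedSpace ℝ E] [FiniteDimensional ℝ E] {p q : ℝ≥0∞}
    (hp : 1 ≤ p) (hp' : p ≠ ∞) (hq : 1 ≤ q) (hq' : q ≠ ∞) {k G : E × E → ℝ≥0∞} (hk : Measurable k)
    (hk' : ∀ z, k z ≠ ∞) (hG : AEMeasurable G volume) :
    mixedLNorm p q (fun z => ∫⁻ z', k (z - z') * G z') ≤ (∫⁻ z, k z) * mixedLNorm p q G := by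
  have : (volume : Measure (E × E)).IsAddHaarMeasure :=
    inferInstanceAs ((volume : Measure E).prod volume).IsAddHaarMeasure
  have convolution_comm (z : E × E) :
      ∫⁻ z', k (z - z') * G z' = ∫⁻ t, k t * hG.mk G (z - t) := by
    rw [← lintegral_sub_left_eq_self (fun t => k t * hG.mk G (z - t)) z]
    exact lintegral_congr_ae (hG.ae_eq_mk.mono fun z' h => by simp [h])
  calc mixedLNorm p q (fun z => ∫⁻ z', k (z - z') * G z')
    _ = mixedLNorm p q (fun z => ∫⁻ t, k t * hG.mk G (z - t)) := by simp_rw [convolution_comm]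
    _ ≤ ∫⁻ t, mixedLNorm p q (fun z => k t * hG.mk G (z - t)) :=
        mixedLNorm_lintegral_le hp hp' hq hq' (G := fun z => k z.2 * hG.mk G (z.1 - z.2))
          ((hk.comp measurable_snd).mul (hG.measurable_mk.comp (measurable_fst.sub measurable_snd)))
    _ = ∫⁻ t, k t * mixedLNorm p q (hG.mk G) := by
        refine lintegral_congr fun t => ?_
        rw [mixedLNorm_const_mul p q (hk' t), mixedLNorm_sub_right]
    _ = (∫⁻ z, k z) * mixedLNorm p q G := by
        rw [lintegral_mul_const _ hk, mixedLNorm_congr_ae hG.ae_eq_mk]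

end Young

section TimeFrequency

open FourierTransform

variable {n : ℕ}

local notation "𝔼" => EuclideanSpace ℝ (Fin n)

section SchwartzEstimates

variable {E : Type*} [NormedAddCommGroup E]

theorem one_add_norm_le_mul_sub (a b : E) : 1 + ‖a‖ ≤ (1 + ‖b‖) * (1 + ‖a - b‖) := by
  have h : ‖a‖ ≤ ‖b‖ + ‖a - b‖ := by simpa using norm_add_le b (a - b)
  nlinarith [norm_nonneg b, norm_nonneg (a - b)]

variable [NormedSpace ℝ E]

theorem exists_seminorm_one_add_norm_pow_mul_iteratedFDeriv_le (k l : ℕ) :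
    ∃ p : Seminorm ℂ 𝓢(E, ℂ), Continuous p ∧
      ∀ (φ : 𝓢(E, ℂ)) (y : E), (1 + ‖y‖) ^ k * ‖iteratedFDeriv ℝ l φ y‖ ≤ p φ := by
  have hcont := Seminorm.continuous_finsetSup (s := Finset.Iic (k, l)) fun m _ =>
    (schwartz_withSeminorms ℂ E ℂ).continuous_seminorm m
  refine ⟨(2 ^ k : NNReal) • _, hcont.const_smul _, fun φ y => ?_⟩
  rw [smul_apply, NNReal.smul_def, smul_eq_mul, NNReal.coe_pow, NNReal.coe_ofNat]
  exact one_add_le_sup_seminorm_apply (m := (k, l)) le_rfl le_rfl φ y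

theorem exists_seminorm_one_add_norm_pow_mul_le (k : ℕ) :
    ∃ p : Seminorm ℂ 𝓢(E, ℂ), Continuous p ∧
      ∀ (φ : 𝓢(E, ℂ)) (y : E), (1 + ‖y‖) ^ k * ‖φ y‖ ≤ p φ := by
  simpa only [norm_iteratedFDeriv_zero] using
    exists_seminorm_one_add_norm_pow_mul_iteratedFDeriv_le (E := E) k 0

theorem exists_seminorm_schwartzSeminorm_compSubConstCLM_le (k l : ℕ) :
    ∃ p : Seminorm ℂ 𝓢(E, ℂ), Continuous p ∧ ∀ (φ : 𝓢(E, ℂ)) (a : E),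
      SchwartzMap.seminorm ℂ k l (compSubConstCLM ℂ a φ) ≤ (1 + ‖a‖) ^ k * p φ := by
  obtain ⟨p, hp, hle⟩ := exists_seminorm_one_add_norm_pow_mul_iteratedFDeriv_le (E := E) k l
  refine ⟨p, hp, fun φ a => SchwartzMap.seminorm_le_bound ℂ _ _ _ (by positivity) fun y => ?_⟩
  have translate : iteratedFDeriv ℝ l (compSubConstCLM ℂ a φ) y = iteratedFDeriv ℝ l φ (y - a) := by
    rw [← iteratedFDeriv_comp_sub]
    rfl
  calc ‖y‖ ^ k * ‖iteratedFDeriv ℝ l (compSubConstCLM ℂ a φ) y‖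
    _ ≤ ((1 + ‖a‖) * (1 + ‖y - a‖)) ^ k * ‖iteratedFDeriv ℝ l φ (y - a)‖ := by
        rw [translate]
        gcongr
        linarith [one_add_norm_le_mul_sub y a]
    _ = (1 + ‖a‖) ^ k * ((1 + ‖y - a‖) ^ k * ‖iteratedFDeriv ℝ l φ (y - a)‖) := by
        rw [mul_pow, mul_assoc]
    _ ≤ (1 + ‖a‖) ^ k * p φ := by gcongr; exact hle φ (y - a)

theorem exists_seminorm_compSubConstCLM_le {p : Seminorm ℂ 𝓢(E, ℂ)} (hp : Continuous p) :
    ∃ (N : ℕ) (q : Seminorm ℂ 𝓢(E, ℂ)), Continuous q ∧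
      ∀ (φ : 𝓢(E, ℂ)) (a : E), p (compSubConstCLM ℂ a φ) ≤ (1 + ‖a‖) ^ N * q φ := by
  obtain ⟨s, C, -, hC⟩ := Seminorm.bound_of_continuous (schwartz_withSeminorms ℂ E ℂ) p hp
  choose q hq hle using fun m : ℕ × ℕ =>
    exists_seminorm_schwartzSeminorm_compSubConstCLM_le (E := E) m.1 m.2
  have hcont := Seminorm.continuous_finsetSup (s := s) fun m _ => hq m
  refine ⟨s.sup Prod.fst, C • s.sup q, hcont.const_smul _, fun φ a => ?_⟩
  calc p (compSubConstCLM ℂ a φ)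
    _ ≤ C * s.sup (schwartzSeminormFamily ℂ E ℂ) (compSubConstCLM ℂ a φ) := hC _
    _ ≤ C * ((1 + ‖a‖) ^ s.sup Prod.fst * s.sup q φ) := by
        gcongr
        refine Seminorm.finset_sup_apply_le (by positivity) fun m hm => (hle m φ a).trans ?_
        gcongr
        · linarith [norm_nonneg a]
        · exact Finset.le_sup (f := Prod.fst) hm
        · exact Seminorm.le_finset_sup_apply hm
    _ = (1 + ‖a‖) ^ s.sup Prod.fst * (C • s.sup q) φ := mul_left_comm _ _ _

variable [FiniteDimensional ℝ E] [MeasureSpace E] [BorelSpace E]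
  [(volume : Measure E).IsAddHaarMeasure]

theorem integrable_one_add_norm_pow_inv {N : ℕ} (hN : Module.finrank ℝ E < N) :
    Integrable fun y : E => ((1 + ‖y‖) ^ N)⁻¹ :=
  (integrable_one_add_norm (μ := volume) (r := N) (by exact_mod_cast hN)).congr
    (ae_of_all _ fun y => by simp only [Real.rpow_neg (show 0 ≤ 1 + ‖y‖ by positivity),
      Real.rpow_natCast])

theorem exists_seminorm_integral_norm_mul_norm_comp_sub_le (h : 𝓢(E, ℂ)) (N : ℕ) :
    ∃ p : Seminorm ℂ 𝓢(E, ℂ), Continuous p ∧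
      ∀ (φ : 𝓢(E, ℂ)) (a : E), ∫ y, ‖φ y‖ * ‖h (y - a)‖ ≤ p φ * ((1 + ‖a‖) ^ N)⁻¹ := by
  set d := Module.finrank ℝ E + 1
  obtain ⟨p, hp, hpφ⟩ := exists_seminorm_one_add_norm_pow_mul_le (E := E) (N + d)
  obtain ⟨q, -, hqh⟩ := exists_seminorm_one_add_norm_pow_mul_le (E := E) N
  set I := ∫ y : E, ((1 + ‖y‖) ^ d)⁻¹
  have hI : 0 ≤ I := integral_nonneg fun y => by positivity
  have hqI : 0 ≤ q h * I := mul_nonneg (apply_nonneg q h) hI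
  refine ⟨(q h * I).toNNReal • p, hp.const_smul _, fun φ a => ?_⟩
  rw [smul_apply, NNReal.smul_def, smul_eq_mul, Real.coe_toNNReal _ hqI]
  have pointwise (y : E) : ‖φ y‖ * ‖h (y - a)‖
      ≤ (q h * p φ * ((1 + ‖a‖) ^ N)⁻¹) * ((1 + ‖y‖) ^ d)⁻¹ := by
    rw [mul_assoc (q h * p φ), ← mul_inv, ← div_eq_mul_inv, le_div_iff₀ (by positivity)]
    calc ‖φ y‖ * ‖h (y - a)‖ * ((1 + ‖a‖) ^ N * (1 + ‖y‖) ^ d)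
      _ ≤ ‖φ y‖ * ‖h (y - a)‖ * (((1 + ‖y‖) * (1 + ‖a - y‖)) ^ N * (1 + ‖y‖) ^ d) := by
          gcongr
          exact one_add_norm_le_mul_sub a y
      _ = ((1 + ‖y - a‖) ^ N * ‖h (y - a)‖) * ((1 + ‖y‖) ^ (N + d) * ‖φ y‖) := by
          rw [norm_sub_rev a y, mul_pow, pow_add]
          ring
      _ ≤ q h * p φ := by gcongr; exacts [hqh h _, hpφ φ y]
  calc ∫ y, ‖φ y‖ * ‖h (y - a)‖
    _ ≤ ∫ y : E, (q h * p φ * ((1 + ‖a‖) ^ N)⁻¹) * ((1 + ‖y‖) ^ d)⁻¹ :=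
        integral_mono_of_nonneg (ae_of_all _ fun y => by positivity)
          ((integrable_one_add_norm_pow_inv (Nat.lt_succ_self _)).const_mul _)
          (ae_of_all _ pointwise)
    _ = q h * I * p φ * ((1 + ‖a‖) ^ N)⁻¹ := by rw [integral_const_mul]; ring

theorem integrable_schwartz_mul (φ ψ : 𝓢(E, ℂ)) : Integrable fun y => φ y * ψ y :=
  (pairing (ContinuousLinearMap.mul ℂ ℂ) φ ψ).integrable

theorem integrable_schwartz_norm_sq (φ : 𝓢(E, ℂ)) : Integrable fun y => ‖φ y‖ ^ 2 := by
  simpa using (φ.memLp 2 volume).integrable_norm_pow (p := 2) two_ne_zero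

end SchwartzEstimates

/-! ### Time-frequency shifts of Schwartz functions -/

section Modulation

theorem norm_cexp_neg_I_mul (t : ℝ) : ‖Complex.exp (-(Complex.I * (t : ℂ)))‖ = 1 := by
  rw [← mul_neg, ← Complex.ofReal_neg, Complex.norm_exp_I_mul_ofReal]

/-- The modulation `φ ↦ exp (-i y·ξ) φ(y)`. -/
noncomputable def modulationCLM (ξ : 𝔼) : 𝓢(𝔼, ℂ) →L[ℂ] 𝓢(𝔼, ℂ) :=
  smulLeftCLM ℂ (fun y : 𝔼 => Complex.exp (-(Complex.I * ((⟪y, ξ⟫_ℝ : ℝ) : ℂ))))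

theorem modulationCLM_apply (ξ : 𝔼) (φ : 𝓢(𝔼, ℂ)) (y : 𝔼) :
    modulationCLM ξ φ y = Complex.exp (-(Complex.I * ((⟪y, ξ⟫_ℝ : ℝ) : ℂ))) * φ y :=
  smulLeftCLM_apply_apply (hasTemperateGrowth_cexp_inner ξ) φ y

theorem fourier_modulationCLM (ξ : 𝔼) (φ : 𝓢(𝔼, ℂ)) :
    𝓕 (modulationCLM ξ φ) = compSubConstCLM ℂ (-(2 * Real.pi)⁻¹ • ξ) (𝓕 φ) := by
  ext η
  rw [compSubConstCLM_apply, fourier_coe, fourier_coe, Real.fourier_eq', Real.fourier_eq']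
  refine integral_congr_ae (ae_of_all _ fun y => ?_)
  simp only [modulationCLM_apply, smul_eq_mul, ← mul_assoc, ← Complex.exp_add]
  congr 2
  rw [inner_sub_right, neg_smul, inner_neg_right, inner_smul_right]
  push_cast
  field_simp
  ring

theorem norm_fourierInv_compSubConstCLM (h : 𝓢(𝔼, ℂ)) (x η : 𝔼) :
    ‖𝓕⁻ (compSubConstCLM ℂ x h) η‖ = ‖𝓕⁻ h η‖ := by
  have modulate : 𝓕⁻ (compSubConstCLM ℂ x h) η
      = Complex.exp (↑(2 * Real.pi * ⟪x, η⟫_ℝ) * Complex.I) * 𝓕⁻ h η := by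
    rw [fourierInv_coe, fourierInv_coe, Real.fourierInv_eq', Real.fourierInv_eq',
      ← integral_const_mul, ← integral_add_right_eq_self _ x]
    refine integral_congr_ae (ae_of_all _ fun y => ?_)
    simp only [compSubConstCLM_apply, smul_eq_mul, ← mul_assoc, ← Complex.exp_add,
      add_sub_cancel_right]
    congr 2
    rw [inner_add_left]
    push_cast
    ring
  rw [modulate, norm_mul, Complex.norm_exp_ofReal_mul_I, one_mul]

theorem exists_seminorm_modulationCLM_le {p : Seminorm ℂ 𝓢(𝔼, ℂ)} (hp : Continuous p) :
    ∃ (N : ℕ) (q : Seminorm ℂ 𝓢(𝔼, ℂ)), Continuous q ∧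
      ∀ (φ : 𝓢(𝔼, ℂ)) (ξ : 𝔼), p (modulationCLM ξ φ) ≤ (1 + ‖ξ‖) ^ N * q φ := by
  -- the Fourier transform turns modulations into translations
  set 𝓕₀ := fourierCLE ℂ 𝓢(𝔼, ℂ)
  obtain ⟨N, q, hq, hle⟩ := exists_seminorm_compSubConstCLM_le
    (p := p.comp 𝓕₀.symm.toLinearEquiv.toLinearMap) (hp.comp 𝓕₀.symm.continuous)
  refine ⟨N, q.comp 𝓕₀.toLinearEquiv.toLinearMap, hq.comp 𝓕₀.continuous, fun φ ξ => ?_⟩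
  have hnorm : ‖-(2 * Real.pi)⁻¹ • ξ‖ ≤ ‖ξ‖ := by
    rw [norm_smul, norm_neg, Real.norm_of_nonneg (by positivity)]
    refine mul_le_of_le_one_left (norm_nonneg _) (inv_le_one_of_one_le₀ ?_)
    nlinarith [Real.pi_gt_three]
  calc p (modulationCLM ξ φ)
    _ = p (𝓕⁻ (compSubConstCLM ℂ (-(2 * Real.pi)⁻¹ • ξ) (𝓕 φ))) := by
        rw [← fourier_modulationCLM, fourierInv_fourier_eq]
    _ ≤ (1 + ‖-(2 * Real.pi)⁻¹ • ξ‖) ^ N * q (𝓕 φ) := hle (𝓕 φ) _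
    _ ≤ (1 + ‖ξ‖) ^ N * q (𝓕 φ) := by gcongr

theorem norm_integral_modulationCLM_mul_le (φ h : 𝓢(𝔼, ℂ)) (x ξ : 𝔼) :
    ‖∫ y, modulationCLM ξ φ y * h (y - x)‖ ≤ ∫ y, ‖φ y‖ * ‖h (y - x)‖ := by
  refine (norm_integral_le_integral_norm _).trans_eq ?_
  simp only [norm_mul, modulationCLM_apply, norm_cexp_neg_I_mul, one_mul]

theorem norm_integral_modulationCLM_mul_le_fourier (φ h : 𝓢(𝔼, ℂ)) (x ξ : 𝔼) :
    ‖∫ y, modulationCLM ξ φ y * h (y - x)‖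
      ≤ ∫ η, ‖𝓕 φ η‖ * ‖𝓕⁻ h (η - (2 * Real.pi)⁻¹ • ξ)‖ := by
  have parseval : ∫ y, modulationCLM ξ φ y * h (y - x)
      = ∫ η, 𝓕 (modulationCLM ξ φ) η * 𝓕⁻ (compSubConstCLM ℂ x h) η := by
    rw [integral_fourier_mul_eq, fourier_fourierInv_eq]
    rfl
  rw [parseval, ← integral_sub_right_eq_self _ ((2 * Real.pi)⁻¹ • ξ)]
  refine (norm_integral_le_integral_norm _).trans_eq ?_
  simp only [norm_mul, norm_fourierInv_compSubConstCLM, fourier_modulationCLM,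
    compSubConstCLM_apply, neg_smul, sub_neg_eq_add, sub_add_cancel]

end Modulation

section Decay

/-- The submultiplicative weight `(1 + |x|) (1 + |ξ|)` on phase space, against which decay and
growth are measured. -/
noncomputable def phaseWeight (z : 𝔼 × 𝔼) : ℝ := (1 + ‖z.1‖) * (1 + ‖z.2‖)

theorem one_add_norm_fst_le_phaseWeight (z : 𝔼 × 𝔼) : 1 + ‖z.1‖ ≤ phaseWeight z :=
  le_mul_of_one_le_right (by positivity) (le_add_of_nonneg_right (norm_nonneg _))

theorem one_add_norm_snd_le_phaseWeight (z : 𝔼 × 𝔼) : 1 + ‖z.2‖ ≤ phaseWeight z :=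
  le_mul_of_one_le_left (by positivity) (le_add_of_nonneg_right (norm_nonneg _))

theorem one_le_phaseWeight (z : 𝔼 × 𝔼) : 1 ≤ phaseWeight z :=
  (le_add_of_nonneg_right (norm_nonneg _)).trans (one_add_norm_fst_le_phaseWeight z)

theorem phaseWeight_pos (z : 𝔼 × 𝔼) : 0 < phaseWeight z :=
  zero_lt_one.trans_le (one_le_phaseWeight z)

theorem phaseWeight_le_mul_sub (z z' : 𝔼 × 𝔼) :
    phaseWeight z ≤ phaseWeight z' * phaseWeight (z - z') := by
  calc phaseWeight z
    _ ≤ ((1 + ‖z'.1‖) * (1 + ‖z.1 - z'.1‖)) * ((1 + ‖z'.2‖) * (1 + ‖z.2 - z'.2‖)) := by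
        unfold phaseWeight
        gcongr <;> exact one_add_norm_le_mul_sub _ _
    _ = phaseWeight z' * phaseWeight (z - z') := mul_mul_mul_comm _ _ _ _

theorem phaseWeight_sub_comm (z z' : 𝔼 × 𝔼) : phaseWeight (z - z') = phaseWeight (z' - z) := by
  simp only [phaseWeight, Prod.fst_sub, Prod.snd_sub, norm_sub_rev]

@[fun_prop]
theorem continuous_phaseWeight : Continuous (phaseWeight (n := n)) := by
  unfold phaseWeight
  fun_prop

theorem integrable_phaseWeight_pow_inv {N : ℕ} (hN : n < N) :
    Integrable fun z : 𝔼 × 𝔼 => (phaseWeight z ^ N)⁻¹ := by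
  have h : Integrable fun y : 𝔼 => ((1 + ‖y‖) ^ N)⁻¹ :=
    integrable_one_add_norm_pow_inv (by rwa [finrank_euclideanSpace_fin])
  simp only [phaseWeight, mul_pow, mul_inv]
  exact h.mul_prod h

theorem le_add_mul_mul_of_le_mul_sq {J a b s t : ℝ} (hJ : 0 ≤ J) (ha : 0 ≤ a) (hb : 0 ≤ b)
    (hs : 0 ≤ s) (ht : 0 ≤ t) (hJs : J ≤ a * s ^ 2) (hJt : J ≤ b * t ^ 2) :
    J ≤ (a + b) * (s * t) := by
  refine le_of_sq_le_sq ?_ (by positivity)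
  calc J ^ 2 = J * J := sq J
    _ ≤ (a * s ^ 2) * (b * t ^ 2) := by gcongr
    _ = (a * b) * (s * t) ^ 2 := by ring
    _ ≤ (a + b) ^ 2 * (s * t) ^ 2 := by gcongr; nlinarith
    _ = ((a + b) * (s * t)) ^ 2 := (mul_pow _ _ _).symm

theorem exists_seminorm_integral_modulationCLM_mul_le_position (h : 𝓢(𝔼, ℂ)) (N : ℕ) :
    ∃ p : Seminorm ℂ 𝓢(𝔼, ℂ), Continuous p ∧ ∀ (φ : 𝓢(𝔼, ℂ)) (x ξ : 𝔼),
      ‖∫ y, modulationCLM ξ φ y * h (y - x)‖ ≤ p φ * ((1 + ‖x‖) ^ N)⁻¹ := by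
  obtain ⟨p, hp, hle⟩ := exists_seminorm_integral_norm_mul_norm_comp_sub_le h N
  exact ⟨p, hp, fun φ x ξ => (norm_integral_modulationCLM_mul_le φ h x ξ).trans (hle φ x)⟩

theorem exists_seminorm_integral_modulationCLM_mul_le_frequency (h : 𝓢(𝔼, ℂ)) (N : ℕ) :
    ∃ p : Seminorm ℂ 𝓢(𝔼, ℂ), Continuous p ∧ ∀ (φ : 𝓢(𝔼, ℂ)) (x ξ : 𝔼),
      ‖∫ y, modulationCLM ξ φ y * h (y - x)‖ ≤ p φ * ((1 + ‖ξ‖) ^ N)⁻¹ := by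
  obtain ⟨q, hq, hle⟩ := exists_seminorm_integral_norm_mul_norm_comp_sub_le (𝓕⁻ h) N
  set q' := q.comp (fourierCLE ℂ 𝓢(𝔼, ℂ)).toLinearEquiv.toLinearMap
  have hq' : Continuous q' := hq.comp (fourierCLE ℂ 𝓢(𝔼, ℂ)).continuous
  refine ⟨((2 * Real.pi) ^ N).toNNReal • q', hq'.const_smul _, fun φ x ξ => ?_⟩
  rw [smul_apply, NNReal.smul_def, smul_eq_mul, Real.coe_toNNReal _ (by positivity)]
  have rescale : 1 + ‖ξ‖ ≤ (2 * Real.pi) * (1 + ‖(2 * Real.pi)⁻¹ • ξ‖) := by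
    rw [norm_smul, Real.norm_of_nonneg (by positivity), mul_add,
      mul_inv_cancel_left₀ (by positivity)]
    linarith [Real.pi_gt_three]
  calc ‖∫ y, modulationCLM ξ φ y * h (y - x)‖
    _ ≤ q (𝓕 φ) * ((1 + ‖(2 * Real.pi)⁻¹ • ξ‖) ^ N)⁻¹ :=
        (norm_integral_modulationCLM_mul_le_fourier φ h x ξ).trans (hle (𝓕 φ) _)
    _ = (2 * Real.pi) ^ N * q' φ * (((2 * Real.pi) * (1 + ‖(2 * Real.pi)⁻¹ • ξ‖)) ^ N)⁻¹ := by
        change _ = (2 * Real.pi) ^ N * q (𝓕 φ) * _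
        rw [mul_pow _ (1 + _), mul_inv]
        field_simp
    _ ≤ (2 * Real.pi) ^ N * q' φ * ((1 + ‖ξ‖) ^ N)⁻¹ := by gcongr

theorem exists_seminorm_integral_modulationCLM_mul_le (h : 𝓢(𝔼, ℂ)) (N : ℕ) :
    ∃ p : Seminorm ℂ 𝓢(𝔼, ℂ), Continuous p ∧ ∀ (φ : 𝓢(𝔼, ℂ)) (z : 𝔼 × 𝔼),
      ‖∫ y, modulationCLM z.2 φ y * h (y - z.1)‖ ≤ p φ * (phaseWeight z ^ N)⁻¹ := by
  obtain ⟨p, hp, hpφ⟩ := exists_seminorm_integral_modulationCLM_mul_le_position h (N * 2)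
  obtain ⟨q, hq, hqφ⟩ := exists_seminorm_integral_modulationCLM_mul_le_frequency h (N * 2)
  refine ⟨p + q, hp.add hq, fun φ z => ?_⟩
  rw [phaseWeight, mul_pow, mul_inv]
  refine le_add_mul_mul_of_le_mul_sq (norm_nonneg _) (apply_nonneg p φ) (apply_nonneg q φ)
    (by positivity) (by positivity) ?_ ?_
  · simpa only [inv_pow, pow_mul] using hpφ φ z.1 z.2
  · simpa only [inv_pow, pow_mul] using hqφ φ z.1 z.2

end Decay

section TimeFrequencyShift

/-- The complex conjugate of a Schwartz function. -/
noncomputable def conjSchwartz (g : 𝓢(𝔼, ℂ)) : 𝓢(𝔼, ℂ) :=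
  postcompCLM (𝕜 := ℝ) (Complex.conjCLE : ℂ →L[ℝ] ℂ) g

theorem conjSchwartz_apply (g : 𝓢(𝔼, ℂ)) (y : 𝔼) :
    conjSchwartz g y = (starRingEnd ℂ) (g y) := rfl

/-- The time-frequency shift `y ↦ exp (i y·ξ) g(y - x)` for `z = (x, ξ)`. -/
noncomputable def timeFrequencyShift (g : 𝓢(𝔼, ℂ)) (z : 𝔼 × 𝔼) : 𝓢(𝔼, ℂ) :=
  conjSchwartz (conjTimeFrequencyShift g z)

theorem timeFrequencyShift_apply (g : 𝓢(𝔼, ℂ)) (z : 𝔼 × 𝔼) (y : 𝔼) :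
    timeFrequencyShift g z y
      = Complex.exp (-(Complex.I * ((⟪y, -z.2⟫_ℝ : ℝ) : ℂ))) * g (y - z.1) := by
  simp only [timeFrequencyShift, conjSchwartz_apply, conjTimeFrequencyShift_apply, map_mul,
    Complex.conj_conj, ← Complex.exp_conj, map_neg, Complex.conj_I, Complex.conj_ofReal,
    inner_neg_right, Complex.ofReal_neg, neg_mul, mul_neg]

theorem norm_conjTimeFrequencyShift_apply (g : 𝓢(𝔼, ℂ)) (z : 𝔼 × 𝔼) (y : 𝔼) :
    ‖conjTimeFrequencyShift g z y‖ = ‖g (y - z.1)‖ := by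
  rw [conjTimeFrequencyShift_apply, norm_mul, norm_cexp_neg_I_mul, one_mul, RCLike.norm_conj]

theorem norm_timeFrequencyShift_apply (g : 𝓢(𝔼, ℂ)) (z : 𝔼 × 𝔼) (y : 𝔼) :
    ‖timeFrequencyShift g z y‖ = ‖g (y - z.1)‖ := by
  rw [timeFrequencyShift_apply, norm_mul, norm_cexp_neg_I_mul, one_mul]

theorem exists_seminorm_conjTimeFrequencyShift_le (g : 𝓢(𝔼, ℂ)) {p : Seminorm ℂ 𝓢(𝔼, ℂ)}
    (hp : Continuous p) : ∃ (N : ℕ) (C : ℝ), 0 < C ∧ ∀ z : 𝔼 × 𝔼,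
      p (conjTimeFrequencyShift g z) ≤ C * phaseWeight z ^ N := by
  obtain ⟨N, q, hq, hpq⟩ := exists_seminorm_modulationCLM_le hp
  obtain ⟨N', q', -, hqq'⟩ := exists_seminorm_compSubConstCLM_le hq
  refine ⟨N + N', q' (conjSchwartz g) + 1, by positivity, fun z => ?_⟩
  calc p (conjTimeFrequencyShift g z)
    _ ≤ (1 + ‖z.2‖) ^ N * q (compSubConstCLM ℂ z.1 (conjSchwartz g)) := hpq _ _
    _ ≤ (1 + ‖z.2‖) ^ N * ((1 + ‖z.1‖) ^ N' * q' (conjSchwartz g)) := by gcongr; exact hqq' _ _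
    _ ≤ phaseWeight z ^ N * (phaseWeight z ^ N' * (q' (conjSchwartz g) + 1)) := by
        have := (phaseWeight_pos z).le
        gcongr
        exacts [one_add_norm_snd_le_phaseWeight z, one_add_norm_fst_le_phaseWeight z,
          le_add_of_nonneg_right zero_le_one]
    _ = (q' (conjSchwartz g) + 1) * phaseWeight z ^ (N + N') := by ring

theorem contDiff_conjTimeFrequencyShift_uncurry (g : 𝓢(𝔼, ℂ)) :
    ContDiff ℝ (⊤ : ℕ∞) fun w : (𝔼 × 𝔼) × 𝔼 => conjTimeFrequencyShift g w.1 w.2 := by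
  simp_rw [conjTimeFrequencyShift_apply]
  have phase : ContDiff ℝ (⊤ : ℕ∞) fun w : (𝔼 × 𝔼) × 𝔼 => ⟪w.2, w.1.2⟫_ℝ :=
    contDiff_snd.inner ℝ (contDiff_snd.comp contDiff_fst)
  have translate : ContDiff ℝ (⊤ : ℕ∞) fun w : (𝔼 × 𝔼) × 𝔼 => g (w.2 - w.1.1) :=
    (g.smooth ⊤).comp (by fun_prop)
  exact (contDiff_const.mul (Complex.ofRealCLM.contDiff.comp phase)).neg.cexp.mul
    (Complex.conjCLE.contDiff.comp translate)

theorem continuous_conjTimeFrequencyShift_uncurry (g : 𝓢(𝔼, ℂ)) :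
    Continuous fun w : (𝔼 × 𝔼) × 𝔼 => conjTimeFrequencyShift g w.1 w.2 :=
  (contDiff_conjTimeFrequencyShift_uncurry g).continuous

theorem continuous_conjTimeFrequencyShift_left (g : 𝓢(𝔼, ℂ)) (y : 𝔼) :
    Continuous fun z : 𝔼 × 𝔼 => conjTimeFrequencyShift g z y :=
  (continuous_conjTimeFrequencyShift_uncurry g).comp (f := fun z => (z, y))
    (continuous_id.prodMk continuous_const)

theorem continuous_timeFrequencyShift_left (g : 𝓢(𝔼, ℂ)) (y : 𝔼) :
    Continuous fun z : 𝔼 × 𝔼 => timeFrequencyShift g z y :=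
  Complex.continuous_conj.comp (continuous_conjTimeFrequencyShift_left g y)

theorem continuous_iteratedFDeriv_conjTimeFrequencyShift (g : 𝓢(𝔼, ℂ)) (l : ℕ) (y : 𝔼) :
    Continuous fun z : 𝔼 × 𝔼 => iteratedFDeriv ℝ l (conjTimeFrequencyShift g z) y := by
  set G : (𝔼 × 𝔼) × 𝔼 → ℂ := fun w => conjTimeFrequencyShift g w.1 w.2 with hG
  have smooth := contDiff_conjTimeFrequencyShift_uncurry g
  set ι := ContinuousLinearMap.inr ℝ (𝔼 × 𝔼) 𝔼
  have slice (z : 𝔼 × 𝔼) : iteratedFDeriv ℝ l (conjTimeFrequencyShift g z) y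
      = (iteratedFDeriv ℝ l G (z, y)).compContinuousLinearMap fun _ => ι := by
    have factor : (conjTimeFrequencyShift g z : 𝔼 → ℂ) = (fun w => G ((z, 0) + w)) ∘ ι := by
      ext y
      simp [hG, ι]
    have hs : ContDiff ℝ (⊤ : ℕ∞) fun w => G ((z, 0) + w) :=
      smooth.comp (contDiff_const.add contDiff_id)
    rw [factor, ContinuousLinearMap.iteratedFDeriv_comp_right (i := l) _ hs _
      (by exact_mod_cast le_top), iteratedFDeriv_comp_add_left]
    simp [ι]
  simp_rw [slice]
  exact (ContinuousMultilinearMap.compContinuousLinearMapL fun _ : Fin l => ι).continuous.comp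
    ((smooth.continuous_iteratedFDeriv (by exact_mod_cast le_top)).comp (by fun_prop))

end TimeFrequencyShift

section GaborPairing

/-- The coefficient `∫ φ(y) exp (i y·ξ) g(y - x) dy` of a Schwartz function at `z = (x, ξ)`: no
conjugate is taken, so it is the short-time Fourier transform of `φ` at `(x, -ξ)` with window
`conj g`. -/
noncomputable def gaborPairing (g φ : 𝓢(𝔼, ℂ)) (z : 𝔼 × 𝔼) : ℂ :=
  ∫ y, φ y * timeFrequencyShift g z y

theorem gaborPairing_eq_integral_modulationCLM (g φ : 𝓢(𝔼, ℂ)) (z : 𝔼 × 𝔼) :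
    gaborPairing g φ z = ∫ y, modulationCLM (-z.2) φ y * g (y - z.1) :=
  integral_congr_ae (ae_of_all _ fun y => by
    simp only [timeFrequencyShift_apply, modulationCLM_apply]
    ring)

theorem exists_seminorm_norm_gaborPairing_le (g : 𝓢(𝔼, ℂ)) (N : ℕ) :
    ∃ p : Seminorm ℂ 𝓢(𝔼, ℂ), Continuous p ∧ ∀ (φ : 𝓢(𝔼, ℂ)) (z : 𝔼 × 𝔼),
      ‖gaborPairing g φ z‖ ≤ p φ * (phaseWeight z ^ N)⁻¹ := by
  obtain ⟨p, hp, hle⟩ := exists_seminorm_integral_modulationCLM_mul_le g N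
  refine ⟨p, hp, fun φ z => ?_⟩
  rw [gaborPairing_eq_integral_modulationCLM]
  simpa only [phaseWeight, norm_neg] using hle φ (z.1, -z.2)

theorem gaborPairing_conjTimeFrequencyShift (g : 𝓢(𝔼, ℂ)) (z z' : 𝔼 × 𝔼) :
    gaborPairing g (conjTimeFrequencyShift g z') z
      = Complex.exp (-(Complex.I * ((⟪z'.1, z'.2 - z.2⟫_ℝ : ℝ) : ℂ))) *
        gaborPairing g (conjSchwartz g) (z - z') := by
  rw [gaborPairing, gaborPairing, ← integral_const_mul, ← integral_add_right_eq_self _ z'.1]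
  refine integral_congr_ae (ae_of_all _ fun y => ?_)
  have hy : y + z'.1 - z.1 = y - (z - z').1 := by rw [Prod.fst_sub]; abel
  simp only [conjTimeFrequencyShift_apply, timeFrequencyShift_apply, add_sub_cancel_right, hy,
    conjSchwartz_apply]
  rw [mul_mul_mul_comm, mul_left_comm ((starRingEnd ℂ) (g y)), ← mul_assoc (Complex.exp _),
    ← Complex.exp_add, ← Complex.exp_add]
  congr 2
  simp only [inner_sub_right, inner_add_left, inner_neg_right, Prod.snd_sub]
  push_cast
  ring

theorem exists_norm_gaborPairing_conjTimeFrequencyShift_le (g : 𝓢(𝔼, ℂ)) (N : ℕ) :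
    ∃ C : ℝ, 0 < C ∧ ∀ z z' : 𝔼 × 𝔼,
      ‖gaborPairing g (conjTimeFrequencyShift g z') z‖ ≤ C * (phaseWeight (z - z') ^ N)⁻¹ := by
  obtain ⟨p, -, hle⟩ := exists_seminorm_norm_gaborPairing_le g N
  refine ⟨p (conjSchwartz g) + 1, by positivity, fun z z' => ?_⟩
  rw [gaborPairing_conjTimeFrequencyShift, norm_mul, norm_cexp_neg_I_mul, one_mul]
  refine (hle _ _).trans ?_
  have := phaseWeight_pos (z - z')
  gcongr
  exact le_add_of_nonneg_right zero_le_one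

theorem continuous_gaborPairing (g φ : 𝓢(𝔼, ℂ)) : Continuous (gaborPairing g φ) := by
  refine continuous_of_dominated (bound := fun y => ‖φ y‖ * SchwartzMap.seminorm ℂ 0 0 g)
    (fun z => (integrable_schwartz_mul φ _).aestronglyMeasurable) (fun z => ae_of_all _ fun y => ?_)
    (φ.integrable.norm.mul_const _) (ae_of_all _ fun y => ?_)
  · rw [norm_mul, norm_timeFrequencyShift_apply]
    gcongr
    exact SchwartzMap.norm_le_seminorm ℂ g _
  · exact continuous_const.mul (continuous_timeFrequencyShift_left g y)

theorem continuous_gaborPairing_conjTimeFrequencyShift (g : 𝓢(𝔼, ℂ)) :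
    Continuous fun w : (𝔼 × 𝔼) × (𝔼 × 𝔼) =>
      gaborPairing g (conjTimeFrequencyShift g w.2) w.1 := by
  simp_rw [gaborPairing_conjTimeFrequencyShift]
  have := continuous_gaborPairing g (conjSchwartz g)
  fun_prop

theorem integrable_gaborPairing (g φ : 𝓢(𝔼, ℂ)) : Integrable (gaborPairing g φ) := by
  obtain ⟨p, -, hle⟩ := exists_seminorm_norm_gaborPairing_le g (n + 1)
  exact ((integrable_phaseWeight_pow_inv (Nat.lt_succ_self n)).const_mul (p φ)).mono'
    (continuous_gaborPairing g φ).aestronglyMeasurable (ae_of_all _ (hle φ))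

end GaborPairing

section Inversion

/-- The constant `(2π)ⁿ ∫ |g|²` in the inversion formula for the short-time Fourier transform. -/
noncomputable def gaborConst (g : 𝓢(𝔼, ℂ)) : ℝ := (2 * Real.pi) ^ n * ∫ y, ‖g y‖ ^ 2

theorem gaborConst_pos {g : 𝓢(𝔼, ℂ)} (hg : g ≠ 0) : 0 < gaborConst g := by
  refine mul_pos (by positivity) ?_
  obtain ⟨y, hy⟩ : ∃ y, g y ≠ 0 := by
    by_contra! h
    exact hg (SchwartzMap.ext h)
  rw [integral_pos_iff_support_of_nonneg (fun y => by positivity) (integrable_schwartz_norm_sq g)]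
  exact (g.continuous.norm.pow 2).isOpen_support.measure_pos _ ⟨y, by simpa using hy⟩

theorem gaborPairing_eq_fourierInv (g φ : 𝓢(𝔼, ℂ)) (x ξ : 𝔼) :
    gaborPairing g φ (x, ξ) = 𝓕⁻ (pairing (ContinuousLinearMap.mul ℂ ℂ) φ
      (compSubConstCLM ℂ x g)) ((2 * Real.pi)⁻¹ • ξ) := by
  rw [fourierInv_coe, Real.fourierInv_eq', gaborPairing]
  refine integral_congr_ae (ae_of_all _ fun y => ?_)
  simp only [timeFrequencyShift_apply, smul_eq_mul, pairing_apply_apply, compSubConstCLM_apply,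
    ContinuousLinearMap.mul_apply', mul_left_comm (φ y)]
  congr 2
  rw [inner_neg_right, inner_smul_right]
  push_cast
  field_simp

theorem integral_comp_inv_two_pi_smul_mul_cexp (f : 𝓢(𝔼, ℂ)) (y : 𝔼) :
    ∫ ξ, f ((2 * Real.pi)⁻¹ • ξ) * Complex.exp (-(Complex.I * ((⟪y, ξ⟫_ℝ : ℝ) : ℂ)))
      = ((2 * Real.pi) ^ n : ℝ) * 𝓕 f y := by
  rw [fourier_coe, Real.fourier_eq', ← abs_of_pos (a := (2 * Real.pi) ^ n) (by positivity),
    ← Complex.real_smul]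
  conv_rhs => enter [1, 1, 2]; rw [← finrank_euclideanSpace_fin (𝕜 := ℝ) (n := n)]
  rw [← Measure.integral_comp_inv_smul]
  refine integral_congr_ae (ae_of_all _ fun ξ => ?_)
  simp only [smul_eq_mul, mul_comm (f _)]
  congr 2
  rw [inner_smul_left, real_inner_comm]
  simp only [conj_trivial]
  push_cast
  field_simp

theorem integral_gaborPairing_mul_conjTimeFrequencyShift_frequency (g φ : 𝓢(𝔼, ℂ)) (x y : 𝔼) :
    ∫ ξ, gaborPairing g φ (x, ξ) * conjTimeFrequencyShift g (x, ξ) y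
      = ((2 * Real.pi) ^ n : ℝ) * (φ y * ((‖g (y - x)‖ ^ 2 : ℝ) : ℂ)) := by
  simp only [gaborPairing_eq_fourierInv, conjTimeFrequencyShift_apply, ← mul_assoc]
  rw [integral_mul_const, integral_comp_inv_two_pi_smul_mul_cexp, fourier_fourierInv_eq,
    pairing_apply_apply, compSubConstCLM_apply, ContinuousLinearMap.mul_apply', mul_assoc,
    mul_assoc, Complex.mul_conj, Complex.normSq_eq_norm_sq, ← mul_assoc]

theorem integral_gaborPairing_mul_conjTimeFrequencyShift (g φ : 𝓢(𝔼, ℂ)) (y : 𝔼) :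
    ∫ z, gaborPairing g φ z * conjTimeFrequencyShift g z y = gaborConst g * φ y := by
  have hint : Integrable fun z => gaborPairing g φ z * conjTimeFrequencyShift g z y := by
    refine (integrable_gaborPairing g φ).mul_bdd (c := SchwartzMap.seminorm ℂ 0 0 g)
      (continuous_conjTimeFrequencyShift_left g y).aestronglyMeasurable (ae_of_all _ fun z => ?_)
    rw [norm_conjTimeFrequencyShift_apply]
    exact SchwartzMap.norm_le_seminorm ℂ g _
  rw [Measure.volume_eq_prod] at hint ⊢
  rw [integral_prod _ hint]
  simp_rw [integral_gaborPairing_mul_conjTimeFrequencyShift_frequency]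
  rw [integral_const_mul, integral_const_mul, integral_complex_ofReal,
    integral_sub_left_eq_self (fun t => ‖g t‖ ^ 2) volume y, gaborConst]
  push_cast
  ring

end Inversion

section IteratedFDeriv

variable {α E F : Type*} [MeasurableSpace α] {μ : Measure α} [NormedAddCommGroup E]
  [NormedSpace ℝ E] [NormedAddCommGroup F] [NormedSpace ℝ F] [CompleteSpace F]

theorem iteratedFDeriv_integral {f : α → E → F} (hf : ∀ a, ContDiff ℝ (⊤ : ℕ∞) (f a))
    (hm : ∀ l y, AEStronglyMeasurable (fun a => iteratedFDeriv ℝ l (f a) y) μ)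
    {b : ℕ → α → ℝ} (hb : ∀ l, Integrable (b l) μ)
    (hle : ∀ l a y, ‖iteratedFDeriv ℝ l (f a) y‖ ≤ b l a) (l : ℕ) :
    iteratedFDeriv ℝ l (fun y => ∫ a, f a y ∂μ) = fun y => ∫ a, iteratedFDeriv ℝ l (f a) y ∂μ := by
  have hint (l y) : Integrable (fun a => iteratedFDeriv ℝ l (f a) y) μ :=
    (hb l).mono' (hm l y) (ae_of_all _ fun a => hle l a y)
  induction l with
  | zero =>
    simp only [iteratedFDeriv_zero_eq_comp]
    funext y
    exact ((continuousMultilinearCurryFin0 ℝ E F).symm.toContinuousLinearEquiv.integral_comp_comm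
      fun a => f a y).symm
  | succ l ih =>
    funext y
    set L := continuousMultilinearCurryLeftEquiv ℝ (fun _ : Fin (l + 1) => E) F with hL
    have uncurry (a y) :
        fderiv ℝ (iteratedFDeriv ℝ l (f a)) y = L (iteratedFDeriv ℝ (l + 1) (f a) y) := by
      rw [iteratedFDeriv_succ_eq_comp_left, Function.comp_apply, hL,
        LinearIsometryEquiv.apply_symm_apply]
    have hderiv : HasFDerivAt (fun y => ∫ a, iteratedFDeriv ℝ l (f a) y ∂μ)
        (∫ a, fderiv ℝ (iteratedFDeriv ℝ l (f a)) y ∂μ) y := by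
      refine hasFDerivAt_integral_of_dominated_of_fderiv_le (s := Set.univ) (bound := b (l + 1))
        (F' := fun y a => fderiv ℝ (iteratedFDeriv ℝ l (f a)) y)
        univ_mem (Eventually.of_forall fun y => hm l y) (hint l y) ?_ ?_ (hb _) ?_
      · simp_rw [uncurry]
        exact L.continuous.comp_aestronglyMeasurable (hm (l + 1) y)
      · refine ae_of_all _ fun a y _ => ?_
        rw [uncurry, LinearIsometryEquiv.norm_map]
        exact hle _ a y
      · exact ae_of_all _ fun a y _ => ((hf a).differentiable_iteratedFDeriv
          (by exact_mod_cast WithTop.coe_lt_top l) y).hasFDerivAt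
    rw [iteratedFDeriv_succ_eq_comp_left, ih, Function.comp_apply, hderiv.fderiv]
    simp_rw [uncurry]
    have comm := LinearIsometry.integral_comp_comm (𝕜 := ℝ) (F := E →L[ℝ] E [×l]→L[ℝ] F) (μ := μ)
      L.toLinearIsometry fun a => iteratedFDeriv ℝ (l + 1) (f a) y
    exact (congrArg L.symm comm).trans (L.symm_apply_apply _)

end IteratedFDeriv

/-! ### Tempered distributions -/

section TemperedDistributions

theorem exists_dual_comp_eq_of_norm_le {𝕜 V W : Type*} [RCLike 𝕜] [AddCommGroup V] [Module 𝕜 V]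
    [NormedAddCommGroup W] [NormedSpace 𝕜 W] (Λ : V →ₗ[𝕜] W) (ℓ : V →ₗ[𝕜] 𝕜) {C : ℝ}
    (hle : ∀ v, ‖ℓ v‖ ≤ C * ‖Λ v‖) : ∃ G : StrongDual 𝕜 W, ∀ v, G (Λ v) = ℓ v := by
  obtain ⟨s, hs⟩ := Λ.rangeRestrict.exists_rightInverse_of_surjective Λ.range_rangeRestrict
  have hΛs (w) : Λ (s w) = w := congrArg Subtype.val (LinearMap.congr_fun hs w)
  obtain ⟨G, hG, -⟩ := exists_extension_norm_eq (LinearMap.range Λ)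
    ((ℓ ∘ₗ s).mkContinuous C fun w => (hle (s w)).trans_eq (by rw [hΛs]; rfl))
  refine ⟨G, fun v => (hG (Λ.rangeRestrict v)).trans ?_⟩
  have hker : Λ (s (Λ.rangeRestrict v) - v) = 0 := by
    rw [map_sub, hΛs]
    exact sub_self _
  have hzero := hle (s (Λ.rangeRestrict v) - v)
  rwa [hker, norm_zero, mul_zero, norm_le_zero_iff, map_sub, sub_eq_zero] at hzero

theorem integral_mul_norm_le_norm_toLp_mul_norm_toLp {α : Type*} [MeasurableSpace α]
    {μ : Measure α} {f : α → ℝ} {F : α → ℂ} (hf : MemLp f 2 μ) (hF : MemLp F 2 μ) :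
    ∫ a, f a * ‖F a‖ ∂μ ≤ ‖hf.toLp f‖ * ‖hF.toLp F‖ := by
  calc ∫ a, f a * ‖F a‖ ∂μ
    _ = ⟪hf.toLp f, hF.norm.toLp _⟫_ℝ := by
        rw [L2.inner_def]
        refine integral_congr_ae ?_
        filter_upwards [hf.coeFn_toLp, hF.norm.coeFn_toLp] with a hfa hFa
        rw [hfa, hFa, real_inner_comm]
        rfl
    _ ≤ ‖hf.toLp f‖ * ‖hF.norm.toLp _‖ := real_inner_le_norm _ _
    _ = ‖hf.toLp f‖ * ‖hF.toLp F‖ := by rw [Lp.norm_toLp _ hF.norm, Lp.norm_toLp _ hF, eLpNorm_norm]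

theorem integrable_norm_gaborPairing_mul_phaseWeight_pow (g φ : 𝓢(𝔼, ℂ)) (N : ℕ) :
    Integrable fun z => ‖gaborPairing g φ z‖ * phaseWeight z ^ N := by
  obtain ⟨p, -, hle⟩ := exists_seminorm_norm_gaborPairing_le g (N + (n + 1))
  refine ((integrable_phaseWeight_pow_inv (Nat.lt_succ_self n)).const_mul (p φ)).mono'
    ((continuous_gaborPairing g φ).norm.mul (continuous_phaseWeight.pow N)).aestronglyMeasurable
    (ae_of_all _ fun z => ?_)
  have hz := phaseWeight_pos z
  calc ‖‖gaborPairing g φ z‖ * phaseWeight z ^ N‖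
    _ = ‖gaborPairing g φ z‖ * phaseWeight z ^ N := Real.norm_of_nonneg (by positivity)
    _ ≤ (p φ * (phaseWeight z ^ (N + (n + 1)))⁻¹) * phaseWeight z ^ N := by gcongr; exact hle φ z
    _ = p φ * (phaseWeight z ^ (n + 1))⁻¹ := by rw [pow_add]; field_simp

theorem gaborConst_smul_iteratedFDeriv (g φ : 𝓢(𝔼, ℂ)) (l : ℕ) (y : 𝔼) :
    (gaborConst g : ℂ) • iteratedFDeriv ℝ l φ y
      = ∫ z, gaborPairing g φ z • iteratedFDeriv ℝ l (conjTimeFrequencyShift g z) y := by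
  choose M D _ hle using fun l : ℕ => exists_seminorm_conjTimeFrequencyShift_le g
    ((schwartz_withSeminorms ℂ 𝔼 ℂ).continuous_seminorm (0, l))
  set f : 𝔼 × 𝔼 → 𝓢(𝔼, ℂ) := fun z => gaborPairing g φ z • conjTimeFrequencyShift g z
  have deriv_f (l z y) : iteratedFDeriv ℝ l (f z) y
      = gaborPairing g φ z • iteratedFDeriv ℝ l (conjTimeFrequencyShift g z) y :=
    iteratedFDeriv_const_smul_apply ((conjTimeFrequencyShift g z).contDiffAt l)
  have bound (l z y) : ‖iteratedFDeriv ℝ l (f z) y‖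
      ≤ D l * (‖gaborPairing g φ z‖ * phaseWeight z ^ M l) := by
    rw [deriv_f, norm_smul, mul_left_comm]
    gcongr
    exact (SchwartzMap.norm_iteratedFDeriv_le_seminorm ℂ _ l y).trans (hle l z)
  have measurable (l y) : AEStronglyMeasurable (fun z => iteratedFDeriv ℝ l (f z) y) volume := by
    simp_rw [deriv_f]
    exact ((continuous_gaborPairing g φ).smul
      (continuous_iteratedFDeriv_conjTimeFrequencyShift g l y)).aestronglyMeasurable
  have inversion : (fun y => ∫ z, f z y) = ⇑((gaborConst g : ℂ) • φ) :=
    funext fun y => integral_gaborPairing_mul_conjTimeFrequencyShift g φ y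
  have swap := congrFun (iteratedFDeriv_integral (fun z => (f z).smooth ⊤) measurable
    (fun l => (integrable_norm_gaborPairing_mul_phaseWeight_pow g φ (M l)).const_mul _) bound l) y
  rw [inversion] at swap
  simp_rw [← deriv_f, ← swap]
  exact (iteratedFDeriv_const_smul_apply (φ.contDiffAt l)).symm

theorem gaborConst_mul_seminorm_le (g φ : 𝓢(𝔼, ℂ)) {k l N : ℕ} {C : ℝ} (hC : 0 ≤ C)
    (hle : ∀ z, SchwartzMap.seminorm ℂ k l (conjTimeFrequencyShift g z) ≤ C * phaseWeight z ^ N) :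
    gaborConst g * SchwartzMap.seminorm ℂ k l φ
      ≤ C * ∫ z, ‖gaborPairing g φ z‖ * phaseWeight z ^ N := by
  have hκ : 0 ≤ gaborConst g := mul_nonneg (by positivity) (integral_nonneg fun _ => by positivity)
  have hseminorm : gaborConst g * SchwartzMap.seminorm ℂ k l φ
      = SchwartzMap.seminorm ℂ k l ((gaborConst g : ℂ) • φ) := by
    rw [map_smul_eq_mul, Complex.norm_real, Real.norm_of_nonneg hκ]
  have pointwise (y : 𝔼) (z : 𝔼 × 𝔼) :
      ‖y‖ ^ k * ‖gaborPairing g φ z • iteratedFDeriv ℝ l (conjTimeFrequencyShift g z) y‖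
        ≤ C * (‖gaborPairing g φ z‖ * phaseWeight z ^ N) := by
    rw [norm_smul, mul_left_comm, mul_left_comm C]
    exact mul_le_mul_of_nonneg_left ((SchwartzMap.le_seminorm ℂ k l _ y).trans (hle z))
      (norm_nonneg _)
  rw [hseminorm]
  refine SchwartzMap.seminorm_le_bound ℂ k l _ (mul_nonneg hC (integral_nonneg fun z => ?_))
    fun y => ?_
  · have := phaseWeight_pos z
    positivity
  let f (z : 𝔼 × 𝔼) := gaborPairing g φ z • iteratedFDeriv ℝ l (conjTimeFrequencyShift g z) y
  calc ‖y‖ ^ k * ‖iteratedFDeriv ℝ l ((gaborConst g : ℂ) • φ : 𝓢(𝔼, ℂ)) y‖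
    _ = ‖y‖ ^ k * ‖∫ z, f z‖ := by
        rw [← gaborConst_smul_iteratedFDeriv, ← iteratedFDeriv_const_smul_apply (φ.contDiffAt l)]
        rfl
    _ ≤ ∫ z, ‖y‖ ^ k * ‖f z‖ := by
        rw [integral_const_mul]
        gcongr
        exact norm_integral_le_integral_norm _
    _ ≤ C * ∫ z, ‖gaborPairing g φ z‖ * phaseWeight z ^ N := by
        rw [← integral_const_mul]
        exact integral_mono_of_nonneg (ae_of_all _ fun z => by positivity)
          ((integrable_norm_gaborPairing_mul_phaseWeight_pow g φ N).const_mul C)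
          (ae_of_all _ (pointwise y))

theorem exists_seminorm_le_integral_norm_gaborPairing {g : 𝓢(𝔼, ℂ)} (hg : g ≠ 0)
    {p : Seminorm ℂ 𝓢(𝔼, ℂ)} (hp : Continuous p) : ∃ (N : ℕ) (C : ℝ), 0 ≤ C ∧ ∀ φ : 𝓢(𝔼, ℂ),
      p φ ≤ C * ∫ z, ‖gaborPairing g φ z‖ * phaseWeight z ^ N := by
  obtain ⟨s, C, -, hC⟩ := Seminorm.bound_of_continuous (schwartz_withSeminorms ℂ 𝔼 ℂ) p hp
  choose N D hD hle using fun m : ℕ × ℕ => exists_seminorm_conjTimeFrequencyShift_le g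
    ((schwartz_withSeminorms ℂ 𝔼 ℂ).continuous_seminorm m)
  have hκ := gaborConst_pos hg
  have hD' : 0 ≤ ∑ m ∈ s, D m := Finset.sum_nonneg fun m _ => (hD m).le
  refine ⟨s.sup N, C * ((gaborConst g)⁻¹ * ∑ m ∈ s, D m), by positivity, fun φ => ?_⟩
  have hI : 0 ≤ ∫ z, ‖gaborPairing g φ z‖ * phaseWeight z ^ s.sup N := integral_nonneg fun z =>
    mul_nonneg (norm_nonneg _) (pow_nonneg (phaseWeight_pos z).le _)
  rw [mul_assoc]
  refine (hC φ).trans (mul_le_mul_of_nonneg_left ?_ C.2)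
  refine Seminorm.finset_sup_apply_le (by positivity) fun m hm => ?_
  rw [mul_assoc, le_inv_mul_iff₀ hκ]
  refine gaborConst_mul_seminorm_le g φ hD' fun z => (hle m z).trans ?_
  have := phaseWeight_pos z
  gcongr
  · exact Finset.single_le_sum (fun m _ => (hD m).le) hm
  · exact one_le_phaseWeight z
  · exact Finset.le_sup hm

theorem memLp_two_phaseWeight_pow_inv :
    MemLp (fun z : 𝔼 × 𝔼 => (phaseWeight z ^ (n + 1))⁻¹) 2 := by
  have hc : Continuous fun z : 𝔼 × 𝔼 => (phaseWeight z ^ (n + 1))⁻¹ :=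
    (continuous_phaseWeight.pow _).inv₀ fun z => (pow_pos (phaseWeight_pos z) _).ne'
  rw [memLp_two_iff_integrable_sq hc.aestronglyMeasurable]
  refine (integrable_phaseWeight_pow_inv (Nat.lt_succ_self n)).mono' (hc.pow 2).aestronglyMeasurable
    (ae_of_all _ fun z => ?_)
  have hz : 1 ≤ phaseWeight z ^ (n + 1) := one_le_pow₀ (one_le_phaseWeight z)
  rw [Real.norm_of_nonneg (by positivity), sq]
  exact mul_le_of_le_one_left (by positivity) (inv_le_one_of_one_le₀ hz)

theorem memLp_two_phaseWeight_pow_mul_gaborPairing (g φ : 𝓢(𝔼, ℂ)) (K : ℕ) :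
    MemLp (fun z => ((phaseWeight z ^ K : ℝ) : ℂ) * gaborPairing g φ z) 2 := by
  obtain ⟨p, -, hle⟩ := exists_seminorm_norm_gaborPairing_le g (K + (n + 1))
  refine (memLp_two_phaseWeight_pow_inv.const_mul (p φ)).mono'
    ((Complex.continuous_ofReal.comp (continuous_phaseWeight.pow K)).mul
      (continuous_gaborPairing g φ)).aestronglyMeasurable (ae_of_all _ fun z => ?_)
  have hz := phaseWeight_pos z
  calc ‖((phaseWeight z ^ K : ℝ) : ℂ) * gaborPairing g φ z‖
    _ = phaseWeight z ^ K * ‖gaborPairing g φ z‖ := by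
        rw [norm_mul, Complex.norm_real, Real.norm_of_nonneg (by positivity)]
    _ ≤ phaseWeight z ^ K * (p φ * (phaseWeight z ^ (K + (n + 1)))⁻¹) := by gcongr; exact hle φ z
    _ = p φ * (phaseWeight z ^ (n + 1))⁻¹ := by rw [pow_add]; field_simp

theorem gaborPairing_add (g φ ψ : 𝓢(𝔼, ℂ)) (z : 𝔼 × 𝔼) :
    gaborPairing g (φ + ψ) z = gaborPairing g φ z + gaborPairing g ψ z := by
  simp only [gaborPairing, add_apply, add_mul]
  exact integral_add (integrable_schwartz_mul φ _) (integrable_schwartz_mul ψ _)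

theorem gaborPairing_smul (g φ : 𝓢(𝔼, ℂ)) (c : ℂ) (z : 𝔼 × 𝔼) :
    gaborPairing g (c • φ) z = c * gaborPairing g φ z := by
  simp only [gaborPairing, smul_apply, smul_eq_mul, mul_assoc, integral_const_mul]

/-- The pairing with time-frequency shifts, weighted by the `K`-th power of `phaseWeight`, as a
linear map from `𝓢` to `L²`. -/
noncomputable def weightedGaborPairing (g : 𝓢(𝔼, ℂ)) (K : ℕ) :
    𝓢(𝔼, ℂ) →ₗ[ℂ] Lp ℂ 2 (volume : Measure (𝔼 × 𝔼)) where
  toFun φ := (memLp_two_phaseWeight_pow_mul_gaborPairing g φ K).toLp _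
  map_add' φ ψ := by
    rw [← MemLp.toLp_add]
    congr 1
    ext z
    rw [gaborPairing_add, Pi.add_apply, mul_add]
  map_smul' c φ := by
    rw [RingHom.id_apply, ← MemLp.toLp_const_smul]
    congr 1
    ext z
    rw [gaborPairing_smul, Pi.smul_apply, smul_eq_mul, mul_left_comm]

theorem integral_norm_gaborPairing_mul_le_norm_weightedGaborPairing (g φ : 𝓢(𝔼, ℂ)) (N : ℕ) :
    ∫ z, ‖gaborPairing g φ z‖ * phaseWeight z ^ N
      ≤ ‖(memLp_two_phaseWeight_pow_inv (n := n)).toLp _‖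
        * ‖weightedGaborPairing g (N + (n + 1)) φ‖ := by
  refine le_of_eq_of_le (integral_congr_ae (ae_of_all _ fun z => ?_))
    (integral_mul_norm_le_norm_toLp_mul_norm_toLp memLp_two_phaseWeight_pow_inv
      (memLp_two_phaseWeight_pow_mul_gaborPairing g φ (N + (n + 1))))
  have hz := phaseWeight_pos z
  simp only [norm_mul, Complex.norm_real, norm_pow, Real.norm_of_nonneg hz.le, pow_add]
  field_simp

theorem exists_memLp_two_eq_integral_gaborPairing {g : 𝓢(𝔼, ℂ)} (hg : g ≠ 0) (f : 𝓢'(𝔼, ℂ)) :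
    ∃ (K : ℕ) (H : 𝔼 × 𝔼 → ℂ), MemLp H 2 ∧
      ∀ φ, f φ = ∫ z, H z * (((phaseWeight z ^ K : ℝ) : ℂ) * gaborPairing g φ z) := by
  let ℓ : 𝓢(𝔼, ℂ) →ₗ[ℂ] ℂ := ⟨⟨f, map_add f⟩, map_smul f⟩
  obtain ⟨N, C, hC, hle⟩ := exists_seminorm_le_integral_norm_gaborPairing hg
    (p := (normSeminorm ℂ ℂ).comp ℓ) (continuous_norm.comp (map_continuous f))
  set K := N + (n + 1)
  obtain ⟨G, hG⟩ := exists_dual_comp_eq_of_norm_le (weightedGaborPairing g K) ℓ fun φ =>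
    (hle φ).trans ((mul_le_mul_of_nonneg_left
      (integral_norm_gaborPairing_mul_le_norm_weightedGaborPairing g φ N) hC).trans_eq
        (mul_assoc _ _ _).symm)
  set h := (InnerProductSpace.toDual ℂ _).symm G
  refine ⟨K, fun z => (starRingEnd ℂ) (h z), (Lp.memLp h).star, fun φ => ?_⟩
  change ℓ φ = _
  rw [← hG φ, ← InnerProductSpace.toDual_symm_apply, L2.inner_def]
  refine integral_congr_ae ?_
  filter_upwards [(memLp_two_phaseWeight_pow_mul_gaborPairing g φ K).coeFn_toLp] with z hz
  rw [RCLike.inner_apply, mul_comm]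
  exact congrArg _ hz

end TemperedDistributions

section Reproducing

theorem gaborConst_mul_gaborPairing (g φ : 𝓢(𝔼, ℂ)) (z : 𝔼 × 𝔼) :
    gaborConst g * gaborPairing g φ z
      = ∫ z', gaborPairing g φ z' * gaborPairing g (conjTimeFrequencyShift g z') z := by
  have hint : Integrable (Function.uncurry fun (y : 𝔼) (z' : 𝔼 × 𝔼) =>
      gaborPairing g φ z' * conjTimeFrequencyShift g z' y * timeFrequencyShift g z y)
      (volume.prod volume) := by
    refine (((timeFrequencyShift g z).integrable.mul_prod (integrable_gaborPairing g φ)).bdd_mul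
      (c := SchwartzMap.seminorm ℂ 0 0 g) (f := fun w => conjTimeFrequencyShift g w.2 w.1) ?_
      (ae_of_all _ fun w => ?_)).congr (ae_of_all _ fun w => ?_)
    · exact ((continuous_conjTimeFrequencyShift_uncurry g).comp
        (f := fun w : 𝔼 × (𝔼 × 𝔼) => (w.2, w.1)) (by fun_prop)).aestronglyMeasurable
    · rw [norm_conjTimeFrequencyShift_apply]
      exact SchwartzMap.norm_le_seminorm ℂ g _
    · simp only [Function.uncurry_def]
      ring
  calc gaborConst g * gaborPairing g φ z
    _ = ∫ y, ∫ z', gaborPairing g φ z' * conjTimeFrequencyShift g z' y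
          * timeFrequencyShift g z y := by
        simp only [gaborPairing, ← integral_const_mul, integral_mul_const]
        simp only [← gaborPairing.eq_def, integral_gaborPairing_mul_conjTimeFrequencyShift,
          mul_assoc]
    _ = ∫ z', ∫ y, gaborPairing g φ z' * conjTimeFrequencyShift g z' y
          * timeFrequencyShift g z y := integral_integral_swap hint
    _ = ∫ z', gaborPairing g φ z' * gaborPairing g (conjTimeFrequencyShift g z') z := by
        simp only [mul_assoc, integral_const_mul]
        rfl

theorem exists_phaseWeight_pow_mul_norm_gaborPairing_le (g : 𝓢(𝔼, ℂ)) (N : ℕ) :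
    ∃ C : ℝ, 0 < C ∧ ∀ z z' : 𝔼 × 𝔼,
      phaseWeight z ^ N * ‖gaborPairing g (conjTimeFrequencyShift g z') z‖
        ≤ C * phaseWeight z' ^ N := by
  obtain ⟨C, hC, hle⟩ := exists_norm_gaborPairing_conjTimeFrequencyShift_le g N
  refine ⟨C, hC, fun z z' => ?_⟩
  have hz := phaseWeight_pos z
  have hz' := phaseWeight_pos z'
  have hzz' := phaseWeight_pos (z - z')
  calc phaseWeight z ^ N * ‖gaborPairing g (conjTimeFrequencyShift g z') z‖
    _ ≤ (phaseWeight z' * phaseWeight (z - z')) ^ N * (C * (phaseWeight (z - z') ^ N)⁻¹) := by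
        gcongr
        exacts [phaseWeight_le_mul_sub z z', hle z z']
    _ = C * phaseWeight z' ^ N := by
        rw [mul_pow]
        field_simp

theorem integrable_mul_phaseWeight_pow_mul_reproducingKernel (g φ : 𝓢(𝔼, ℂ)) (K : ℕ)
    {H : 𝔼 × 𝔼 → ℂ} (hH : MemLp H 2) :
    Integrable (Function.uncurry fun (z z' : 𝔼 × 𝔼) => H z * (((phaseWeight z ^ K : ℝ) : ℂ) *
      (gaborPairing g φ z' * gaborPairing g (conjTimeFrequencyShift g z') z)))
      (volume.prod volume) := by
  obtain ⟨C, -, hle⟩ := exists_phaseWeight_pow_mul_norm_gaborPairing_le g (K + (n + 1))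
  have hHint : Integrable fun z => ‖H z‖ * (phaseWeight z ^ (n + 1))⁻¹ :=
    hH.norm.integrable_mul memLp_two_phaseWeight_pow_inv
  refine ((hHint.mul_prod (integrable_norm_gaborPairing_mul_phaseWeight_pow g φ
    (K + (n + 1)))).const_mul C).mono' ?_ (ae_of_all _ fun ⟨z, z'⟩ => ?_)
  · refine hH.aestronglyMeasurable.comp_fst.mul (Continuous.aestronglyMeasurable ?_)
    have := continuous_gaborPairing g φ
    have := continuous_gaborPairing_conjTimeFrequencyShift g
    fun_prop
  have hz := phaseWeight_pos z
  set R := gaborPairing g (conjTimeFrequencyShift g z') z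
  calc ‖H z * (((phaseWeight z ^ K : ℝ) : ℂ) * (gaborPairing g φ z' * R))‖
    _ = ‖H z‖ * (phaseWeight z ^ (n + 1))⁻¹ * (‖gaborPairing g φ z'‖ *
          (phaseWeight z ^ (K + (n + 1)) * ‖R‖)) := by
        rw [norm_mul, norm_mul, norm_mul, Complex.norm_real, Real.norm_of_nonneg (by positivity),
          pow_add _ K (n + 1)]
        field_simp
    _ ≤ ‖H z‖ * (phaseWeight z ^ (n + 1))⁻¹ * (‖gaborPairing g φ z'‖ *
          (C * phaseWeight z' ^ (K + (n + 1)))) :=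
        mul_le_mul_of_nonneg_left (mul_le_mul_of_nonneg_left (hle z z') (norm_nonneg _))
          (by positivity)
    _ = C * (‖H z‖ * (phaseWeight z ^ (n + 1))⁻¹ *
          (‖gaborPairing g φ z'‖ * phaseWeight z' ^ (K + (n + 1)))) := by ring

theorem integral_mul_reproducingKernel_eq_stft_mul (g φ : 𝓢(𝔼, ℂ)) {f : 𝓢'(𝔼, ℂ)} {K : ℕ}
    {H : 𝔼 × 𝔼 → ℂ}
    (hf : ∀ φ, f φ = ∫ z, H z * (((phaseWeight z ^ K : ℝ) : ℂ) * gaborPairing g φ z))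
    (z' : 𝔼 × 𝔼) :
    ∫ z, H z * (((phaseWeight z ^ K : ℝ) : ℂ) *
      (gaborPairing g φ z' * gaborPairing g (conjTimeFrequencyShift g z') z))
      = stft g f z' * gaborPairing g φ z' := by
  rw [stft, hf, ← integral_mul_const]
  exact integral_congr_ae (ae_of_all _ fun z => by ring)

theorem integrable_stft_mul_gaborPairing {g : 𝓢(𝔼, ℂ)} (hg : g ≠ 0) (f : 𝓢'(𝔼, ℂ))
    (φ : 𝓢(𝔼, ℂ)) : Integrable fun z => stft g f z * gaborPairing g φ z := by
  obtain ⟨K, H, hH, hf⟩ := exists_memLp_two_eq_integral_gaborPairing hg f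
  exact (integrable_mul_phaseWeight_pow_mul_reproducingKernel g φ K hH).integral_prod_right.congr
    (ae_of_all _ (integral_mul_reproducingKernel_eq_stft_mul g φ hf))

theorem integral_stft_mul_gaborPairing {g : 𝓢(𝔼, ℂ)} (hg : g ≠ 0) (f : 𝓢'(𝔼, ℂ)) (φ : 𝓢(𝔼, ℂ)) :
    ∫ z, stft g f z * gaborPairing g φ z = gaborConst g * f φ := by
  obtain ⟨K, H, hH, hf⟩ := exists_memLp_two_eq_integral_gaborPairing hg f
  simp_rw [← integral_mul_reproducingKernel_eq_stft_mul g φ hf]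
  rw [← integral_integral_swap (integrable_mul_phaseWeight_pow_mul_reproducingKernel g φ K hH),
    hf φ, ← integral_const_mul]
  refine integral_congr_ae (ae_of_all _ fun z => ?_)
  simp only [integral_const_mul, ← gaborConst_mul_gaborPairing]
  ring

end Reproducing

/-! ### Modulation spaces -/

section Weight

/-- A weight that grows at most like the `N`-th power of `phaseWeight` under translations. The
power of `phaseWeight` replaces the polynomial weight of `IsPolynomiallyModerate`, because the
decay of short-time Fourier transforms is measured by powers of `phaseWeight`. -/
structure IsModerateWeight (w : 𝔼 × 𝔼 → ℝ) (C : ℝ) (N : ℕ) : Prop where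
  pos : ∀ z, 0 < w z
  aestronglyMeasurable : AEStronglyMeasurable w volume
  const_pos : 0 < C
  add_le : ∀ z z', w (z + z') ≤ C * phaseWeight z ^ N * w z'

theorem polyWeight_pos (s : ℝ) (z : 𝔼 × 𝔼) : 0 < polyWeight s z := by
  unfold polyWeight
  positivity

theorem one_add_norm_sq_add_norm_sq_le_phaseWeight_sq (z : 𝔼 × 𝔼) :
    1 + ‖z.1‖ ^ 2 + ‖z.2‖ ^ 2 ≤ phaseWeight z ^ 2 := by
  rw [phaseWeight, ← sub_nonneg]
  ring_nf
  positivity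

theorem polyWeight_le_phaseWeight_pow {s : ℝ} {N : ℕ} (hs : s ≤ N) (z : 𝔼 × 𝔼) :
    polyWeight s z ≤ phaseWeight z ^ N := by
  have hbase : 1 ≤ 1 + ‖z.1‖ ^ 2 + ‖z.2‖ ^ 2 := by nlinarith [sq_nonneg ‖z.1‖, sq_nonneg ‖z.2‖]
  calc polyWeight s z
    _ ≤ (1 + ‖z.1‖ ^ 2 + ‖z.2‖ ^ 2) ^ ((N : ℝ) / 2) :=
        Real.rpow_le_rpow_of_exponent_le hbase (by linarith)
    _ ≤ (phaseWeight z ^ (2 : ℝ)) ^ ((N : ℝ) / 2) := by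
        rw [Real.rpow_two]
        gcongr
        exact one_add_norm_sq_add_norm_sq_le_phaseWeight_sq z
    _ = phaseWeight z ^ N := by
        rw [← Real.rpow_mul (phaseWeight_pos z).le, mul_div_cancel₀ _ two_ne_zero,
          Real.rpow_natCast]

theorem IsWeight.exists_isModerateWeight {w : 𝔼 × 𝔼 → ℝ} (hw : IsWeight w)
    (hm : IsPolynomiallyModerate w) : ∃ C N, IsModerateWeight w C N := by
  obtain ⟨s, C, h⟩ := hm
  obtain ⟨N, hN⟩ := exists_nat_ge s
  have hC : 0 < C := by
    have h₀ := (hw.pos (0 + 0)).trans_le (h 0 0)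
    exact pos_of_mul_pos_left h₀ (mul_pos (polyWeight_pos s 0) (hw.pos 0)).le
  refine ⟨C, N, hw.pos, hw.locallyIntegrable.aestronglyMeasurable, hC, fun z z' => ?_⟩
  have hz' := (hw.pos z').le
  calc w (z + z')
    _ ≤ C * (polyWeight s z * w z') := h z z'
    _ ≤ C * (phaseWeight z ^ N * w z') := by
        gcongr
        exact polyWeight_le_phaseWeight_pow hN z
    _ = C * phaseWeight z ^ N * w z' := (mul_assoc _ _ _).symm

namespace IsModerateWeight

variable {w : EuclideanSpace ℝ (Fin n) × EuclideanSpace ℝ (Fin n) → ℝ} {C : ℝ} {N : ℕ}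

theorem le_sub (hw : IsModerateWeight w C N) (z z' : 𝔼 × 𝔼) :
    w z ≤ C * phaseWeight (z - z') ^ N * w z' := by
  simpa only [sub_add_cancel] using hw.add_le (z - z') z'

theorem inv_le (hw : IsModerateWeight w C N) (z : 𝔼 × 𝔼) :
    (w z)⁻¹ ≤ (C / w 0) * phaseWeight z ^ N := by
  have h := hw.le_sub 0 z
  rw [phaseWeight_sub_comm, sub_zero] at h
  rwa [inv_le_iff_one_le_mul₀ (hw.pos z), div_mul_eq_mul_div, div_mul_eq_mul_div,
    one_le_div (hw.pos 0)]

theorem phaseWeight_pow_inv_le (hw : IsModerateWeight w C N) (M : ℕ) (z : 𝔼 × 𝔼) :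
    (phaseWeight z ^ (N + M))⁻¹ ≤ C / w 0 * (w z * (phaseWeight z ^ M)⁻¹) := by
  have hz := phaseWeight_pos z
  have hle : 1 ≤ C / w 0 * phaseWeight z ^ N * w z := by
    rw [← inv_le_iff_one_le_mul₀ (hw.pos z)]
    exact hw.inv_le z
  calc (phaseWeight z ^ (N + M))⁻¹
    _ ≤ (C / w 0 * phaseWeight z ^ N * w z) * (phaseWeight z ^ (N + M))⁻¹ :=
        le_mul_of_one_le_left (by positivity) hle
    _ = C / w 0 * (w z * (phaseWeight z ^ M)⁻¹) := by
        rw [pow_add]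
        field_simp

theorem enorm_ofReal_mul (hw : IsModerateWeight w C N) (z : 𝔼 × 𝔼) (c : ℂ) :
    ‖(w z : ℂ) * c‖ₑ = ENNReal.ofReal (w z) * ‖c‖ₑ := by
  rw [_root_.enorm_mul, ← ofReal_norm, Complex.norm_real, Real.norm_of_nonneg (hw.pos z).le]

theorem aestronglyMeasurable_mul (hw : IsModerateWeight w C N) {F : 𝔼 × 𝔼 → ℂ}
    (hF : AEStronglyMeasurable F volume) :
    AEStronglyMeasurable (fun z => (w z : ℂ) * F z) volume :=
  (Complex.continuous_ofReal.comp_aestronglyMeasurable hw.aestronglyMeasurable).mul hF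

end IsModerateWeight

theorem eLpNorm_one_add_norm_pow_inv_ne_top {p : ℝ≥0∞} (hp : 1 ≤ p) {N : ℕ} (hN : n < N) :
    eLpNorm (fun x : 𝔼 => ENNReal.ofReal ((1 + ‖x‖) ^ N)⁻¹) p volume ≠ ∞ := by
  have hle (x : 𝔼) : ENNReal.ofReal ((1 + ‖x‖) ^ N)⁻¹ ≤ 1 := by
    rw [ENNReal.ofReal_le_one]
    exact inv_le_one_of_one_le₀ (one_le_pow₀ (le_add_of_nonneg_right (norm_nonneg x)))
  rcases eq_or_ne p ∞ with rfl | hp'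
  · rw [eLpNorm_exponent_top]
    exact ne_top_of_le_ne_top ENNReal.one_ne_top (eLpNormEssSup_le_of_ae_enorm_bound
      (ae_of_all _ fun x => (enorm_eq_self _).trans_le (hle x)))
  rw [eLpNorm_ennreal_eq_lintegral_rpow (one_pos.trans_le hp).ne' hp']
  refine (ENNReal.rpow_lt_top_of_nonneg (by positivity) ?_).ne
  have hint : Integrable fun x : 𝔼 => ((1 + ‖x‖) ^ N)⁻¹ :=
    integrable_one_add_norm_pow_inv (finrank_euclideanSpace_fin.trans_lt hN)
  refine ne_top_of_le_ne_top hint.lintegral_lt_top.ne (lintegral_mono fun x => ?_)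
  exact (ENNReal.rpow_le_rpow_of_exponent_ge (hle x) (ENNReal.toReal_mono hp' hp)).trans_eq
    (ENNReal.rpow_one _)

theorem mixedLNorm_phaseWeight_pow_inv_ne_top {p q : ℝ≥0∞} (hp : 1 ≤ p) (hq : 1 ≤ q) {N : ℕ}
    (hN : n < N) :
    mixedLNorm p q (fun z : 𝔼 × 𝔼 => ENNReal.ofReal (phaseWeight z ^ N)⁻¹) ≠ ∞ := by
  have factor (z : 𝔼 × 𝔼) : ENNReal.ofReal (phaseWeight z ^ N)⁻¹
      = ENNReal.ofReal ((1 + ‖z.2‖) ^ N)⁻¹ * ENNReal.ofReal ((1 + ‖z.1‖) ^ N)⁻¹ := by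
    rw [phaseWeight, mul_pow, mul_inv, mul_comm, ENNReal.ofReal_mul (by positivity)]
  have hx := eLpNorm_one_add_norm_pow_inv_ne_top (n := n) hp hN
  simp only [mixedLNorm, factor, eLpNorm_ennreal_const_mul p ENNReal.ofReal_ne_top]
  simp only [mul_comm _ (eLpNorm _ p volume), eLpNorm_ennreal_const_mul q hx]
  exact ENNReal.mul_ne_top hx (eLpNorm_one_add_norm_pow_inv_ne_top hq hN)

theorem measurable_phaseWeight_pow_inv (N : ℕ) :
    Measurable fun z : 𝔼 × 𝔼 => ENNReal.ofReal (phaseWeight z ^ N)⁻¹ :=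
  (continuous_phaseWeight.measurable.pow_const N).inv.ennreal_ofReal

theorem IsModerateWeight.exists_lintegral_mul_phaseWeight_le {w : 𝔼 × 𝔼 → ℝ} {C : ℝ} {N : ℕ}
    (hw : IsModerateWeight w C N) {p q : ℝ≥0∞} (hp : 1 ≤ p) (hq : 1 ≤ q) :
    ∃ D : ℝ≥0∞, D ≠ ∞ ∧ ∀ F : 𝔼 × 𝔼 → ℂ, AEStronglyMeasurable F volume →
      ∫⁻ z, ‖F z‖ₑ * ENNReal.ofReal (phaseWeight z ^ (N + (n + 1)))⁻¹
        ≤ D * mixedENorm p q (fun z => (w z : ℂ) * F z) := by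
  have := ENNReal.HolderConjugate.conjExponent hp
  have := ENNReal.HolderConjugate.conjExponent hq
  have one_le_conjExponent (r : ℝ≥0∞) : 1 ≤ r.conjExponent := le_self_add
  set v : 𝔼 × 𝔼 → ℝ≥0∞ := fun z => ENNReal.ofReal (phaseWeight z ^ (n + 1))⁻¹
  set c := ENNReal.ofReal (C / w 0)
  have pointwise (F : 𝔼 × 𝔼 → ℂ) (z : 𝔼 × 𝔼) :
      ‖F z‖ₑ * ENNReal.ofReal (phaseWeight z ^ (N + (n + 1)))⁻¹
        ≤ c * (‖(w z : ℂ) * F z‖ₑ * v z) := by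
    calc ‖F z‖ₑ * ENNReal.ofReal (phaseWeight z ^ (N + (n + 1)))⁻¹
      _ ≤ ‖F z‖ₑ * (c * (ENNReal.ofReal (w z) * v z)) := by
          rw [← ENNReal.ofReal_mul (hw.pos z).le,
            ← ENNReal.ofReal_mul (div_pos hw.const_pos (hw.pos 0)).le]
          gcongr
          exact hw.phaseWeight_pow_inv_le _ z
      _ = c * (‖(w z : ℂ) * F z‖ₑ * v z) := by
          rw [hw.enorm_ofReal_mul]
          ring
  refine ⟨c * mixedLNorm p.conjExponent q.conjExponent v, ENNReal.mul_ne_top ENNReal.ofReal_ne_top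
    (mixedLNorm_phaseWeight_pow_inv_ne_top (one_le_conjExponent p) (one_le_conjExponent q)
      (Nat.lt_succ_self n)), fun F hF => ?_⟩
  rw [mixedENorm_eq_mixedLNorm, mul_assoc, mul_comm (mixedLNorm _ _ v)]
  calc ∫⁻ z, ‖F z‖ₑ * ENNReal.ofReal (phaseWeight z ^ (N + (n + 1)))⁻¹
    _ ≤ ∫⁻ z, c * (‖(w z : ℂ) * F z‖ₑ * v z) := lintegral_mono (pointwise F)
    _ = c * ∫⁻ z, ‖(w z : ℂ) * F z‖ₑ * v z := lintegral_const_mul' _ _ ENNReal.ofReal_ne_top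
    _ ≤ c * _ := by
        gcongr
        exact lintegral_mul_le_mixedLNorm_mul_mixedLNorm p _ q _
          (hw.aestronglyMeasurable_mul hF).enorm (measurable_phaseWeight_pow_inv _).aemeasurable

end Weight

section StftContinuous

theorem continuous_stft {g : 𝓢(𝔼, ℂ)} (hg : g ≠ 0) (f : 𝓢'(𝔼, ℂ)) : Continuous (stft g f) := by
  obtain ⟨K, H, hH, hf⟩ := exists_memLp_two_eq_integral_gaborPairing hg f
  obtain ⟨C, hC, hle⟩ := exists_phaseWeight_pow_mul_norm_gaborPairing_le g (K + (n + 1))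
  have hHint : Integrable fun z => ‖H z‖ * (phaseWeight z ^ (n + 1))⁻¹ :=
    hH.norm.integrable_mul memLp_two_phaseWeight_pow_inv
  have stft_eq : stft g f = fun z' => ∫ z, H z * (((phaseWeight z ^ K : ℝ) : ℂ)
      * gaborPairing g (conjTimeFrequencyShift g z') z) := funext fun z' => hf _
  have hmeas (z') : AEStronglyMeasurable (fun z => H z * (((phaseWeight z ^ K : ℝ) : ℂ)
      * gaborPairing g (conjTimeFrequencyShift g z') z)) volume :=
    hH.aestronglyMeasurable.mul
      (memLp_two_phaseWeight_pow_mul_gaborPairing g _ K).aestronglyMeasurable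
  rw [stft_eq]
  refine continuous_iff_continuousAt.2 fun a => ?_
  have hnear : ∀ᶠ z' in 𝓝 a, phaseWeight z' < phaseWeight a + 1 :=
    continuous_phaseWeight.continuousAt.eventually_lt_const (lt_add_one _)
  refine continuousAt_of_dominated (bound := fun z => (C * (phaseWeight a + 1) ^ (K + (n + 1))) *
    (‖H z‖ * (phaseWeight z ^ (n + 1))⁻¹)) (.of_forall hmeas) ?_
    (hHint.const_mul _) (ae_of_all _ fun z => Continuous.continuousAt ?_)
  · filter_upwards [hnear] with z' hz'
    refine ae_of_all _ fun z => ?_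
    have hz := phaseWeight_pos z
    have hz'₀ := phaseWeight_pos z'
    set R := gaborPairing g (conjTimeFrequencyShift g z') z
    calc ‖H z * (((phaseWeight z ^ K : ℝ) : ℂ) * R)‖
      _ = ‖H z‖ * (phaseWeight z ^ (n + 1))⁻¹ * (phaseWeight z ^ (K + (n + 1)) * ‖R‖) := by
          rw [norm_mul, norm_mul, Complex.norm_real, Real.norm_of_nonneg (by positivity),
            pow_add _ K (n + 1)]
          field_simp
      _ ≤ ‖H z‖ * (phaseWeight z ^ (n + 1))⁻¹ * (C * phaseWeight z' ^ (K + (n + 1))) :=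
          mul_le_mul_of_nonneg_left (hle z z') (by positivity)
      _ ≤ ‖H z‖ * (phaseWeight z ^ (n + 1))⁻¹ * (C * (phaseWeight a + 1) ^ (K + (n + 1))) := by
          gcongr
      _ = C * (phaseWeight a + 1) ^ (K + (n + 1)) * (‖H z‖ * (phaseWeight z ^ (n + 1))⁻¹) :=
          mul_comm _ _
  · have hR : Continuous fun z' => gaborPairing g (conjTimeFrequencyShift g z') z :=
      (continuous_gaborPairing_conjTimeFrequencyShift g).comp (f := fun z' => (z, z')) (by fun_prop)
    exact continuous_const.mul (continuous_const.mul hR)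

end StftContinuous

section Synthesis

theorem norm_le_toReal_mul_norm_of_enorm_le {E F : Type*} [SeminormedAddCommGroup E]
    [SeminormedAddCommGroup F] {K : ℝ≥0∞} (hK : K ≠ ∞) {x : E} {y : F} (h : ‖x‖ₑ ≤ K * ‖y‖ₑ) :
    ‖x‖ ≤ K.toReal * ‖y‖ := by
  simpa only [ENNReal.toReal_mul, toReal_enorm]
    using ENNReal.toReal_mono (ENNReal.mul_ne_top hK enorm_ne_top) h

theorem exists_continuousLinearMap_of_enorm_le {E F : Type*} [SeminormedAddCommGroup E]
    [NormedSpace ℂ E] [SeminormedAddCommGroup F] [NormedSpace ℂ F] (f : E →ₗ[ℂ] F) {K : ℝ≥0∞}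
    (hK : K ≠ ∞) (h : ∀ x, ‖f x‖ₑ ≤ K * ‖x‖ₑ) :
    ∃ T : E →L[ℂ] F, (∀ x, T x = f x) ∧ ‖T‖ₑ ≤ K := by
  have hb (x : E) : ‖f x‖ ≤ K.toReal * ‖x‖ := norm_le_toReal_mul_norm_of_enorm_le hK (h x)
  refine ⟨f.mkContinuous _ hb, fun _ => rfl, ?_⟩
  rw [← ofReal_norm]
  exact (ENNReal.ofReal_le_ofReal (f.mkContinuous_norm_le ENNReal.toReal_nonneg hb)).trans_eq
    (ENNReal.ofReal_toReal hK)

theorem continuous_linearMap_of_norm_le {E F : Type*} [AddCommGroup E] [Module ℂ E]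
    [TopologicalSpace E] [IsTopologicalAddGroup E] [SeminormedAddCommGroup F] [NormedSpace ℂ F]
    (f : E →ₗ[ℂ] F) {p : Seminorm ℂ E} (hp : Continuous p) {c : ℝ} (h : ∀ x, ‖f x‖ ≤ p x * c) :
    Continuous f := by
  refine continuous_of_continuousAt_zero f ?_
  have hlim : Tendsto (fun x => p x * c) (𝓝 0) (𝓝 0) := by
    simpa only [map_zero, zero_mul] using (hp.mul_const c).tendsto 0
  rw [ContinuousAt, map_zero]
  exact squeeze_zero_norm h hlim

theorem exists_tempered_eq_integral_mul_gaborPairing (g : 𝓢(𝔼, ℂ)) {M : ℕ} {F : 𝔼 × 𝔼 → ℂ}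
    (hF : AEStronglyMeasurable F volume)
    (hM : ∫⁻ z, ‖F z‖ₑ * ENNReal.ofReal (phaseWeight z ^ M)⁻¹ ≠ ∞) :
    ∃ f : 𝓢'(𝔼, ℂ), ∀ φ, Integrable (fun z => F z * gaborPairing g φ z) ∧
      f φ = ∫ z, F z * gaborPairing g φ z := by
  obtain ⟨p, hp, hpφ⟩ := exists_seminorm_norm_gaborPairing_le g M
  have hFi : Integrable fun z => ‖F z‖ * (phaseWeight z ^ M)⁻¹ := by
    have hcont : Continuous fun z : 𝔼 × 𝔼 => (phaseWeight z ^ M)⁻¹ :=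
      (continuous_phaseWeight.pow _).inv₀ fun z => (pow_pos (phaseWeight_pos z) _).ne'
    refine ⟨hF.norm.mul hcont.aestronglyMeasurable, lt_of_le_of_lt (lintegral_mono fun z => ?_)
      hM.lt_top⟩
    have hz := phaseWeight_pos z
    rw [enorm_mul, enorm_norm, Real.enorm_of_nonneg (by positivity)]
  have hle (φ : 𝓢(𝔼, ℂ)) (z : 𝔼 × 𝔼) :
      ‖F z * gaborPairing g φ z‖ ≤ p φ * (‖F z‖ * (phaseWeight z ^ M)⁻¹) := by
    rw [norm_mul, mul_left_comm]
    exact mul_le_mul_of_nonneg_left (hpφ φ z) (norm_nonneg _)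
  have hint (φ : 𝓢(𝔼, ℂ)) : Integrable fun z => F z * gaborPairing g φ z :=
    (hFi.const_mul (p φ)).mono' (hF.mul (continuous_gaborPairing g φ).aestronglyMeasurable)
      (ae_of_all _ (hle φ))
  let L : 𝓢(𝔼, ℂ) →ₗ[ℂ] ℂ :=
    { toFun φ := ∫ z, F z * gaborPairing g φ z
      map_add' φ ψ := by
        simp_rw [← integral_add (hint φ) (hint ψ), gaborPairing_add, mul_add]
      map_smul' c φ := by
        simp_rw [RingHom.id_apply, smul_eq_mul, ← integral_const_mul, gaborPairing_smul,
          mul_left_comm] }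
  have hL (φ : 𝓢(𝔼, ℂ)) : ‖L φ‖ ≤ p φ * ∫ z, ‖F z‖ * (phaseWeight z ^ M)⁻¹ := by
    rw [← integral_const_mul]
    exact norm_integral_le_of_norm_le (hFi.const_mul _) (ae_of_all _ (hle φ))
  exact ⟨⟨L, continuous_linearMap_of_norm_le L hp hL⟩, fun φ => ⟨hint φ, rfl⟩⟩

namespace IsModerateWeight

variable {w : EuclideanSpace ℝ (Fin n) × EuclideanSpace ℝ (Fin n) → ℝ} {C : ℝ} {N : ℕ}

theorem exists_enorm_mul_gaborPairing_le (hw : IsModerateWeight w C N) (g : 𝓢(𝔼, ℂ)) :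
    ∃ D : ℝ≥0∞, D ≠ ∞ ∧ ∀ z z',
      ‖(w z' : ℂ) * gaborPairing g (conjTimeFrequencyShift g z') z‖ₑ
        ≤ D * ENNReal.ofReal (phaseWeight (z' - z) ^ (n + 1))⁻¹ * ENNReal.ofReal (w z) := by
  obtain ⟨C', hC', hle⟩ := exists_norm_gaborPairing_conjTimeFrequencyShift_le g (N + (n + 1))
  have hC := hw.const_pos
  refine ⟨ENNReal.ofReal (C * C'), ENNReal.ofReal_ne_top, fun z z' => ?_⟩
  have hzz' := phaseWeight_pos (z' - z)
  have hwz := hw.pos z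
  have hwz' := hw.pos z'
  rw [hw.enorm_ofReal_mul, ← ofReal_norm, ← ENNReal.ofReal_mul hwz'.le,
    ← ENNReal.ofReal_mul (by positivity), ← ENNReal.ofReal_mul (by positivity)]
  refine ENNReal.ofReal_le_ofReal ?_
  calc w z' * ‖gaborPairing g (conjTimeFrequencyShift g z') z‖
    _ ≤ (C * phaseWeight (z' - z) ^ N * w z) *
        (C' * (phaseWeight (z' - z) ^ (N + (n + 1)))⁻¹) := by
        refine mul_le_mul (hw.le_sub z' z) ?_ (norm_nonneg _) (by positivity)
        rw [phaseWeight_sub_comm]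
        exact hle z z'
    _ = C * C' * (phaseWeight (z' - z) ^ (n + 1))⁻¹ * w z := by
        rw [pow_add]
        field_simp

theorem exists_modulationENorm_le (hw : IsModerateWeight w C N) (g : 𝓢(𝔼, ℂ)) {p q : ℝ≥0∞}
    (hp : 1 ≤ p) (hp' : p ≠ ∞) (hq : 1 ≤ q) (hq' : q ≠ ∞) :
    ∃ D : ℝ≥0∞, D ≠ ∞ ∧ ∀ F : 𝔼 × 𝔼 → ℂ, AEStronglyMeasurable F volume → ∀ f : 𝓢'(𝔼, ℂ),
      (∀ φ, f φ = ∫ z, F z * gaborPairing g φ z) →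
        modulationENorm g w p q f ≤ D * mixedENorm p q (fun z => (w z : ℂ) * F z) := by
  obtain ⟨D, hD, hR⟩ := hw.exists_enorm_mul_gaborPairing_le g
  set k : 𝔼 × 𝔼 → ℝ≥0∞ := fun z => D * ENNReal.ofReal (phaseWeight z ^ (n + 1))⁻¹
  have hk : ∫⁻ z, k z ≠ ∞ := by
    rw [lintegral_const_mul' _ _ hD]
    exact ENNReal.mul_ne_top hD
      (integrable_phaseWeight_pow_inv (Nat.lt_succ_self n)).lintegral_lt_top.ne
  refine ⟨∫⁻ z, k z, hk, fun F hF f hf => ?_⟩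
  rw [modulationENorm, mixedENorm_eq_mixedLNorm, mixedENorm_eq_mixedLNorm]
  refine le_trans (mixedLNorm_mono fun z' => ?_) (mixedLNorm_convolution_le hp hp' hq hq'
    ((measurable_phaseWeight_pow_inv _).const_mul D)
    (fun z => ENNReal.mul_ne_top hD ENNReal.ofReal_ne_top) (hw.aestronglyMeasurable_mul hF).enorm)
  calc ‖(w z' : ℂ) * stft g f z'‖ₑ
    _ = ‖∫ z, F z * ((w z' : ℂ) * gaborPairing g (conjTimeFrequencyShift g z') z)‖ₑ := by
        simp_rw [stft, hf, ← integral_const_mul, mul_left_comm]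
    _ ≤ ∫⁻ z, ‖F z * ((w z' : ℂ) * gaborPairing g (conjTimeFrequencyShift g z') z)‖ₑ :=
        enorm_integral_le_lintegral_enorm _
    _ ≤ ∫⁻ z, k (z' - z) * ‖(w z : ℂ) * F z‖ₑ := by
        refine lintegral_mono fun z => ?_
        rw [hw.enorm_ofReal_mul, enorm_mul, ← mul_assoc, mul_comm]
        gcongr
        exact hR z z'

end IsModerateWeight

end Synthesis

namespace ModulationSpace

variable {g : 𝓢(EuclideanSpace ℝ (Fin n), ℂ)}
  {w : EuclideanSpace ℝ (Fin n) × EuclideanSpace ℝ (Fin n) → ℝ} {p q : ℝ≥0∞}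
  [hp : Fact (1 ≤ p)] [hp' : Fact (p ≠ ∞)] [hq : Fact (1 ≤ q)] [hq' : Fact (q ≠ ∞)]
  {C : ℝ} {N : ℕ}

theorem toDistribution_injective :
    Function.Injective (toDistribution (g := g) (w := w) (p := p) (q := q)) :=
  Subtype.val_injective

theorem enorm_eq (a : ModulationSpace g w p q) :
    ‖a‖ₑ = modulationENorm g w p q (toDistribution a) := by
  rw [← ofReal_norm, norm_def, ENNReal.ofReal_toReal (modulationENorm_lt_top a).ne]

theorem exists_toDistribution_eq (hg : g ≠ 0) (hw : IsModerateWeight w C N) {f : 𝓢'(𝔼, ℂ)}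
    (h : modulationENorm g w p q f ≠ ∞) :
    ∃ a : ModulationSpace g w p q, toDistribution a = f :=
  ⟨⟨f, hw.aestronglyMeasurable_mul (continuous_stft hg f).aestronglyMeasurable, h.lt_top⟩, rfl⟩

theorem exists_synthesis (hg : g ≠ 0) (hw : IsModerateWeight w C N) :
    ∃ D : ℝ≥0∞, D ≠ ∞ ∧ ∀ F : 𝔼 × 𝔼 → ℂ, AEStronglyMeasurable F volume →
      mixedENorm p q (fun z => (w z : ℂ) * F z) ≠ ∞ → ∃ a : ModulationSpace g w p q,
        (∀ φ, Integrable (fun z => F z * gaborPairing g φ z) ∧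
          toDistribution a φ = ∫ z, F z * gaborPairing g φ z) ∧
        ‖a‖ₑ ≤ D * mixedENorm p q (fun z => (w z : ℂ) * F z) := by
  obtain ⟨D, hD, hle⟩ := hw.exists_modulationENorm_le g hp.out hp'.out hq.out hq'.out
  obtain ⟨D', hD', hle'⟩ := hw.exists_lintegral_mul_phaseWeight_le hp.out hq.out
  refine ⟨D, hD, fun F hF hfin => ?_⟩
  obtain ⟨f, hf⟩ := exists_tempered_eq_integral_mul_gaborPairing g hF
    (ne_top_of_le_ne_top (ENNReal.mul_ne_top hD' hfin) (hle' F hF))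
  have hfD := hle F hF f fun φ => (hf φ).2
  obtain ⟨a, rfl⟩ := exists_toDistribution_eq hg hw
    (ne_top_of_le_ne_top (ENNReal.mul_ne_top hD hfin) hfD)
  exact ⟨a, hf, (enorm_eq a).trans_le hfD⟩

theorem integral_stft_mul_gaborPairing_eq_smul (hg : g ≠ 0) (a : ModulationSpace g w p q)
    (φ : 𝓢(𝔼, ℂ)) :
    ∫ z, stft g (toDistribution a) z * gaborPairing g φ z
      = toDistribution ((gaborConst g : ℂ) • a) φ := by
  rw [integral_stft_mul_gaborPairing hg, map_smul]
  rfl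

theorem exists_enorm_apply_le (hg : g ≠ 0) (hw : IsModerateWeight w C N) (φ : 𝓢(𝔼, ℂ)) :
    ∃ K : ℝ≥0∞, K ≠ ∞ ∧ ∀ a : ModulationSpace g w p q, ‖toDistribution a φ‖ₑ ≤ K * ‖a‖ₑ := by
  obtain ⟨D, hD, hle⟩ := hw.exists_lintegral_mul_phaseWeight_le hp.out hq.out
  obtain ⟨s, -, hs⟩ := exists_seminorm_norm_gaborPairing_le g (N + (n + 1))
  have hκ : (gaborConst g : ℂ) ≠ 0 := Complex.ofReal_ne_zero.2 (gaborConst_pos hg).ne'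
  refine ⟨‖(gaborConst g : ℂ)⁻¹‖ₑ * (ENNReal.ofReal (s φ) * D), ENNReal.mul_ne_top enorm_ne_top
    (ENNReal.mul_ne_top ENNReal.ofReal_ne_top hD), fun a => ?_⟩
  set V := stft g (toDistribution a) with hV
  calc ‖toDistribution a φ‖ₑ
    _ = ‖(gaborConst g : ℂ)⁻¹‖ₑ * ‖∫ z, V z * gaborPairing g φ z‖ₑ := by
        rw [hV, integral_stft_mul_gaborPairing hg, ← enorm_mul, inv_mul_cancel_left₀ hκ]
    _ ≤ ‖(gaborConst g : ℂ)⁻¹‖ₑ * ∫⁻ z, ‖V z * gaborPairing g φ z‖ₑ := by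
        gcongr
        exact enorm_integral_le_lintegral_enorm _
    _ ≤ ‖(gaborConst g : ℂ)⁻¹‖ₑ * ∫⁻ z, ENNReal.ofReal (s φ) *
          (‖V z‖ₑ * ENNReal.ofReal (phaseWeight z ^ (N + (n + 1)))⁻¹) := by
        gcongr with z
        rw [enorm_mul, mul_left_comm, ← ENNReal.ofReal_mul (apply_nonneg s φ),
          ← ofReal_norm (gaborPairing g φ z)]
        gcongr
        exact hs φ z
    _ ≤ ‖(gaborConst g : ℂ)⁻¹‖ₑ * (ENNReal.ofReal (s φ) * (D * ‖a‖ₑ)) := by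
        rw [lintegral_const_mul' _ _ ENNReal.ofReal_ne_top, enorm_eq]
        gcongr
        exact hle V (continuous_stft hg _).aestronglyMeasurable
    _ = ‖(gaborConst g : ℂ)⁻¹‖ₑ * (ENNReal.ofReal (s φ) * D) * ‖a‖ₑ := by
        simp only [mul_assoc]

theorem exists_continuousLinearMap_eq_apply (hg : g ≠ 0) (hw : IsModerateWeight w C N)
    (φ : 𝓢(𝔼, ℂ)) :
    ∃ e : ModulationSpace g w p q →L[ℂ] ℂ, ∀ a, e a = toDistribution a φ := by
  obtain ⟨K, hK, hle⟩ := exists_enorm_apply_le (p := p) (q := q) hg hw φ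
  let L : ModulationSpace g w p q →ₗ[ℂ] ℂ :=
    { toFun a := toDistribution a φ
      map_add' _ _ := rfl
      map_smul' _ _ := rfl }
  obtain ⟨T, hT, -⟩ := exists_continuousLinearMap_of_enorm_le L hK hle
  exact ⟨T, hT⟩

/-- For a nonzero window, the modulation norm is definite. It is not an instance because it depends
on `g ≠ 0`. -/
noncomputable abbrev normedAddCommGroup (hg : g ≠ 0) (hw : IsModerateWeight w C N) :
    NormedAddCommGroup (ModulationSpace g w p q) :=
  NormedAddCommGroup.ofSeparation fun a ha => by
    refine toDistribution_injective ?_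
    rw [map_zero]
    ext φ
    obtain ⟨K, -, hle⟩ := exists_enorm_apply_le (p := p) (q := q) hg hw φ
    have haφ := hle a
    rwa [← ofReal_norm a, ha, ENNReal.ofReal_zero, mul_zero, nonpos_iff_eq_zero,
      enorm_eq_zero] at haφ

section Series

variable {u : ℕ → ModulationSpace g w p q}

theorem mixedLNorm_tsum_enorm_stft_le (hg : g ≠ 0) (hw : IsModerateWeight w C N) :
    mixedLNorm p q (fun z => ∑' j, ‖(w z : ℂ) * stft g (toDistribution (u j)) z‖ₑ)
      ≤ ∑' j, ‖u j‖ₑ := by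
  simp_rw [enorm_eq, modulationENorm, mixedENorm_eq_mixedLNorm]
  exact mixedLNorm_tsum_le hp.out hp'.out hq.out hq'.out fun j =>
    (hw.aestronglyMeasurable_mul (continuous_stft hg _).aestronglyMeasurable).enorm

theorem mixedENorm_tsum_stft_le (hg : g ≠ 0) (hw : IsModerateWeight w C N) :
    mixedENorm p q (fun z => (w z : ℂ) * ∑' j, stft g (toDistribution (u j)) z)
      ≤ ∑' j, ‖u j‖ₑ := by
  rw [mixedENorm_eq_mixedLNorm]
  refine le_trans (mixedLNorm_mono fun z => ?_) (mixedLNorm_tsum_enorm_stft_le hg hw)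
  rw [← tsum_mul_left]
  exact enorm_tsum_le_tsum_enorm

theorem ae_summable_stft (hg : g ≠ 0) (hw : IsModerateWeight w C N) (hu : ∑' j, ‖u j‖ₑ ≠ ∞) :
    ∀ᵐ z, Summable fun j => stft g (toDistribution (u j)) z := by
  have hmeas (j : ℕ) : AEMeasurable fun z => ‖(w z : ℂ) * stft g (toDistribution (u j)) z‖ₑ :=
    (hw.aestronglyMeasurable_mul (continuous_stft hg _).aestronglyMeasurable).enorm
  have hfin : ∀ᵐ z, ∑' j, ‖(w z : ℂ) * stft g (toDistribution (u j)) z‖ₑ < ∞ :=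
    ae_lt_top_of_mixedLNorm_ne_top (zero_lt_one.trans_le hp.out).ne'
      (zero_lt_one.trans_le hq.out).ne' (AEMeasurable.tsum hmeas)
      (ne_top_of_le_ne_top hu (mixedLNorm_tsum_enorm_stft_le hg hw))
  filter_upwards [hfin] with z hz
  exact (summable_mul_left_iff (Complex.ofReal_ne_zero.2 (hw.pos z).ne')).1 (.of_enorm hz.ne)

theorem aestronglyMeasurable_tsum_stft (hg : g ≠ 0) (hw : IsModerateWeight w C N)
    (hu : ∑' j, ‖u j‖ₑ ≠ ∞) :
    AEStronglyMeasurable (fun z => ∑' j, stft g (toDistribution (u j)) z) volume := by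
  refine aestronglyMeasurable_of_tendsto_ae atTop
    (f := fun m z => ∑ j ∈ Finset.range m, stft g (toDistribution (u j)) z) (fun m =>
      (continuous_finsetSum _ fun j _ => continuous_stft hg _).aestronglyMeasurable) ?_
  filter_upwards [ae_summable_stft hg hw hu] with z hz
  exact hz.hasSum.tendsto_sum_nat

theorem integral_tsum_stft_add_mul_gaborPairing (hg : g ≠ 0) (hw : IsModerateWeight w C N)
    (hu : ∑' j, ‖u j‖ₑ ≠ ∞) {φ : 𝓢(𝔼, ℂ)}
    (hint : Integrable fun z => (∑' j, stft g (toDistribution (u j)) z) * gaborPairing g φ z)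
    (m : ℕ) :
    ∫ z, (∑' j, stft g (toDistribution (u (j + m))) z) * gaborPairing g φ z
      = (∫ z, (∑' j, stft g (toDistribution (u j)) z) * gaborPairing g φ z)
        - ∑ j ∈ Finset.range m, toDistribution ((gaborConst g : ℂ) • u j) φ := by
  have hintj (j : ℕ) := integrable_stft_mul_gaborPairing hg (toDistribution (u j)) φ
  simp_rw [← integral_stft_mul_gaborPairing_eq_smul hg]
  rw [← integral_finsetSum _ fun j _ => hintj j,
    ← integral_sub hint (integrable_finsetSum _ fun j _ => hintj j)]
  refine integral_congr_ae ?_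
  filter_upwards [ae_summable_stft hg hw hu] with z hz
  rw [← hz.sum_add_tsum_nat_add m, add_mul, Finset.sum_mul, add_sub_cancel_left]

end Series

theorem completeSpace (hg : g ≠ 0) (hw : IsModerateWeight w C N) :
    CompleteSpace (ModulationSpace g w p q) := by
  let _ := normedAddCommGroup (p := p) (q := q) hg hw
  refine NormedAddCommGroup.completeSpace_of_summable_imp_tendsto
    (E := ModulationSpace g w p q) fun u hu => ?_
  have hu' : ∑' j, ‖u j‖ₑ ≠ ∞ := tsum_enorm_ne_top_iff_summable_norm.2 hu
  have hum (m : ℕ) : ∑' j, ‖u (j + m)‖ₑ ≠ ∞ :=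
    ne_top_of_le_ne_top hu' (ENNReal.tsum_comp_le_tsum_of_injective (add_left_injective m) _)
  have hVm (m : ℕ) := mixedENorm_tsum_stft_le (u := fun j => u (j + m)) hg hw
  obtain ⟨D, hD, hsyn⟩ := exists_synthesis (p := p) (q := q) hg hw
  -- `a m` is synthesized from the `m`-th tail of the series of short-time Fourier transforms.
  choose a ha haD using fun m => hsyn _ (aestronglyMeasurable_tsum_stft hg hw (hum m))
    (ne_top_of_le_ne_top (hum m) (hVm m))
  set κ : ℂ := (gaborConst g : ℂ)
  have hκ : κ ≠ 0 := Complex.ofReal_ne_zero.2 (gaborConst_pos hg).ne'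
  have a_eq (m : ℕ) : a m = a 0 - κ • ∑ j ∈ Finset.range m, u j := by
    refine toDistribution_injective ?_
    ext φ
    obtain ⟨e, he⟩ := exists_continuousLinearMap_eq_apply (p := p) (q := q) hg hw φ
    rw [← he (_ - _), map_sub, Finset.smul_sum, map_sum]
    simp_rw [he, (ha _ φ).2]
    exact integral_tsum_stft_add_mul_gaborPairing hg hw hu' (ha 0 φ).1 m
  have ha_lim : Tendsto a atTop (𝓝 0) := by
    have hDlim : Tendsto (fun m => D * ∑' j, ‖u (j + m)‖ₑ) atTop (𝓝 0) := by
      simpa only [mul_zero] using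
        ENNReal.Tendsto.const_mul (ENNReal.tendsto_sum_nat_add _ hu') (Or.inr hD)
    rw [tendsto_zero_iff_enorm_tendsto_zero]
    exact tendsto_of_tendsto_of_tendsto_of_le_of_le tendsto_const_nhds hDlim (fun _ => zero_le)
      fun m => (haD m).trans (by gcongr; exact hVm m)
  have sum_eq (m : ℕ) : ∑ j ∈ Finset.range m, u j = κ⁻¹ • a 0 - κ⁻¹ • a m := by
    rw [a_eq m, smul_sub, inv_smul_smul₀ hκ, sub_sub_cancel]
  refine ⟨κ⁻¹ • a 0, ?_⟩
  simp_rw [sum_eq]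
  simpa only [smul_zero, sub_zero] using (ha_lim.const_smul κ⁻¹).const_sub (κ⁻¹ • a 0)

end ModulationSpace

section ShiftedWindow

variable {w : EuclideanSpace ℝ (Fin n) × EuclideanSpace ℝ (Fin n) → ℝ} {C : ℝ} {N : ℕ}

theorem phaseWeight_sub_pow_inv_le (z z' : 𝔼 × 𝔼) (N : ℕ) :
    (phaseWeight (z - z') ^ N)⁻¹ ≤ phaseWeight z' ^ N * (phaseWeight z ^ N)⁻¹ := by
  have hz := phaseWeight_pos z
  have hzz' := phaseWeight_pos (z - z')
  rw [← div_eq_mul_inv, le_div_iff₀ (by positivity), inv_mul_le_iff₀ (by positivity),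
    ← mul_pow, mul_comm]
  exact pow_le_pow_left₀ hz.le (phaseWeight_le_mul_sub z z') _

theorem IsModerateWeight.exists_enorm_mul_gaborPairing_le_of_phaseWeight_sub_le
    (hw : IsModerateWeight w C N) (g : 𝓢(𝔼, ℂ)) (z : 𝔼 × 𝔼) (b : ℝ) :
    ∃ D : ℝ≥0∞, D ≠ ∞ ∧ ∀ s, phaseWeight (s - z) ≤ b → ∀ z',
      ‖(w z' : ℂ) * gaborPairing g (conjTimeFrequencyShift g z') s‖ₑ
        ≤ D * ENNReal.ofReal (phaseWeight (z' - z) ^ (n + 1))⁻¹ := by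
  obtain ⟨D, hD, hle⟩ := hw.exists_enorm_mul_gaborPairing_le g
  refine ⟨D * ENNReal.ofReal (b ^ (n + 1) * (C * b ^ N * w z)),
    ENNReal.mul_ne_top hD ENNReal.ofReal_ne_top, fun s hs z' => (hle s z').trans ?_⟩
  have hC := hw.const_pos
  have hwz := hw.pos z
  have hws₀ := (hw.pos s).le
  have hsz := phaseWeight_pos (s - z)
  have hzz' := phaseWeight_pos (z' - z)
  have hb : 0 < b := hsz.trans_le hs
  have hws : w s ≤ C * b ^ N * w z := (hw.le_sub s z).trans (by gcongr)
  have hdecay : (phaseWeight (z' - s) ^ (n + 1))⁻¹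
      ≤ b ^ (n + 1) * (phaseWeight (z' - z) ^ (n + 1))⁻¹ := by
    have h := phaseWeight_sub_pow_inv_le (z' - z) (s - z) (n + 1)
    rw [sub_sub_sub_cancel_right] at h
    exact h.trans (by gcongr)
  rw [mul_assoc, mul_assoc, ← ENNReal.ofReal_mul' hws₀,
    ← ENNReal.ofReal_mul (by positivity), mul_right_comm]
  gcongr

theorem mixedLNorm_const_mul_phaseWeight_sub_pow_inv_ne_top {p q : ℝ≥0∞} (hp : 1 ≤ p) (hq : 1 ≤ q)
    {D : ℝ≥0∞} (hD : D ≠ ∞) (z : 𝔼 × 𝔼) :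
    mixedLNorm p q (fun z' => D * ENNReal.ofReal (phaseWeight (z' - z) ^ (n + 1))⁻¹) ≠ ∞ := by
  rw [mixedLNorm_const_mul p q hD,
    mixedLNorm_sub_right p q (fun z' => ENNReal.ofReal (phaseWeight z' ^ (n + 1))⁻¹)]
  exact ENNReal.mul_ne_top hD (mixedLNorm_phaseWeight_pow_inv_ne_top hp hq (Nat.lt_succ_self n))

theorem toTemperedDistributionCLM_timeFrequencyShift_apply (g φ : 𝓢(𝔼, ℂ)) (z : 𝔼 × 𝔼) :
    toTemperedDistributionCLM 𝔼 ℂ volume (timeFrequencyShift g z) φ = gaborPairing g φ z :=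
  toTemperedDistributionCLM_apply_apply volume _ _

theorem stft_timeFrequencyShift (g : 𝓢(𝔼, ℂ)) (z z' : 𝔼 × 𝔼) :
    stft g (toTemperedDistributionCLM 𝔼 ℂ volume (timeFrequencyShift g z)) z'
      = gaborPairing g (conjTimeFrequencyShift g z') z :=
  toTemperedDistributionCLM_timeFrequencyShift_apply g _ z

theorem continuous_gaborPairing_conjTimeFrequencyShift_right (g : 𝓢(𝔼, ℂ)) (z : 𝔼 × 𝔼) :
    Continuous fun z' => gaborPairing g (conjTimeFrequencyShift g z') z :=
  (continuous_gaborPairing_conjTimeFrequencyShift g).comp (f := fun z' => (z, z')) (by fun_prop)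

theorem continuous_stft_timeFrequencyShift (g : 𝓢(𝔼, ℂ)) (z : 𝔼 × 𝔼) :
    Continuous (stft g (toTemperedDistributionCLM 𝔼 ℂ volume (timeFrequencyShift g z))) := by
  simpa only [← stft_timeFrequencyShift g z] using
    continuous_gaborPairing_conjTimeFrequencyShift_right g z

namespace ModulationSpace

variable {g : 𝓢(EuclideanSpace ℝ (Fin n), ℂ)} {p q : ℝ≥0∞}
  [hp : Fact (1 ≤ p)] [hp' : Fact (p ≠ ∞)] [hq : Fact (1 ≤ q)] [hq' : Fact (q ≠ ∞)]

omit hp' hq' in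
theorem modulationENorm_timeFrequencyShift_ne_top (hw : IsModerateWeight w C N) (z : 𝔼 × 𝔼) :
    modulationENorm g w p q (toTemperedDistributionCLM 𝔼 ℂ volume (timeFrequencyShift g z))
      ≠ ∞ := by
  obtain ⟨D, hD, hle⟩ := hw.exists_enorm_mul_gaborPairing_le_of_phaseWeight_sub_le g z
    (phaseWeight (z - z))
  rw [modulationENorm, mixedENorm_eq_mixedLNorm]
  refine ne_top_of_le_ne_top
    (mixedLNorm_const_mul_phaseWeight_sub_pow_inv_ne_top hp.out hq.out hD z)
    (mixedLNorm_mono fun z' => ?_)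
  rw [stft_timeFrequencyShift]
  exact hle z le_rfl z'

variable (g p q) in
/-- The time-frequency shift `y ↦ exp (i y·ξ) g (y - x)` of the window by `z = (x, ξ)`, as an
element of `M_w^{p,q}`. These elements play the role of the evaluation kernels of `M_w^{p,q}`. -/
noncomputable def shiftedWindow (hw : IsModerateWeight w C N) (z : 𝔼 × 𝔼) :
    ModulationSpace g w p q :=
  ⟨toTemperedDistributionCLM 𝔼 ℂ volume (timeFrequencyShift g z),
    hw.aestronglyMeasurable_mul (continuous_stft_timeFrequencyShift g z).aestronglyMeasurable,
    (modulationENorm_timeFrequencyShift_ne_top hw z).lt_top⟩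

theorem toDistribution_shiftedWindow (hw : IsModerateWeight w C N) (z : 𝔼 × 𝔼) :
    toDistribution (shiftedWindow g p q hw z)
      = toTemperedDistributionCLM 𝔼 ℂ volume (timeFrequencyShift g z) :=
  rfl

theorem toDistribution_shiftedWindow_apply (hw : IsModerateWeight w C N) (z : 𝔼 × 𝔼)
    (φ : 𝓢(𝔼, ℂ)) : toDistribution (shiftedWindow g p q hw z) φ = gaborPairing g φ z :=
  toTemperedDistributionCLM_timeFrequencyShift_apply g φ z

theorem enorm_shiftedWindow_sub (hw : IsModerateWeight w C N) (s z : 𝔼 × 𝔼) :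
    ‖shiftedWindow g p q hw s - shiftedWindow g p q hw z‖ₑ = mixedLNorm p q (fun z' => ‖(w z' : ℂ) *
      (gaborPairing g (conjTimeFrequencyShift g z') s
        - gaborPairing g (conjTimeFrequencyShift g z') z)‖ₑ) := by
  simp_rw [enorm_eq, modulationENorm, mixedENorm_eq_mixedLNorm, map_sub,
    ← toTemperedDistributionCLM_timeFrequencyShift_apply]
  rfl

theorem continuous_shiftedWindow (hw : IsModerateWeight w C N) :
    Continuous (shiftedWindow g p q hw) := by
  refine continuous_iff_seqContinuous.2 fun s z hs => ?_
  have hsz : Tendsto (fun j => phaseWeight (s j - z)) atTop (𝓝 (phaseWeight (z - z))) :=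
    (continuous_phaseWeight.tendsto _).comp (hs.sub_const z)
  obtain ⟨b, hb⟩ := hsz.bddAbove_range
  have hz : phaseWeight (z - z) ≤ b := le_of_tendsto' hsz fun j => hb ⟨j, rfl⟩
  obtain ⟨D, hD, hle⟩ := hw.exists_enorm_mul_gaborPairing_le_of_phaseWeight_sub_le g z b
  have hcont := continuous_gaborPairing_conjTimeFrequencyShift_right g
  rw [tendsto_iff_enorm_sub_tendsto_zero]
  simp only [Function.comp_apply, enorm_shiftedWindow_sub]
  refine tendsto_mixedLNorm_zero_of_dominated hp'.out (zero_lt_one.trans_le hq.out).ne' hq'.out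
    (fun j => (hw.aestronglyMeasurable_mul
      ((hcont _).sub (hcont _)).aestronglyMeasurable).enorm) ?_
    (mixedLNorm_const_mul_phaseWeight_sub_pow_inv_ne_top hp.out hq.out
      (ENNReal.add_ne_top.2 ⟨hD, hD⟩) z)
    (fun j => ae_of_all _ fun z' => ?_) (ae_of_all _ fun z' => ?_)
  · exact (((measurable_phaseWeight_pow_inv _).comp
      (measurable_id.sub_const z)).const_mul _).aemeasurable
  · beta_reduce
    rw [mul_sub, add_mul]
    exact enorm_sub_le.trans (add_le_add (hle _ (hb ⟨j, rfl⟩) z') (hle z hz z'))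
  · have hlim : Tendsto (fun j => (w z' : ℂ) * (gaborPairing g (conjTimeFrequencyShift g z') (s j)
        - gaborPairing g (conjTimeFrequencyShift g z') z)) atTop (𝓝 0) := by
      rw [← mul_zero (w z' : ℂ),
        ← sub_self (gaborPairing g (conjTimeFrequencyShift g z') z)]
      exact ((((continuous_gaborPairing g _).tendsto z).comp hs).sub_const _).const_mul _
    simpa only [enorm_zero] using hlim.enorm

end ModulationSpace

end ShiftedWindow

/-! ### The trace of a nuclear operator -/

section FunctionalRepresentation

theorem apply_eq_integral_of_injective {𝕜 X B ι : Type*} [RCLike 𝕜] [MeasurableSpace X]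
    {μ : Measure X} [NormedAddCommGroup B] [NormedSpace 𝕜 B] [NormedSpace ℝ B] [CompleteSpace B]
    {π : X → B} {F : X → 𝕜} (hint : Integrable (fun x => F x • π x) μ) {e : ι → B →L[𝕜] 𝕜}
    (he : Function.Injective fun x i => e i x) {b : B} (hb : ∀ i, e i b = ∫ x, F x * e i (π x) ∂μ)
    (ψ : B →L[𝕜] 𝕜) : ψ b = ∫ x, F x * ψ (π x) ∂μ := by
  have hcomm : ∀ ψ : B →L[𝕜] 𝕜, ∫ x, F x * ψ (π x) ∂μ = ψ (∫ x, F x • π x ∂μ) := fun ψ => by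
    simp only [← ψ.integral_comp_comm hint, map_smul, smul_eq_mul]
  rw [hcomm, he (funext fun i => (hb i).trans (hcomm (e i)))]

theorem dense_of_forall_dual_eq_zero {𝕜 E : Type*} [RCLike 𝕜] [SeminormedAddCommGroup E]
    [NormedSpace 𝕜 E] (S : Submodule 𝕜 E)
    (h : ∀ ψ : E →L[𝕜] 𝕜, (∀ x ∈ S, ψ x = 0) → ψ = 0) : Dense (S : Set E) := by
  let _ : NormedSpace ℝ E := .restrictScalars ℝ 𝕜 E
  have : IsScalarTower ℝ 𝕜 E := RestrictScalars.isScalarTower ℝ 𝕜 E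
  intro x
  by_contra hx
  obtain ⟨f, u, hf, hu⟩ := RCLike.geometric_hahn_banach_closed_point (𝕜 := 𝕜)
    (S.topologicalClosure.restrictScalars ℝ).convex S.isClosed_topologicalClosure hx
  have hu₀ : 0 < u := by simpa using hf 0 (Submodule.zero_mem _)
  have hf₀ : f = 0 := h f fun a ha => by
    by_contra hfa
    have hlt := hf (((u : 𝕜) / f a) • a) (S.le_topologicalClosure (S.smul_mem _ ha))
    rw [map_smul, smul_eq_mul, div_mul_cancel₀ _ hfa, RCLike.ofReal_re] at hlt
    exact lt_irrefl _ hlt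
  rw [hf₀] at hu
  exact lt_asymm hu₀ (by simpa using hu)

theorem tendsto_mixedENorm_indicator_compl {p q : ℝ≥0∞} (hp : p ≠ ∞) (hq₀ : q ≠ 0) (hq : q ≠ ∞)
    {K : ℕ → Set (𝔼 × 𝔼)} (hK : AECover volume atTop K) {F : 𝔼 × 𝔼 → ℂ}
    (hF : AEStronglyMeasurable F volume) (hFpq : mixedENorm p q F ≠ ∞) :
    Tendsto (fun m => mixedENorm p q ((K m)ᶜ.indicator F)) atTop (𝓝 0) := by
  simp_rw [mixedENorm_eq_mixedLNorm] at hFpq ⊢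
  refine tendsto_mixedLNorm_zero_of_dominated hp hq₀ hq
    (fun m => (hF.indicator (hK.measurableSet m).compl).enorm) hF.enorm hFpq
    (fun m => ae_of_all _ fun z => enorm_indicator_le_enorm_self F z) ?_
  filter_upwards [hK.ae_eventually_mem] with z hz
  refine tendsto_const_nhds.congr' (hz.mono fun m hm => ?_)
  simp only [Set.indicator_of_notMem (Set.notMem_compl_iff.2 hm), enorm_zero]

namespace ModulationSpace

variable {w : EuclideanSpace ℝ (Fin n) × EuclideanSpace ℝ (Fin n) → ℝ} {C : ℝ} {N : ℕ}
  {g : 𝓢(EuclideanSpace ℝ (Fin n), ℂ)} {p q : ℝ≥0∞}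
  [hp : Fact (1 ≤ p)] [hp' : Fact (p ≠ ∞)] [hq : Fact (1 ≤ q)] [hq' : Fact (q ≠ ∞)]

theorem apply_eq_integral (hg : g ≠ 0) (hw : IsModerateWeight w C N) {μ : Measure (𝔼 × 𝔼)}
    {F : 𝔼 × 𝔼 → ℂ} (hF : Integrable (fun z => F z • shiftedWindow g p q hw z) μ)
    {b : ModulationSpace g w p q}
    (hb : ∀ φ, toDistribution b φ = ∫ z, F z * gaborPairing g φ z ∂μ)
    (ψ : ModulationSpace g w p q →L[ℂ] ℂ) :
    ψ b = ∫ z, F z * ψ (shiftedWindow g p q hw z) ∂μ := by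
  let _ := normedAddCommGroup (p := p) (q := q) hg hw
  have := completeSpace (p := p) (q := q) hg hw
  choose e he using exists_continuousLinearMap_eq_apply (p := p) (q := q) hg hw
  refine apply_eq_integral_of_injective (e := e) hF (fun a a' h => ?_) (fun φ => ?_) ψ
  · exact toDistribution_injective (ContinuousLinearMap.ext fun φ =>
      (he φ a).symm.trans ((congrFun h φ).trans (he φ a')))
  · simp_rw [he, toDistribution_shiftedWindow_apply, hb]

theorem apply_eq_setIntegral (hg : g ≠ 0) (hw : IsModerateWeight w C N) {K : Set (𝔼 × 𝔼)}
    (hK : IsCompact K) {F : 𝔼 × 𝔼 → ℂ} (hF : AEStronglyMeasurable F volume)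
    {a b : ModulationSpace g w p q} (hFa : ∀ z, ‖F z‖ ≤ ‖stft g (toDistribution a) z‖)
    (hb : ∀ φ, toDistribution b φ = ∫ z in K, F z * gaborPairing g φ z)
    (ψ : ModulationSpace g w p q →L[ℂ] ℂ) :
    ψ b = ∫ z in K, F z * ψ (shiftedWindow g p q hw z) := by
  let _ := normedAddCommGroup (p := p) (q := q) hg hw
  have hπ := continuous_shiftedWindow (g := g) (p := p) (q := q) hw
  have hint : IntegrableOn
      (fun z => stft g (toDistribution a) z • shiftedWindow g p q hw z) K :=
    ((continuous_stft hg _).smul hπ).continuousOn.integrableOn_compact hK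
  refine apply_eq_integral hg hw (Integrable.mono hint
    (hF.restrict.smul hπ.aestronglyMeasurable) (ae_of_all _ fun z => ?_)) hb ψ
  simp only [Pi.smul_apply', norm_smul]
  gcongr
  exact hFa z

theorem mixedENorm_mul_le_enorm {a : ModulationSpace g w p q} {F : 𝔼 × 𝔼 → ℂ}
    (hFa : ∀ z, ‖F z‖ ≤ ‖stft g (toDistribution a) z‖) :
    mixedENorm p q (fun z => (w z : ℂ) * F z) ≤ ‖a‖ₑ := by
  rw [enorm_eq, modulationENorm, mixedENorm_eq_mixedLNorm, mixedENorm_eq_mixedLNorm]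
  refine mixedLNorm_mono fun z => ?_
  rw [enorm_mul, enorm_mul]
  gcongr
  exact enorm_le_iff_norm_le.2 (hFa z)

theorem exists_setLIntegral_stft_mul_shiftedWindow_le (hg : g ≠ 0) (hw : IsModerateWeight w C N) :
    ∃ D : ℝ≥0∞, D ≠ ∞ ∧ ∀ (ψ : ModulationSpace g w p q →L[ℂ] ℂ) (a : ModulationSpace g w p q)
      (K : Set (𝔼 × 𝔼)), IsCompact K →
        ∫⁻ z in K, ‖stft g (toDistribution a) z * ψ (shiftedWindow g p q hw z)‖ₑ
          ≤ D * (‖ψ‖ₑ * ‖a‖ₑ) := by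
  obtain ⟨D, hD, hsyn⟩ := exists_synthesis (p := p) (q := q) hg hw
  refine ⟨D, hD, fun ψ a K hK => ?_⟩
  set G : 𝔼 × 𝔼 → ℂ := fun z => stft g (toDistribution a) z * ψ (shiftedWindow g p q hw z)
  have hVc : Continuous (stft g (toDistribution a)) := continuous_stft hg _
  have hGc : Continuous G := hVc.mul (ψ.continuous.comp (continuous_shiftedWindow hw))
  -- `F z * ψ (shiftedWindow z) = ‖G z‖`, so synthesizing `F` over `K` turns `ψ` into `∫ ‖G‖`
  set F : 𝔼 × 𝔼 → ℂ := fun z =>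
    stft g (toDistribution a) z * ((starRingEnd ℂ) (G z) / (‖G z‖ : ℂ)) with hF
  have hFm : Measurable F := hVc.measurable.mul <|
    (Complex.continuous_conj.comp hGc).measurable.div
      (Complex.continuous_ofReal.comp hGc.norm).measurable
  have hFa : ∀ z, ‖F z‖ ≤ ‖stft g (toDistribution a) z‖ := fun z => by
    rw [hF, norm_mul, norm_div, RCLike.norm_conj, Complex.norm_real, norm_norm]
    exact mul_le_of_le_one_right (norm_nonneg _) (div_self_le_one _)
  have hFψ : ∀ z, F z * ψ (shiftedWindow g p q hw z) = (‖G z‖ : ℂ) := fun z => by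
    rw [hF, mul_right_comm, ← mul_div_assoc, Complex.mul_conj', sq, mul_self_div_self]
  have hFK : mixedENorm p q (fun z => (w z : ℂ) * K.indicator F z) ≤ ‖a‖ₑ :=
    mixedENorm_mul_le_enorm fun z => (norm_indicator_le_norm_self F z).trans (hFa z)
  obtain ⟨b, hb, hbD⟩ := hsyn (K.indicator F)
    (hFm.indicator hK.measurableSet).aestronglyMeasurable (ne_top_of_le_ne_top enorm_ne_top hFK)
  have hψb : ψ b = ((∫ z in K, ‖G z‖ : ℝ) : ℂ) := by
    rw [apply_eq_setIntegral hg hw hK hFm.aestronglyMeasurable hFa (fun φ => ?_) ψ]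
    · simp_rw [hFψ, integral_complex_ofReal]
    · rw [(hb φ).2, ← integral_indicator hK.measurableSet]
      simp_rw [Set.indicator_mul_left]
  calc ∫⁻ z in K, ‖G z‖ₑ
      = ‖ψ b‖ₑ := by
        rw [hψb, ← ofReal_norm, Complex.norm_real,
          Real.norm_of_nonneg (integral_nonneg fun _ => norm_nonneg _),
          ofReal_integral_norm_eq_lintegral_enorm (hGc.continuousOn.integrableOn_compact hK)]
    _ ≤ ‖ψ‖ₑ * (D * ‖a‖ₑ) := (ψ.le_opENorm b).trans (by gcongr; exact hbD.trans (by gcongr))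
    _ = D * (‖ψ‖ₑ * ‖a‖ₑ) := mul_left_comm _ _ _

theorem exists_lintegral_stft_mul_shiftedWindow_le (hg : g ≠ 0) (hw : IsModerateWeight w C N) :
    ∃ D : ℝ≥0∞, D ≠ ∞ ∧ ∀ (ψ : ModulationSpace g w p q →L[ℂ] ℂ) (a : ModulationSpace g w p q),
      ∫⁻ z, ‖stft g (toDistribution a) z * ψ (shiftedWindow g p q hw z)‖ₑ
        ≤ D * (‖ψ‖ₑ * ‖a‖ₑ) := by
  obtain ⟨D, hD, hle⟩ := exists_setLIntegral_stft_mul_shiftedWindow_le (p := p) (q := q) hg hw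
  refine ⟨D, hD, fun ψ a => ?_⟩
  have hG : Continuous fun z => stft g (toDistribution a) z * ψ (shiftedWindow g p q hw z) :=
    (continuous_stft hg _).mul (ψ.continuous.comp (continuous_shiftedWindow hw))
  exact le_of_tendsto' ((aecover_closedBall (x := 0)
    tendsto_natCast_atTop_atTop).lintegral_tendsto_of_countably_generated
      hG.measurable.enorm.aemeasurable) fun m => hle ψ a _ (isCompact_closedBall 0 (m : ℝ))

theorem integrable_stft_mul_shiftedWindow (hg : g ≠ 0) (hw : IsModerateWeight w C N)
    (ψ : ModulationSpace g w p q →L[ℂ] ℂ) (a : ModulationSpace g w p q) :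
    Integrable fun z => stft g (toDistribution a) z * ψ (shiftedWindow g p q hw z) := by
  obtain ⟨D, hD, hle⟩ := exists_lintegral_stft_mul_shiftedWindow_le (p := p) (q := q) hg hw
  exact ⟨((continuous_stft hg _).mul
      (ψ.continuous.comp (continuous_shiftedWindow hw))).aestronglyMeasurable,
    (hle ψ a).trans_lt
      (ENNReal.mul_lt_top hD.lt_top (ENNReal.mul_lt_top enorm_lt_top enorm_lt_top))⟩

theorem exists_tendsto_gaborConst_smul (hg : g ≠ 0) (hw : IsModerateWeight w C N)
    (a : ModulationSpace g w p q) :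
    ∃ b : ℕ → ModulationSpace g w p q, Tendsto b atTop (𝓝 ((gaborConst g : ℂ) • a)) ∧
      ∀ m φ, toDistribution (b m) φ
        = ∫ z in Metric.closedBall 0 m, stft g (toDistribution a) z * gaborPairing g φ z := by
  obtain ⟨D, hD, hsyn⟩ := exists_synthesis (p := p) (q := q) hg hw
  set V := stft g (toDistribution a)
  have hVm : AEStronglyMeasurable V volume := (continuous_stft hg _).aestronglyMeasurable
  set K : ℕ → Set (𝔼 × 𝔼) := fun m => Metric.closedBall 0 m
  have hK : AECover volume atTop K := aecover_closedBall tendsto_natCast_atTop_atTop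
  have hKV (m : ℕ) : mixedENorm p q (fun z => (w z : ℂ) * (K m)ᶜ.indicator V z) ≤ ‖a‖ₑ :=
    mixedENorm_mul_le_enorm fun z => norm_indicator_le_norm_self V z
  choose c hc hcD using fun m => hsyn ((K m)ᶜ.indicator V)
    (hVm.indicator (hK.measurableSet m).compl) (ne_top_of_le_ne_top enorm_ne_top (hKV m))
  have hV : mixedENorm p q (fun z => (w z : ℂ) * V z) ≠ ∞ :=
    ne_top_of_le_ne_top enorm_ne_top (mixedENorm_mul_le_enorm fun z => le_rfl)
  have htail : Tendsto (fun m => mixedENorm p q fun z => (w z : ℂ) * (K m)ᶜ.indicator V z) atTop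
      (𝓝 0) :=
    (tendsto_mixedENorm_indicator_compl hp'.out (zero_lt_one.trans_le hq.out).ne' hq'.out hK
      (hw.aestronglyMeasurable_mul hVm) hV).congr fun m =>
        congrArg _ (funext fun z => Set.indicator_mul_right (K m)ᶜ (fun z => (w z : ℂ)) V)
  have hc₀ : Tendsto c atTop (𝓝 0) := by
    have hD₀ := ENNReal.Tendsto.const_mul htail (Or.inr hD)
    rw [mul_zero] at hD₀
    simp_rw [tendsto_iff_enorm_sub_tendsto_zero, sub_zero]
    exact tendsto_of_tendsto_of_tendsto_of_le_of_le tendsto_const_nhds hD₀ (fun _ => zero_le) hcD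
  refine ⟨fun m => (gaborConst g : ℂ) • a - c m, by simpa only [sub_zero] using hc₀.const_sub _,
    fun m φ => ?_⟩
  have hint := integrable_stft_mul_gaborPairing hg (toDistribution a) φ
  rw [map_sub, sub_apply, ← integral_stft_mul_gaborPairing_eq_smul hg, (hc m φ).2]
  simp_rw [← Set.indicator_mul_left]
  rw [integral_indicator (hK.measurableSet m).compl, sub_eq_iff_eq_add,
    integral_add_compl (hK.measurableSet m) hint]

theorem integral_stft_mul_shiftedWindow (hg : g ≠ 0) (hw : IsModerateWeight w C N)
    (ψ : ModulationSpace g w p q →L[ℂ] ℂ) (a : ModulationSpace g w p q) :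
    ∫ z, stft g (toDistribution a) z * ψ (shiftedWindow g p q hw z) = gaborConst g * ψ a := by
  obtain ⟨b, hlim, hb⟩ := exists_tendsto_gaborConst_smul (p := p) (q := q) hg hw a
  have hψ (m : ℕ) : ψ (b m) = ∫ z in Metric.closedBall 0 m,
      stft g (toDistribution a) z * ψ (shiftedWindow g p q hw z) :=
    apply_eq_setIntegral hg hw (isCompact_closedBall _ _)
      (continuous_stft hg _).aestronglyMeasurable (fun _ => le_rfl) (hb m) ψ
  have hψlim : Tendsto (fun m => ψ (b m)) atTop (𝓝 (ψ ((gaborConst g : ℂ) • a))) :=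
    (ψ.continuous.tendsto _).comp hlim
  simp_rw [hψ, map_smul] at hψlim
  exact tendsto_nhds_unique ((aecover_closedBall
    tendsto_natCast_atTop_atTop).integral_tendsto_of_countably_generated
      (integrable_stft_mul_shiftedWindow hg hw ψ a)) hψlim

theorem toDistribution_shiftedWindow_eq_toLp (hw : IsModerateWeight w C N) (z : 𝔼 × 𝔼) :
    toDistribution (shiftedWindow g p q hw z)
      = Lp.toTemperedDistribution ((timeFrequencyShift g z).toLp 2 volume) := by
  rw [Lp.toTemperedDistribution_toLp_eq, toDistribution_shiftedWindow]

theorem dense_lp_two (hg : g ≠ 0) (hw : IsModerateWeight w C N) :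
    Dense {a : ModulationSpace g w p q | ∃ f : Lp ℂ 2 (volume : Measure 𝔼),
      toDistribution a = Lp.toTemperedDistribution f} := by
  let S : Submodule ℂ (ModulationSpace g w p q) :=
    (LinearMap.range (Lp.toTemperedDistributionCLM (E := 𝔼) ℂ volume 2).toLinearMap).comap
      toDistribution
  have hS : {a : ModulationSpace g w p q | ∃ f : Lp ℂ 2 (volume : Measure 𝔼),
      toDistribution a = Lp.toTemperedDistribution f} = S :=
    Set.ext fun a => exists_congr fun f => eq_comm
  have hπS (z : 𝔼 × 𝔼) : shiftedWindow g p q hw z ∈ S :=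
    hS.le ⟨_, toDistribution_shiftedWindow_eq_toLp hw z⟩
  rw [hS]
  refine dense_of_forall_dual_eq_zero S fun ψ hψ => ContinuousLinearMap.ext fun a => ?_
  have h := integral_stft_mul_shiftedWindow hg hw ψ a
  simp_rw [hψ _ (hπS _), mul_zero, integral_zero] at h
  exact (mul_eq_zero.1 h.symm).resolve_left (Complex.ofReal_ne_zero.2 (gaborConst_pos hg).ne')

theorem summable_integral_norm_stft_mul_shiftedWindow (hg : g ≠ 0) (hw : IsModerateWeight w C N)
    {ψ : ℕ → ModulationSpace g w p q →L[ℂ] ℂ} {φ : ℕ → ModulationSpace g w p q}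
    (h : Summable fun j => ‖ψ j‖ * ‖φ j‖) :
    Summable fun j => ∫ z, ‖stft g (toDistribution (φ j)) z * ψ j (shiftedWindow g p q hw z)‖ := by
  obtain ⟨D, hD, hle⟩ := exists_lintegral_stft_mul_shiftedWindow_le (p := p) (q := q) hg hw
  refine Summable.of_nonneg_of_le (fun j => integral_nonneg fun _ => norm_nonneg _) (fun j => ?_)
    (h.mul_left D.toReal)
  have hj := ENNReal.toReal_mono (ENNReal.mul_ne_top hD (ENNReal.mul_ne_top enorm_ne_top
    enorm_ne_top)) (hle (ψ j) (φ j))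
  rwa [ENNReal.toReal_mul, ENNReal.toReal_mul, toReal_enorm, toReal_enorm,
    ← integral_norm_eq_lintegral_enorm
      (integrable_stft_mul_shiftedWindow hg hw (ψ j) (φ j)).aestronglyMeasurable] at hj

theorem hasSum_stft_mul_of_isNuclearRepresentation {r : ℝ} (hg : g ≠ 0)
    (hw : IsModerateWeight w C N) {T : ModulationSpace g w p q →L[ℂ] ModulationSpace g w p q}
    {φ : ℕ → ModulationSpace g w p q} {ψ : ℕ → ModulationSpace g w p q →L[ℂ] ℂ}
    (h : IsNuclearRepresentation r T φ ψ) (a : ModulationSpace g w p q) (z : 𝔼 × 𝔼) :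
    HasSum (fun j => stft g (toDistribution (φ j)) z * ψ j a)
      (stft g (toDistribution (T a)) z) := by
  obtain ⟨e, he⟩ := exists_continuousLinearMap_eq_apply (p := p) (q := q) hg hw
    (conjTimeFrequencyShift g z)
  convert (h.hasSum a).mapL e using 1
  · exact funext fun j => by rw [map_smul, smul_eq_mul, mul_comm, he, stft]
  · rw [he, stft]

-- The right-hand side of `κ ψ a = ∫ V_g a ψ(g_z) dz`, summed over a representation, only sees `T`.
theorem exists_forall_hasSum_trace (hg : g ≠ 0) (hw : IsModerateWeight w C N)
    (T : ModulationSpace g w p q →L[ℂ] ModulationSpace g w p q) :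
    ∃ t : ℂ, ∀ (φ : ℕ → ModulationSpace g w p q) (ψ : ℕ → ModulationSpace g w p q →L[ℂ] ℂ),
      IsNuclearRepresentation 1 T φ ψ → HasSum (fun j => ψ j (φ j)) t := by
  have hκ : (gaborConst g : ℂ) ≠ 0 := Complex.ofReal_ne_zero.2 (gaborConst_pos hg).ne'
  refine ⟨(gaborConst g : ℂ)⁻¹ * ∫ z, stft g (toDistribution (T (shiftedWindow g p q hw z))) z,
    fun φ ψ h => ?_⟩
  have hsum : Summable fun j => ‖ψ j‖ * ‖φ j‖ := by simpa only [Real.rpow_one] using h.summable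
  have htrace := (hasSum_integral_of_summable_integral_norm
    (fun j => integrable_stft_mul_shiftedWindow hg hw (ψ j) (φ j))
    (summable_integral_norm_stft_mul_shiftedWindow hg hw hsum)).mul_left (gaborConst g : ℂ)⁻¹
  simpa only [(hasSum_stft_mul_of_isNuclearRepresentation hg hw h _ _).tsum_eq,
    integral_stft_mul_shiftedWindow hg hw, inv_mul_cancel_left₀ hκ] using htrace

end ModulationSpace

end FunctionalRepresentation

/-! ### Spectral multipliers on modulation spaces -/

section Orthogonality

theorem exists_continuousLinearMap_eq_lp_apply (φ : 𝓢(𝔼, ℂ)) :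
    ∃ e : Lp ℂ 2 (volume : Measure 𝔼) →L[ℂ] ℂ, ∀ f, e f = Lp.toTemperedDistribution f φ :=
  ⟨(PointwiseConvergenceCLM.evalCLM (RingHom.id ℂ) ℂ φ).comp
    (Lp.toTemperedDistributionCLM ℂ volume 2), fun _ => rfl⟩

theorem stft_toLp (g χ : 𝓢(𝔼, ℂ)) (z : 𝔼 × 𝔼) :
    stft g (Lp.toTemperedDistribution (χ.toLp 2)) z
      = (starRingEnd ℂ) (gaborPairing g (conjSchwartz χ) z) := by
  rw [stft, Lp.toTemperedDistribution_apply, gaborPairing, ← integral_conj]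
  refine integral_congr_ae ?_
  filter_upwards [χ.coeFn_toLp 2 volume] with y hy
  rw [hy, smul_eq_mul, map_mul, timeFrequencyShift, conjSchwartz_apply, conjSchwartz_apply,
    Complex.conj_conj, Complex.conj_conj, mul_comm]

theorem integral_stft_mul_conj_stft_toLp {g : 𝓢(𝔼, ℂ)} (hg : g ≠ 0)
    (f : Lp ℂ 2 (volume : Measure 𝔼)) (χ : 𝓢(𝔼, ℂ)) :
    ∫ z, stft g (Lp.toTemperedDistribution f) z *
        (starRingEnd ℂ) (stft g (Lp.toTemperedDistribution (χ.toLp 2)) z)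
      = gaborConst g * ⟪χ.toLp 2, f⟫_ℂ := by
  simp_rw [stft_toLp, Complex.conj_conj]
  rw [integral_stft_mul_gaborPairing hg, Lp.toTemperedDistribution_apply, L2.inner_def]
  congr 1
  refine integral_congr_ae ?_
  filter_upwards [χ.coeFn_toLp 2 volume] with y hy
  rw [hy, RCLike.inner_apply, smul_eq_mul, mul_comm, conjSchwartz_apply]

theorem memLp_stft_toLp (g χ : 𝓢(𝔼, ℂ)) :
    MemLp (stft g (Lp.toTemperedDistribution (χ.toLp 2))) 2 := by
  have h := memLp_two_phaseWeight_pow_mul_gaborPairing g (conjSchwartz χ) 0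
  simp only [pow_zero, Complex.ofReal_one, one_mul] at h
  rw [funext (stft_toLp g χ)]
  exact h.star

theorem eLpNorm_stft_toLp {g : 𝓢(𝔼, ℂ)} (hg : g ≠ 0) (χ : 𝓢(𝔼, ℂ)) :
    eLpNorm (stft g (Lp.toTemperedDistribution (χ.toLp 2))) 2
      = ENNReal.ofReal √(gaborConst g) * ‖χ.toLp 2 volume‖ₑ := by
  set V := stft g (Lp.toTemperedDistribution (χ.toLp 2))
  have hV : MemLp V 2 := memLp_stft_toLp g χ
  have hinner : ⟪hV.toLp V, hV.toLp V⟫_ℂ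
      = gaborConst g * ⟪χ.toLp 2 volume, χ.toLp 2 volume⟫_ℂ := by
    rw [← integral_stft_mul_conj_stft_toLp hg, L2.inner_def]
    refine integral_congr_ae ?_
    filter_upwards [hV.coeFn_toLp] with z hz
    rw [hz, RCLike.inner_apply]
  have hsq : ‖hV.toLp V‖ ^ 2 = gaborConst g * ‖χ.toLp 2 volume‖ ^ 2 := by
    rw [inner_self_eq_norm_sq_to_K, inner_self_eq_norm_sq_to_K] at hinner
    refine Complex.ofReal_injective ?_
    push_cast
    exact hinner
  rw [← Lp.enorm_toLp (hf := hV), ← ofReal_norm, ← Real.sqrt_sq (norm_nonneg (hV.toLp V)), hsq,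
    Real.sqrt_mul (gaborConst_pos hg).le, Real.sqrt_sq (norm_nonneg _),
    ENNReal.ofReal_mul (Real.sqrt_nonneg _), ofReal_norm]

theorem continuous_stft_lp_apply (g : 𝓢(𝔼, ℂ)) (z : 𝔼 × 𝔼) :
    Continuous fun f : Lp ℂ 2 (volume : Measure 𝔼) => stft g (Lp.toTemperedDistribution f) z := by
  obtain ⟨e, he⟩ := exists_continuousLinearMap_eq_lp_apply (conjTimeFrequencyShift g z)
  exact e.continuous.congr he

theorem eLpNorm_stft_le {g : 𝓢(𝔼, ℂ)} (hg : g ≠ 0) (f : Lp ℂ 2 (volume : Measure 𝔼)) :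
    eLpNorm (stft g (Lp.toTemperedDistribution f)) 2
      ≤ ENNReal.ofReal √(gaborConst g) * ‖f‖ₑ := by
  obtain ⟨s, hs, hsf⟩ := mem_closure_iff_seq_limit.1
    (SchwartzMap.denseRange_toLpCLM (F := ℂ) (μ := (volume : Measure 𝔼)) ENNReal.ofNat_ne_top f)
  have hbound (m : ℕ) : eLpNorm (stft g (Lp.toTemperedDistribution (s m))) 2
      = ENNReal.ofReal √(gaborConst g) * ‖s m‖ₑ := by
    obtain ⟨χ, hχ⟩ := hs m
    rw [← hχ]
    exact eLpNorm_stft_toLp hg χ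
  have hlim : Tendsto (fun m => ENNReal.ofReal √(gaborConst g) * ‖s m‖ₑ) atTop
      (𝓝 (ENNReal.ofReal √(gaborConst g) * ‖f‖ₑ)) :=
    ENNReal.Tendsto.const_mul hsf.enorm (Or.inr ENNReal.ofReal_ne_top)
  refine (Lp.eLpNorm_lim_le_liminf_eLpNorm
    (f := fun m => stft g (Lp.toTemperedDistribution (s m)))
    (fun _ => (continuous_stft hg _).aestronglyMeasurable) _ (ae_of_all _ fun z =>
      ((continuous_stft_lp_apply g z).tendsto f).comp hsf)).trans_eq ?_
  rw [funext hbound, hlim.liminf_eq]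

theorem memLp_stft {g : 𝓢(𝔼, ℂ)} (hg : g ≠ 0) (f : Lp ℂ 2 (volume : Measure 𝔼)) :
    MemLp (stft g (Lp.toTemperedDistribution f)) 2 :=
  ⟨(continuous_stft hg _).aestronglyMeasurable, (eLpNorm_stft_le hg f).trans_lt
    (ENNReal.mul_lt_top ENNReal.ofReal_lt_top enorm_lt_top)⟩

theorem inner_toLp_stft {g : 𝓢(𝔼, ℂ)} (hg : g ≠ 0) (f h : Lp ℂ 2 (volume : Measure 𝔼)) :
    ⟪(memLp_stft hg h).toLp _, (memLp_stft hg f).toLp _⟫_ℂ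
      = ∫ z, stft g (Lp.toTemperedDistribution f) z *
          (starRingEnd ℂ) (stft g (Lp.toTemperedDistribution h) z) := by
  rw [L2.inner_def]
  refine integral_congr_ae ?_
  filter_upwards [(memLp_stft hg f).coeFn_toLp, (memLp_stft hg h).coeFn_toLp] with z hf hh
  rw [hf, hh, RCLike.inner_apply]

theorem continuous_toLp_stft {g : 𝓢(𝔼, ℂ)} (hg : g ≠ 0) :
    Continuous fun f : Lp ℂ 2 (volume : Measure 𝔼) => (memLp_stft hg f).toLp _ := by
  choose e he using exists_continuousLinearMap_eq_lp_apply (n := n)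
  let L : Lp ℂ 2 (volume : Measure 𝔼) →ₗ[ℂ] Lp ℂ 2 (volume : Measure (𝔼 × 𝔼)) :=
    { toFun f := (memLp_stft hg f).toLp _
      map_add' f h := by
        rw [← MemLp.toLp_add]
        congr 1
        ext z
        simp only [Pi.add_apply, stft, ← he, map_add]
      map_smul' c f := by
        rw [RingHom.id_apply, ← MemLp.toLp_const_smul]
        congr 1
        ext z
        simp only [Pi.smul_apply, stft, ← he, map_smul] }
  obtain ⟨T, hT, -⟩ := exists_continuousLinearMap_of_enorm_le L
    (ENNReal.ofReal_ne_top (r := √(gaborConst g))) fun f =>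
      (Lp.enorm_toLp (hf := memLp_stft hg f)).trans_le (eLpNorm_stft_le hg f)
  exact T.continuous.congr hT

theorem integral_stft_mul_conj_stft {g : 𝓢(𝔼, ℂ)} (hg : g ≠ 0)
    (f h : Lp ℂ 2 (volume : Measure 𝔼)) :
    ∫ z, stft g (Lp.toTemperedDistribution f) z *
        (starRingEnd ℂ) (stft g (Lp.toTemperedDistribution h) z) = gaborConst g * ⟪h, f⟫_ℂ := by
  rw [← inner_toLp_stft hg]
  refine congrFun ((SchwartzMap.denseRange_toLpCLM (F := ℂ) (p := 2) (μ := (volume : Measure 𝔼))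
    ENNReal.ofNat_ne_top).equalizer ((continuous_toLp_stft hg).inner continuous_const)
      (continuous_const.mul (continuous_id.inner continuous_const)) (funext fun χ => ?_)) h
  exact (inner_toLp_stft hg f _).trans (integral_stft_mul_conj_stft_toLp hg f χ)

end Orthogonality

section Duality

variable {w : EuclideanSpace ℝ (Fin n) × EuclideanSpace ℝ (Fin n) → ℝ} {C : ℝ} {N : ℕ}
  {g : 𝓢(EuclideanSpace ℝ (Fin n), ℂ)}

theorem lintegral_stft_mul_conj_stft_le (hg : g ≠ 0) (hw : IsModerateWeight w C N)
    (p p' q q' : ℝ≥0∞) [p.HolderConjugate p'] [q.HolderConjugate q'] (f h : 𝓢'(𝔼, ℂ)) :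
    ∫⁻ z, ‖stft g f z * (starRingEnd ℂ) (stft g h z)‖ₑ
      ≤ modulationENorm g w p q f * modulationENorm g (fun z => (w z)⁻¹) p' q' h := by
  rw [modulationENorm, modulationENorm, mixedENorm_eq_mixedLNorm, mixedENorm_eq_mixedLNorm]
  have hwinv : AEStronglyMeasurable (fun z => (((w z)⁻¹ : ℝ) : ℂ)) volume :=
    (Complex.measurable_ofReal.comp_aemeasurable
      hw.aestronglyMeasurable.aemeasurable.inv).aestronglyMeasurable
  refine (lintegral_mono fun z => le_of_eq ?_).trans (lintegral_mul_le_mixedLNorm_mul_mixedLNorm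
    p p' q q' (hw.aestronglyMeasurable_mul (continuous_stft hg f).aestronglyMeasurable).enorm
    (hwinv.mul (continuous_stft hg h).aestronglyMeasurable).enorm)
  have hwz : (w z : ℂ) ≠ 0 := Complex.ofReal_ne_zero.2 (hw.pos z).ne'
  rw [← enorm_mul, Complex.ofReal_inv, mul_mul_mul_comm, mul_inv_cancel₀ hwz, one_mul, enorm_mul,
    enorm_mul, RCLike.enorm_conj]

theorem one_le_mul_modulationENorm_mul_modulationENorm (hg : g ≠ 0) (hw : IsModerateWeight w C N)
    (p p' q q' : ℝ≥0∞) [p.HolderConjugate p'] [q.HolderConjugate q']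
    {h : Lp ℂ 2 (volume : Measure 𝔼)} (hh : ‖h‖ = 1) :
    1 ≤ ENNReal.ofReal (gaborConst g)⁻¹ *
      (modulationENorm g w p q (Lp.toTemperedDistribution h)
        * modulationENorm g (fun z => (w z)⁻¹) p' q' (Lp.toTemperedDistribution h)) := by
  have hκ := gaborConst_pos hg
  have hhh := integral_stft_mul_conj_stft hg h h
  rw [inner_self_eq_norm_sq_to_K, hh, RCLike.ofReal_one, one_pow, mul_one] at hhh
  calc (1 : ℝ≥0∞) = ENNReal.ofReal (gaborConst g)⁻¹ * ‖(gaborConst g : ℂ)‖ₑ := by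
        rw [← ofReal_norm, Complex.norm_real, Real.norm_of_nonneg hκ.le,
          ← ENNReal.ofReal_mul (by positivity), inv_mul_cancel₀ hκ.ne', ENNReal.ofReal_one]
    _ ≤ _ := by
        rw [← hhh]
        gcongr
        exact (enorm_integral_le_lintegral_enorm _).trans
          (lintegral_stft_mul_conj_stft_le hg hw p p' q q' _ _)

end Duality

section Nuclear

theorem summable_rpow_of_le {ι : Type*} {r s : ℝ} (hr : 0 < r) (hrs : r ≤ s) {a : ι → ℝ}
    (ha : ∀ i, 0 ≤ a i) (h : Summable fun i => a i ^ r) : Summable fun i => a i ^ s := by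
  have hs : 0 < s := hr.trans_le hrs
  have hmem : Memℓp a (ENNReal.ofReal r) := memℓp_gen <| by
    simpa only [ENNReal.toReal_ofReal hr.le, Real.norm_of_nonneg (ha _)] using h
  simpa only [ENNReal.toReal_ofReal hs.le, Real.norm_of_nonneg (ha _)] using
    (hmem.of_exponent_ge (ENNReal.ofReal_le_ofReal hrs)).summable
      (by rwa [ENNReal.toReal_ofReal hs.le])

theorem summable_norm_rpow_mul_norm_rpow {ι E F : Type*} [SeminormedAddGroup E]
    [SeminormedAddGroup F] {r : ℝ} (hr : 0 ≤ r) {x : ι → E} {y : ι → F} {a : ι → ℝ≥0∞}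
    {K : ℝ≥0∞} (hK : K ≠ ∞) (ha : ∑' i, a i ^ r ≠ ∞) (hle : ∀ i, ‖x i‖ₑ * ‖y i‖ₑ ≤ K * a i) :
    Summable fun i => ‖x i‖ ^ r * ‖y i‖ ^ r := by
  have hsum : ∑' i, (‖x i‖ₑ * ‖y i‖ₑ) ^ r ≠ ∞ := by
    refine ne_top_of_le_ne_top (ENNReal.mul_ne_top (ENNReal.rpow_ne_top_of_nonneg hr hK) ha) ?_
    rw [← ENNReal.tsum_mul_left]
    refine ENNReal.tsum_le_tsum fun i => ?_
    rw [← ENNReal.mul_rpow_of_nonneg _ _ hr]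
    exact ENNReal.rpow_le_rpow (hle i) hr
  refine (ENNReal.summable_toReal hsum).congr fun i => ?_
  rw [← ENNReal.toReal_rpow, ENNReal.toReal_mul, toReal_enorm, toReal_enorm,
    Real.mul_rpow (norm_nonneg _) (norm_nonneg _)]

namespace IsNuclearRepresentation

variable {B : Type*} [SeminormedAddCommGroup B] [NormedSpace ℂ B] {T : B →L[ℂ] B} {φ : ℕ → B}
  {ψ : ℕ → B →L[ℂ] ℂ} {r s : ℝ}

theorem of_exponent_le (h : IsNuclearRepresentation r T φ ψ) (hr : 0 < r) (hrs : r ≤ s) :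
    IsNuclearRepresentation s T φ ψ where
  summable := by
    have hle := h.summable
    simp_rw [← Real.mul_rpow (norm_nonneg _) (norm_nonneg _)] at hle ⊢
    exact summable_rpow_of_le hr hrs (fun _ => by positivity) hle
  hasSum := h.hasSum

theorem summable_norm_apply (h : IsNuclearRepresentation 1 T φ ψ) :
    Summable fun j => ‖ψ j (φ j)‖ := by
  refine Summable.of_nonneg_of_le (fun _ => norm_nonneg _) (fun j => (ψ j).le_opNorm (φ j)) ?_
  simpa only [Real.rpow_one] using h.summable

end IsNuclearRepresentation

theorem exists_isNuclearRepresentation {B : Type*} [SeminormedAddCommGroup B] [NormedSpace ℂ B]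
    [CompleteSpace B] {φ : ℕ → B} {ψ : ℕ → B →L[ℂ] ℂ} {r : ℝ} (hr₀ : 0 < r) (hr₁ : r ≤ 1)
    (h : Summable fun j => ‖ψ j‖ ^ r * ‖φ j‖ ^ r) :
    ∃ T, IsNuclearRepresentation r T φ ψ := by
  have h₁ : Summable fun j => ‖(ψ j).smulRight (φ j)‖ := by
    simp_rw [← Real.mul_rpow (norm_nonneg _) (norm_nonneg _)] at h
    simpa only [ContinuousLinearMap.norm_smulRight_apply, Real.rpow_one] using
      summable_rpow_of_le hr₀ hr₁ (fun _ => by positivity) h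
  exact ⟨_, h, fun f => h₁.of_norm.hasSum.mapL (ContinuousLinearMap.apply ℂ B f)⟩

end Nuclear

section SpectralMultiplier

variable {H : Type*} [NormedAddCommGroup H] [InnerProductSpace ℂ H]

theorem mem_spectralDomain_of_norm_le (u : HilbertBasis ℕ ℂ H) {m : ℕ → ℂ} {c : ℝ}
    (hm : ∀ j, ‖m j‖ ≤ c) (f : H) : f ∈ spectralDomain u m := by
  refine memℓp_gen (((lp.memℓp (u.repr f)).summable (by norm_num)).mul_left (c ^ (2 : ℝ))
    |>.of_nonneg_of_le (fun j => by positivity) fun j => ?_)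
  have : 0 ≤ c := (norm_nonneg _).trans (hm 0)
  rw [ENNReal.toReal_ofNat, norm_mul, Real.mul_rpow (norm_nonneg _) (norm_nonneg _)]
  gcongr
  exact hm j

theorem hasSum_spectralMultiplier (u : HilbertBasis ℕ ℂ H) (m : ℕ → ℂ)
    (f : (spectralMultiplier u m).domain) :
    HasSum (fun j => (m j * ⟪u j, (f : H)⟫_ℂ) • u j) (spectralMultiplier u m f) := by
  refine (u.hasSum_repr_symm (spectralCoeff u m f)).congr_fun fun j => ?_
  rw [← u.repr_apply_apply]
  rfl

end SpectralMultiplier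

namespace ModulationSpace

variable {w : EuclideanSpace ℝ (Fin n) × EuclideanSpace ℝ (Fin n) → ℝ} {C : ℝ} {N : ℕ}
  {g : 𝓢(EuclideanSpace ℝ (Fin n), ℂ)} {p p' q q' : ℝ≥0∞}
  [hp : Fact (1 ≤ p)] [hp' : Fact (p ≠ ∞)] [hq : Fact (1 ≤ q)] [hq' : Fact (q ≠ ∞)]

theorem hasNuclearTrace_tsum (hg : g ≠ 0) (hw : IsModerateWeight w C N)
    {T : ModulationSpace g w p q →L[ℂ] ModulationSpace g w p q}
    {φ : ℕ → ModulationSpace g w p q} {ψ : ℕ → ModulationSpace g w p q →L[ℂ] ℂ}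
    (h : IsNuclearRepresentation 1 T φ ψ) : HasNuclearTrace T (∑' j, ψ j (φ j)) := by
  obtain ⟨t, ht⟩ := exists_forall_hasSum_trace hg hw T
  exact ⟨⟨φ, ψ, h⟩, (ht φ ψ h).tsum_eq ▸ ht⟩

section InnerFunctional

variable [p.HolderConjugate p'] [q.HolderConjugate q']

theorem lintegral_stft_mul_conj_stft_le_enorm_mul (hg : g ≠ 0) (hw : IsModerateWeight w C N)
    (p' q' : ℝ≥0∞) [p.HolderConjugate p'] [q.HolderConjugate q'] (h : 𝓢'(𝔼, ℂ))
    (a : ModulationSpace g w p q) :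
    ∫⁻ z, ‖stft g (toDistribution a) z * (starRingEnd ℂ) (stft g h z)‖ₑ
      ≤ ‖a‖ₑ * modulationENorm g (fun z => (w z)⁻¹) p' q' h :=
  (enorm_eq a).symm ▸ lintegral_stft_mul_conj_stft_le hg hw p p' q q' _ _

theorem integrable_stft_mul_conj_stft (hg : g ≠ 0) (hw : IsModerateWeight w C N) {h : 𝓢'(𝔼, ℂ)}
    (hh : modulationENorm g (fun z => (w z)⁻¹) p' q' h ≠ ∞) (a : ModulationSpace g w p q) :
    Integrable fun z => stft g (toDistribution a) z * (starRingEnd ℂ) (stft g h z) :=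
  ⟨((continuous_stft hg _).mul
    (Complex.continuous_conj.comp (continuous_stft hg _))).aestronglyMeasurable,
    (lintegral_stft_mul_conj_stft_le_enorm_mul hg hw p' q' h a).trans_lt
      (ENNReal.mul_lt_top enorm_lt_top hh.lt_top)⟩

theorem exists_functional_eq_inner (hg : g ≠ 0) (hw : IsModerateWeight w C N)
    {h : Lp ℂ 2 (volume : Measure 𝔼)}
    (hh : modulationENorm g (fun z => (w z)⁻¹) p' q' (Lp.toTemperedDistribution h) ≠ ∞) :
    ∃ ψ : ModulationSpace g w p q →L[ℂ] ℂ,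
      ‖ψ‖ₑ ≤ ENNReal.ofReal (gaborConst g)⁻¹
        * modulationENorm g (fun z => (w z)⁻¹) p' q' (Lp.toTemperedDistribution h) ∧
      ∀ a f, toDistribution a = Lp.toTemperedDistribution f → ψ a = ⟪h, f⟫_ℂ := by
  have hκ := gaborConst_pos hg
  have hint := integrable_stft_mul_conj_stft (p := p) (q := q) hg hw hh
  let L : ModulationSpace g w p q →ₗ[ℂ] ℂ :=
    { toFun a := ((gaborConst g)⁻¹ : ℝ) * ∫ z, stft g (toDistribution a) z *
        (starRingEnd ℂ) (stft g (Lp.toTemperedDistribution h) z)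
      map_add' a b := by
        rw [← mul_add, ← integral_add (hint a) (hint b)]
        simp only [map_add, stft, add_apply, add_mul]
      map_smul' c a := by
        rw [RingHom.id_apply, smul_eq_mul, mul_left_comm, ← integral_const_mul c]
        simp only [map_smul, stft, smul_apply, smul_eq_mul, mul_assoc] }
  have hL (a : ModulationSpace g w p q) : ‖L a‖ₑ ≤ ENNReal.ofReal (gaborConst g)⁻¹
      * modulationENorm g (fun z => (w z)⁻¹) p' q' (Lp.toTemperedDistribution h) * ‖a‖ₑ := by
    rw [mul_assoc, mul_comm _ ‖a‖ₑ, LinearMap.coe_mk, AddHom.coe_mk, enorm_mul, ← ofReal_norm,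
      Complex.norm_real, Real.norm_of_nonneg (by positivity)]
    gcongr
    exact (enorm_integral_le_lintegral_enorm _).trans
      (lintegral_stft_mul_conj_stft_le_enorm_mul hg hw p' q' _ a)
  obtain ⟨ψ, hψ, hψL⟩ :=
    exists_continuousLinearMap_of_enorm_le L (ENNReal.mul_ne_top ENNReal.ofReal_ne_top hh) hL
  refine ⟨ψ, hψL, fun a f haf => ?_⟩
  rw [hψ, LinearMap.coe_mk, AddHom.coe_mk, haf, integral_stft_mul_conj_stft hg, Complex.ofReal_inv,
    inv_mul_cancel_left₀ (Complex.ofReal_ne_zero.2 hκ.ne')]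

theorem exists_rankOne_eq_inner_smul (hg : g ≠ 0) (hw : IsModerateWeight w C N)
    {h : Lp ℂ 2 (volume : Measure 𝔼)} (hh : ‖h‖ = 1) {m : ℂ}
    (hm : ‖m‖ₑ * modulationENorm g w p q (Lp.toTemperedDistribution h)
      * modulationENorm g (fun z => (w z)⁻¹) p' q' (Lp.toTemperedDistribution h) ≠ ∞) :
    ∃ (φ : ModulationSpace g w p q) (ψ : ModulationSpace g w p q →L[ℂ] ℂ),
      ‖ψ‖ₑ * ‖φ‖ₑ ≤ ENNReal.ofReal (gaborConst g)⁻¹ *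
        (‖m‖ₑ * modulationENorm g w p q (Lp.toTemperedDistribution h)
          * modulationENorm g (fun z => (w z)⁻¹) p' q' (Lp.toTemperedDistribution h)) ∧
      ψ φ = m ∧
      ∀ a f, toDistribution a = Lp.toTemperedDistribution f →
        toDistribution (ψ a • φ) = Lp.toTemperedDistribution ((m * ⟪h, f⟫_ℂ) • h) := by
  have hsmul : ∀ (c : ℂ) (f : Lp ℂ 2 (volume : Measure 𝔼)),
      Lp.toTemperedDistribution (c • f) = c • Lp.toTemperedDistribution f := fun c f =>
    map_smul (Lp.toTemperedDistributionCLM ℂ volume 2) c f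
  rcases eq_or_ne m 0 with rfl | hm₀
  · refine ⟨0, 0, ?_, rfl, fun a f _ => ?_⟩
    · rw [← ofReal_norm (0 : ModulationSpace g w p q), norm_zero, ENNReal.ofReal_zero, mul_zero]
      exact bot_le
    · rw [smul_zero, map_zero, zero_mul, hsmul, zero_smul]
  set A := modulationENorm g w p q (Lp.toTemperedDistribution h) with hA
  set B := modulationENorm g (fun z => (w z)⁻¹) p' q' (Lp.toTemperedDistribution h)
  have hAB : A * B ≠ ∞ := fun hAB =>
    hm (by rw [mul_assoc, hAB, ENNReal.mul_top (enorm_ne_zero.2 hm₀)])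
  have hAB₀ : A * B ≠ 0 := right_ne_zero_of_mul (zero_lt_one.trans_le
    (one_le_mul_modulationENorm_mul_modulationENorm hg hw p p' q q' hh)).ne'
  have hAtop : A ≠ ∞ := fun h => hAB (by rw [h, ENNReal.top_mul (right_ne_zero_of_mul hAB₀)])
  have hBtop : B ≠ ∞ := fun h => hAB (by rw [h, ENNReal.mul_top (left_ne_zero_of_mul hAB₀)])
  obtain ⟨b, hb⟩ := exists_toDistribution_eq (p := p) (q := q) hg hw hAtop
  obtain ⟨ψ, hψB, hψ⟩ := exists_functional_eq_inner (p := p) (q := q) hg hw hBtop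
  refine ⟨m • b, ψ, ?_, ?_, fun a f haf => ?_⟩
  · rw [enorm_smul, enorm_eq, hb, ← hA]
    calc ‖ψ‖ₑ * (‖m‖ₑ * A) ≤ ENNReal.ofReal (gaborConst g)⁻¹ * B * (‖m‖ₑ * A) := by gcongr
      _ = ENNReal.ofReal (gaborConst g)⁻¹ * (‖m‖ₑ * A * B) := by ring
  · rw [map_smul, hψ b h hb, inner_self_eq_norm_sq_to_K, hh, RCLike.ofReal_one, one_pow,
      smul_eq_mul, mul_one]
  · rw [hψ a f haf, map_smul, map_smul, hb, hsmul, mul_smul, smul_comm]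

end InnerFunctional

theorem isRealization_spectralMultiplier (hg : g ≠ 0) (hw : IsModerateWeight w C N)
    {u : HilbertBasis ℕ ℂ (Lp ℂ 2 (volume : Measure 𝔼))} {m : ℕ → ℂ} {c : ℝ}
    (hm : ∀ j, ‖m j‖ ≤ c) {T : ModulationSpace g w p q →L[ℂ] ModulationSpace g w p q}
    {φ : ℕ → ModulationSpace g w p q} {ψ : ℕ → ModulationSpace g w p q →L[ℂ] ℂ}
    (hT : ∀ a, HasSum (fun j => ψ j a • φ j) (T a))
    (hψφ : ∀ j a f, toDistribution a = Lp.toTemperedDistribution f →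
      toDistribution (ψ j a • φ j) = Lp.toTemperedDistribution ((m j * ⟪u j, f⟫_ℂ) • u j)) :
    IsRealization (spectralMultiplier u m) T where
  dense := by
    refine (dense_lp_two (p := p) (q := q) hg hw).mono ?_
    rintro a ⟨f, hf⟩
    exact ⟨⟨f, mem_spectralDomain_of_norm_le u hm f⟩, hf⟩
  agrees a f haf := by
    ext χ
    obtain ⟨e, he⟩ := exists_continuousLinearMap_eq_apply (p := p) (q := q) hg hw χ
    obtain ⟨e', he'⟩ := exists_continuousLinearMap_eq_lp_apply χ
    rw [← he, ← he']
    refine ((hT a).mapL e).unique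
      (((hasSum_spectralMultiplier u m f).mapL e').congr_fun fun j => ?_)
    rw [he, he', hψφ j a f haf]

theorem exists_isNuclearRepresentation_inner_smul [p.HolderConjugate p'] [q.HolderConjugate q']
    (hg : g ≠ 0) (hw : IsModerateWeight w C N) {h : ℕ → Lp ℂ 2 (volume : Measure 𝔼)}
    (hh : ∀ j, ‖h j‖ = 1) {m : ℕ → ℂ} {r : ℝ} (hr₀ : 0 < r) (hr₁ : r ≤ 1)
    (hsum : ∑' j, ‖m j‖ₑ ^ r * modulationENorm g w p q (Lp.toTemperedDistribution (h j)) ^ r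
      * modulationENorm g (fun z => (w z)⁻¹) p' q' (Lp.toTemperedDistribution (h j)) ^ r ≠ ∞) :
    ∃ (T : ModulationSpace g w p q →L[ℂ] ModulationSpace g w p q)
      (φ : ℕ → ModulationSpace g w p q) (ψ : ℕ → ModulationSpace g w p q →L[ℂ] ℂ),
      IsNuclearRepresentation r T φ ψ ∧ (∀ j, ψ j (φ j) = m j) ∧
      ∀ j a f, toDistribution a = Lp.toTemperedDistribution f →
        toDistribution (ψ j a • φ j) = Lp.toTemperedDistribution ((m j * ⟪h j, f⟫_ℂ) • h j) := by
  simp only [← ENNReal.mul_rpow_of_nonneg _ _ hr₀.le] at hsum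
  have hfin (j : ℕ) : ‖m j‖ₑ * modulationENorm g w p q (Lp.toTemperedDistribution (h j))
      * modulationENorm g (fun z => (w z)⁻¹) p' q' (Lp.toTemperedDistribution (h j)) ≠ ∞ :=
    fun hj => ENNReal.ne_top_of_tsum_ne_top hsum j (by rw [hj, ENNReal.top_rpow_of_pos hr₀])
  choose φ ψ hle hψφ hspec using fun j => exists_rankOne_eq_inner_smul hg hw (hh j) (hfin j)
  have := completeSpace (p := p) (q := q) hg hw
  have hφψ : Summable fun j => ‖ψ j‖ ^ r * ‖φ j‖ ^ r :=
    summable_norm_rpow_mul_norm_rpow hr₀.le ENNReal.ofReal_ne_top hsum hle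
  obtain ⟨T, hT⟩ := exists_isNuclearRepresentation hr₀ hr₁ hφψ
  exact ⟨T, φ, ψ, hT, hψφ, hspec⟩

end ModulationSpace

end TimeFrequency

open ModulationSpace in
theorem theorem5p4_general {n : ℕ}
    (u : HilbertBasis ℕ ℂ (Lp ℂ 2 (volume : Measure (EuclideanSpace ℝ (Fin n))))) (m : ℕ → ℂ)
    {g : 𝓢(EuclideanSpace ℝ (Fin n), ℂ)} (hg : g ≠ 0)
    {w : EuclideanSpace ℝ (Fin n) × EuclideanSpace ℝ (Fin n) → ℝ} (hw : IsWeight w)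
    (hw_mod : IsPolynomiallyModerate w)
    {p q : ℝ≥0∞} [hp : Fact (1 ≤ p)] [Fact (p ≠ ∞)] [hq : Fact (1 ≤ q)] [Fact (q ≠ ∞)]
    {r : ℝ} (hr₀ : 0 < r) (hr₁ : r ≤ 1)
    (hsum : ∑' j, ‖m j‖ₑ ^ r
        * modulationENorm g w p q (Lp.toTemperedDistribution (u j)) ^ r
        * modulationENorm g (fun z => (w z)⁻¹) p.conjExponent q.conjExponent
            (Lp.toTemperedDistribution (u j)) ^ r < ∞) :
    ∃ T : ModulationSpace g w p q →L[ℂ] ModulationSpace g w p q,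
      IsRealization (spectralMultiplier u m) T ∧ IsRNuclear r T ∧
        Summable (fun j => ‖m j‖) ∧ HasNuclearTrace T (∑' j, m j) := by
  obtain ⟨C, N, hwC⟩ := hw.exists_isModerateWeight hw_mod
  have := ENNReal.HolderConjugate.conjExponent hp.out
  have := ENNReal.HolderConjugate.conjExponent hq.out
  obtain ⟨T, φ, ψ, hT, hψφ, hspec⟩ :=
    exists_isNuclearRepresentation_inner_smul hg hwC u.orthonormal.1 hr₀ hr₁ hsum.ne
  have hT₁ := hT.of_exponent_le hr₀ hr₁
  have hm : Summable fun j => ‖m j‖ := by simpa only [hψφ] using hT₁.summable_norm_apply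
  refine ⟨T, isRealization_spectralMultiplier hg hwC
    (fun j => hm.le_tsum j fun _ _ => norm_nonneg _) hT.hasSum hspec, ⟨φ, ψ, hT⟩, hm, ?_⟩
  simpa only [hψφ] using hasNuclearTrace_tsum hg hwC hT₁

theorem theorem5p4 {n k l : ℕ} (hk : 1 ≤ k) (hl : 1 ≤ l)
    (u : HilbertBasis ℕ ℂ (Lp ℂ 2 (volume : Measure (EuclideanSpace ℝ (Fin n)))))
    (lam : ℕ → ℝ) (hu : IsAnharmonicEigenbasis k l u lam)
    (F : ℝ → ℂ)
    (g : 𝓢(EuclideanSpace ℝ (Fin n), ℂ)) (hg : g ≠ 0)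
    (w : EuclideanSpace ℝ (Fin n) × EuclideanSpace ℝ (Fin n) → ℝ) (hw : IsWeight w)
    (hw_sub : IsSubmultiplicativeWeight w) (hw_mod : IsPolynomiallyModerate w)
    (p q : ℝ≥0∞) [Fact (1 ≤ p)] [Fact (p ≠ ∞)] [Fact (1 ≤ q)] [Fact (q ≠ ∞)]
    (r : ℝ) (hr0 : 0 < r) (hr1 : r ≤ 1)
    (hsum : ∑' j, ‖F (lam j)‖ₑ ^ r
        * modulationENorm g w p q (Lp.toTemperedDistribution (u j)) ^ r
        * modulationENorm g (fun z => (w z)⁻¹) p.conjExponent q.conjExponent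
            (Lp.toTemperedDistribution (u j)) ^ r < ∞) :
    ∃ T : ModulationSpace g w p q →L[ℂ] ModulationSpace g w p q,
      IsRealization (spectralMultiplier u (fun j => F (lam j))) T ∧
      IsRNuclear r T ∧
      (r = 1 →
        Summable (fun j => ‖F (lam j)‖) ∧ HasNuclearTrace T (∑' j, F (lam j))) := by
  obtain ⟨T, hT, hnuclear, hsummable, htrace⟩ :=
    theorem5p4_general u (fun j => F (lam j)) hg hw hw_mod hr0 hr1 hsum
  exact ⟨T, hT, hnuclear, fun _ => ⟨hsummable, htrace⟩⟩
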